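/- Let $\mu$ be a $\sigma$-finite measure on a measurable space $\Omega$, let $F_0,F_1$ be probability distributions with $\mu$-a.e. positive densities $f_0,f_1$ (the nominal distributions), and put $l=f_1/f_0$. Let $\epsilon_0,\epsilon_1>0$ and $$\mathscr G_j=\{G_j \text{ a probability distribution}: D_{\mathrm{KL}}(G_j,F_j)\le\epsilon_j\},\qquad j\in\{0,1\},$$ and assume $\mathscr G_0\cap\mathscr G_1=\emptyset$. Let $W$ be the principal branch of the Lambert function, the inverse of $w\mapsto we^w$ on $[-1,\infty)$. For $\lambda_0,\lambda_1>0$ and $\mu_0,\mu_1\in\mathbb R$ let $$\hat g_0=\Big(\lambda_1+\tfrac{\lambda_1}{\lambda_0}\Big)^{-\frac1{\lambda_0}}\exp\Big[-1-\tfrac{1+\mu_0}{\lambda_0}\Big]\,W\left[\frac{\lambda_0\exp\Big[\frac{-\lambda_1-\lambda_1\mu_0+\lambda_0\mu_1}{(1+\lambda_0)\lambda_1}\Big]\,l^{-\frac{\lambda_0}{1+\lambda_0}}}{(1+\lambda_0)\lambda_1}\right]^{-\frac1{\lambda_0}}f_0,$$ $$\hat g_1=\Big(\lambda_1+\tfrac{\lambda_1}{\lambda_0}\Big)^{-\frac{1+\lambda_0}{\lambda_0}}\exp\Big[-1-\tfrac{1+\mu_0}{\lambda_0}\Big]\,W\left[\frac{\lambda_0\exp\Big[\frac{-\lambda_1-\lambda_1\mu_0+\lambda_0\mu_1}{(1+\lambda_0)\lambda_1}\Big]\,l^{-\frac{\lambda_0}{1+\lambda_0}}}{(1+\lambda_0)\lambda_1}\right]^{-\frac{1+\lambda_0}{\lambda_0}}f_0,$$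 and write $\hat G_0,\hat G_1$ for the measures with these densities with respect to $\mu$. Consider the four equations $$\int_\Omega\hat g_0\,d\mu=1,\qquad \int_\Omega\hat g_1\,d\mu=1,\qquad D_{\mathrm{KL}}(\hat G_0,F_0)=\epsilon_0,\qquad D_{\mathrm{KL}}(\hat G_1,F_1)=\epsilon_1. \tag{$*$}$$ **Type I.** The system $(*)$ has a solution with $\lambda_0,\lambda_1>0$. For every such solution, $\hat g_0$ and $\hat g_1$ are $\mu$-a.e. positive probability densities, and $(\hat G_0,\hat G_1)$ is the unique minimizer of $D_{\mathrm{KL}}(G_0,G_1)$ over $(G_0,G_1)\in\mathscr G_0\times\mathscr G_1$. Moreover, put $X=\log(\hat g_1/\hat g_0)$, and for i.i.d. observations $Y_1,Y_2,\dots$ let $S_n=\frac1n\sum_{k=1}^nX(Y_k)$. Then $X$ is $\hat G_0$-integrable, and the test that compares $S_n$ with the Type-I threshold $t_0=\mathbb E_{\hat G_0}[X]$ is asymptotically minimax robust: as $n\to\infty$, $$\tfrac1n\log\hat G_0[S_n>t_0]\to0,\qquad \tfrac1n\log\hat G_1[S_n\le t_0]\to-D_{\mathrm{KL}}(\hat G_0,\hat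 G_1),$$ and for all $(G_0,G_1)\in\mathscr G_0\times\mathscr G_1$ the upper limits of $\frac1n\log G_0[S_n>t_0]$ and of $\frac1n\log G_1[S_n\le t_0]$ do not exceed these two limits, respectively. **Type II.** Interchange $(\epsilon_0,f_0)$ with $(\epsilon_1,f_1)$ in the formulas for $\hat g_0,\hat g_1$ and in $(*)$, and afterwards interchange $\hat g_0$ with $\hat g_1$. The resulting system again has a solution with $\lambda_0,\lambda_1>0$. For every such solution, $\hat g_0$ and $\hat g_1$ are $\mu$-a.e. positive probability densities, and $(\hat G_0,\hat G_1)$ is the unique minimizer of $D_{\mathrm{KL}}(G_1,G_0)$ over $\mathscr G_0\times\mathscr G_1$. With $X=\log(\hat g_1/\hat g_0)$, which is $\hat G_1$-integrable, the test with the Type-II threshold $t_1=\mathbb E_{\hat G_1}[X]$ is asymptotically minimax robust in the same sense, now with the limits $$\tfrac1n\log\hat G_1[S_n\le t_1]\to0,\qquad \tfrac1n\log\hat G_0[S_n>t_1]\to-D_{\mathrm{KL}}(\hat G_1,\hat G_0).$$ -/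

import Mathlib

open MeasureTheory Filter Topology InformationTheory
open scoped ENNReal

noncomputable section

namespace RobustNP

/-! ### The Lambert function -/

/-- The principal branch `W` of the Lambert function: for `x ≥ -1/e`, `lambertW x` is the unique
real number `w ≥ -1` with `w * exp w = x`. -/
def lambertW (x : ℝ) : ℝ :=
  Function.invFunOn (fun w : ℝ => w * Real.exp w) (Set.Ici (-1)) x

theorem strictMonoOn_mul_exp : StrictMonoOn (fun w : ℝ => w * Real.exp w) (Set.Ici (-1)) := by
  apply strictMonoOn_of_deriv_pos (convex_Ici _) (by fun_prop)
  intro x hx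
  rw [interior_Ici, Set.mem_Ioi] at hx
  have h : HasDerivAt (fun w : ℝ => w * Real.exp w) (1 * Real.exp x + x * Real.exp x) x :=
    (hasDerivAt_id x).mul (Real.hasDerivAt_exp x)
  rw [h.deriv, ← add_mul]
  exact mul_pos (by linarith) (Real.exp_pos x)

theorem lambertW_mul_exp_self {w : ℝ} (hw : -1 ≤ w) : lambertW (w * Real.exp w) = w :=
  strictMonoOn_mul_exp.injOn.leftInvOn_invFunOn hw

theorem lambertW_spec {x : ℝ} (hx : -Real.exp (-1) ≤ x) :
    -1 ≤ lambertW x ∧ lambertW x * Real.exp (lambertW x) = x := by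
  have hb : (-1 : ℝ) ≤ max x 0 := le_trans (by norm_num) (le_max_right x 0)
  have h2 : x ≤ max x 0 * Real.exp (max x 0) := by
    have h1 : 1 ≤ Real.exp (max x 0) := Real.one_le_exp (le_max_right x 0)
    nlinarith [le_max_left x 0, le_max_right x 0]
  obtain ⟨w, hw, hwx⟩ := intermediate_value_Icc hb
    (f := fun w : ℝ => w * Real.exp w) (by fun_prop) ⟨by linarith, h2⟩
  have hwx' : w * Real.exp w = x := hwx
  rw [← hwx', lambertW_mul_exp_self hw.1]
  exact ⟨hw.1, rfl⟩

/-! ### Densities, uncertainty classes and least favorable distributions -/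

section Classes

variable {Ω : Type*} [MeasurableSpace Ω]

/-- `g` is an a.e. positive probability density with respect to `μ`. -/
def IsPosDensity (μ : Measure Ω) (g : Ω → ℝ) : Prop :=
  Measurable g ∧ (∀ᵐ y ∂μ, 0 < g y) ∧ Integrable g μ ∧ ∫ y, g y ∂μ = 1

/-- The distribution with density `g` with respect to `μ`. -/
def distOf (μ : Measure Ω) (g : Ω → ℝ) : Measure Ω :=
  μ.withDensity fun y => ENNReal.ofReal (g y)

/-- The Kullback-Leibler neighborhood: all probability distributions `G` with
`D_KL(G, F) ≤ ε`. -/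
def klClass (F : Measure Ω) (ε : ℝ) : Set (Measure Ω) :=
  {G | IsProbabilityMeasure G ∧ klDiv G F ≤ ENNReal.ofReal ε}

/-- `(G₀, G₁)` minimizes `D_KL(G₀, G₁)` over `𝒢₀ × 𝒢₁`. -/
def IsTypeILeastFavorable (𝒢₀ 𝒢₁ : Set (Measure Ω)) (G₀ G₁ : Measure Ω) : Prop :=
  G₀ ∈ 𝒢₀ ∧ G₁ ∈ 𝒢₁ ∧ ∀ H₀ ∈ 𝒢₀, ∀ H₁ ∈ 𝒢₁, klDiv G₀ G₁ ≤ klDiv H₀ H₁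

/-- `(G₀, G₁)` minimizes `D_KL(G₁, G₀)` over `𝒢₀ × 𝒢₁`. -/
def IsTypeIILeastFavorable (𝒢₀ 𝒢₁ : Set (Measure Ω)) (G₀ G₁ : Measure Ω) : Prop :=
  G₀ ∈ 𝒢₀ ∧ G₁ ∈ 𝒢₁ ∧ ∀ H₀ ∈ 𝒢₀, ∀ H₁ ∈ 𝒢₁, klDiv G₁ G₀ ≤ klDiv H₁ H₀

end Classes

/-! ### Log-likelihood ratio tests and asymptotic minimax robustness -/

section Tests

variable {Ω : Type*} [MeasurableSpace Ω]

/-- The empirical mean `S_n = (1/n) ∑ X(y_k)`. -/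
def empMean (X : Ω → ℝ) (n : ℕ) (y : Fin n → Ω) : ℝ := (∑ k, X (y k)) / n

/-- `(1/n) log G[S_n > t]`, the observations being i.i.d. with law `G`. -/
def upperRate (X : Ω → ℝ) (t : ℝ) (G : Measure Ω) (n : ℕ) : EReal :=
  ENNReal.log (Measure.pi (fun _ : Fin n => G) {y | t < empMean X n y}) / (n : EReal)

/-- `(1/n) log G[S_n ≤ t]`, the observations being i.i.d. with law `G`. -/
def lowerRate (X : Ω → ℝ) (t : ℝ) (G : Measure Ω) (n : ℕ) : EReal :=
  ENNReal.log (Measure.pi (fun _ : Fin n => G) {y | empMean X n y ≤ t}) / (n : EReal)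

/-- The test that compares the empirical mean of `X` to the threshold `t` is asymptotically minimax
robust, with `(G₀, G₁)` least favorable: under `(G₀, G₁)` both error exponents exist,
and no other member of the classes has a slower decay of its error probability. -/
def IsAsymptoticallyMinimaxRobust (𝒢₀ 𝒢₁ : Set (Measure Ω)) (G₀ G₁ : Measure Ω)
    (X : Ω → ℝ) (t : ℝ) : Prop :=
  ∃ a₀ a₁ : EReal,
    Tendsto (upperRate X t G₀) atTop (𝓝 a₀) ∧ Tendsto (lowerRate X t G₁) atTop (𝓝 a₁) ∧
    (∀ H₀ ∈ 𝒢₀, limsup (upperRate X t H₀) atTop ≤ a₀) ∧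
    (∀ H₁ ∈ 𝒢₁, limsup (lowerRate X t H₁) atTop ≤ a₁)

end Tests

/-! ### The parametric densities -/

section Parametric

variable {Ω : Type*}

/-- The value of the Lambert function that occurs in both parametric densities, as a function of
the nominal likelihood ratio `l`. -/
def lambertTerm (lam₀ lam₁ mu₀ mu₁ l : ℝ) : ℝ :=
  lambertW (lam₀ * Real.exp ((-lam₁ - lam₁ * mu₀ + lam₀ * mu₁) / ((1 + lam₀) * lam₁))
    * l ^ (-(lam₀ / (1 + lam₀))) / ((1 + lam₀) * lam₁))

/-- The first parametric density, built from the nominal densities `f₀` and `f₁`. -/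
def paramDensity₀ (lam₀ lam₁ mu₀ mu₁ : ℝ) (f₀ f₁ : Ω → ℝ) (y : Ω) : ℝ :=
  (lam₁ + lam₁ / lam₀) ^ (-(1 / lam₀)) * Real.exp (-1 - (1 + mu₀) / lam₀)
    * lambertTerm lam₀ lam₁ mu₀ mu₁ (f₁ y / f₀ y) ^ (-(1 / lam₀)) * f₀ y

/-- The second parametric density, built from the nominal densities `f₀` and `f₁`. -/
def paramDensity₁ (lam₀ lam₁ mu₀ mu₁ : ℝ) (f₀ f₁ : Ω → ℝ) (y : Ω) : ℝ :=
  (lam₁ + lam₁ / lam₀) ^ (-((1 + lam₀) / lam₀)) * Real.exp (-1 - (1 + mu₀) / lam₀)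
    * lambertTerm lam₀ lam₁ mu₀ mu₁ (f₁ y / f₀ y) ^ (-((1 + lam₀) / lam₀)) * f₀ y

/-- The four equations for the parameters: both parametric densities have mass one, and their
distributions lie at divergence exactly `ε₀` and `ε₁` from the nominal ones. -/
def ParamEquations [MeasurableSpace Ω] (μ : Measure Ω) (f₀ f₁ : Ω → ℝ) (ε₀ ε₁ : ℝ)
    (lam₀ lam₁ mu₀ mu₁ : ℝ) : Prop :=
  ∫ y, paramDensity₀ lam₀ lam₁ mu₀ mu₁ f₀ f₁ y ∂μ = 1 ∧
  ∫ y, paramDensity₁ lam₀ lam₁ mu₀ mu₁ f₀ f₁ y ∂μ = 1 ∧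
  klDiv (distOf μ (paramDensity₀ lam₀ lam₁ mu₀ mu₁ f₀ f₁)) (distOf μ f₀) = ENNReal.ofReal ε₀ ∧
  klDiv (distOf μ (paramDensity₁ lam₀ lam₁ mu₀ mu₁ f₀ f₁)) (distOf μ f₁) = ENNReal.ofReal ε₁

end Parametric

end RobustNP

end

/-!
The Type-I problem minimizes the jointly convex functional `D_KL(G₀, G₁)` under two convex
constraints, and the parametric densities are the pointwise minimizers of its Lagrangian with
multipliers `lam₀`, `lam₁` for the divergences and `mu₀`, `mu₁` for the masses: the Lambert function
solves the stationarity equations for the ratio `u = g₀ / g₁` (`paramDensity₀_stationary`,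
`paramDensity₁_stationary`), and the Gibbs inequality shows that a stationary point is a minimizer
(`lagrangian_ge`). Type II is Type I with the two nominal distributions interchanged.

*Sufficiency.* A solution of the four equations is a KKT pair. For such a pair the mean of `u` under
every member of the second class is at most one (`IsKKTPair.lintegral_ratio_le`), since `u` is affine
in `log (g₁ / f₁)`, and the mean of `log u` under a member of the first class is at least
`D_KL(G₀, G₁)` (whenever it is defined), since `log u` is affine and decreasing in `log (g₀ / f₀)`. With the Gibbs inequality
for `log u` this gives minimality, and the equality cases of the Gibbs inequality give uniqueness
(`IsKKTPair.isTypeILeastFavorable_iff`).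

*Error exponents.* The bound on the mean of `u` makes the Chernoff bound with exponent one uniform
over the second class (`pi_le_empMean_le`). The matching lower bounds come from a change of measure to
a slightly tilted `G₀`, under which the statistic has its mean strictly on the required side of
the threshold, together with the law of large numbers (`eventually_le_rate_at_mean`). The statistic is
not constant because the two classes are disjoint.

*Existence.* Pointwise minimization of the Lagrangian gives the dual function of the four multipliers,
which is finite and continuous where `lam₀, lam₁ > 0` because the parametric densities are dominated
by `f₀ + f₁` locally uniformly in the parameters (`paramDensity_bounds`). Disjointness of
the classes makes it positive somewhere (`exists_dualFun_pos`): the geometric mixture of `f₀` and `f₁`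
on the boundary of the first neighborhood lies outside the second one, and truncating the
log-likelihood ratio turns this into an explicit dual certificate. Testing the Lagrangian at (rescaled)
geometric mixtures confines the positive superlevel sets of the dual function to a compact box inside
the domain (`exists_box`), so the maximum is attained. The residuals of the four equations form
a continuous supergradient (`dualFun_le_supergradient`), which vanishes at the maximum
(`exists_paramEquations`).
-/

noncomputable section

namespace RobustNP

/-! ### The Lambert function on the positive axis -/

theorem lambertW_pos_spec {x : ℝ} (hx : 0 < x) :
    0 < lambertW x ∧ lambertW x * Real.exp (lambertW x) = x := by
  obtain ⟨-, h⟩ := lambertW_spec (x := x) (by linarith [Real.exp_pos (-1)])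
  refine ⟨?_, h⟩
  by_contra hneg
  nlinarith [Real.exp_pos (lambertW x)]

theorem log_lambertW_add {x : ℝ} (hx : 0 < x) :
    Real.log (lambertW x) + lambertW x = Real.log x := by
  obtain ⟨hw, h⟩ := lambertW_pos_spec hx
  conv_rhs => rw [← h]
  rw [Real.log_mul hw.ne' (Real.exp_pos _).ne', Real.log_exp]

theorem monotoneOn_lambertW : MonotoneOn lambertW (Set.Ici (-Real.exp (-1))) := by
  intro x hx y hy hxy
  obtain ⟨hx1, hx2⟩ := lambertW_spec hx
  obtain ⟨hy1, hy2⟩ := lambertW_spec hy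
  have := strictMonoOn_mul_exp.le_iff_le (a := lambertW x) (b := lambertW y) hx1 hy1
  exact this.1 (by simpa only [hx2, hy2] using hxy)

theorem continuousAt_lambertW {x : ℝ} (hx : 0 < x) : ContinuousAt lambertW x := by
  have hsub : Set.Ioi (0 : ℝ) ⊆ Set.Ici (-Real.exp (-1)) := fun y hy => by
    have hy' : (0 : ℝ) < y := hy
    show -Real.exp (-1) ≤ y
    linarith [Real.exp_pos (-1)]
  refine continuousAt_of_monotoneOn_of_image_mem_nhds (monotoneOn_lambertW.mono hsub)
    (Ioi_mem_nhds hx) ?_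
  refine mem_of_superset (Ioi_mem_nhds (lambertW_pos_spec hx).1) fun w hw => ?_
  have hw' : (0 : ℝ) < w := hw
  exact ⟨w * Real.exp w, mul_pos hw' (Real.exp_pos w), lambertW_mul_exp_self (by linarith)⟩

/-- Below the branch point the value of `lambertW` is a constant, so `lambertW` is measurable
on the whole line. -/
theorem measurable_lambertW : Measurable lambertW := by
  have hmono : Monotone fun x => lambertW (max x (-Real.exp (-1))) := fun x y hxy =>
    monotoneOn_lambertW (Set.mem_Ici.2 (le_max_right _ _)) (Set.mem_Ici.2 (le_max_right _ _))
      (max_le_max_right _ hxy)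
  have hconst : ∀ x < -Real.exp (-1), lambertW x = lambertW (-Real.exp (-1) - 1) := by
    have hno : ∀ x < -Real.exp (-1), ¬ ∃ a ∈ Set.Ici (-1 : ℝ), a * Real.exp a = x := by
      rintro x hx ⟨a, ha, rfl⟩
      have := strictMonoOn_mul_exp.monotoneOn (a := -1) (b := a) (by simp) ha ha
      linarith
    intro x hx
    unfold lambertW Function.invFunOn
    rw [dif_neg (hno x hx), dif_neg (hno _ (by linarith))]
  have heq : lambertW = fun x => if x < -Real.exp (-1) then lambertW (-Real.exp (-1) - 1)
      else lambertW (max x (-Real.exp (-1))) := by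
    funext x
    split_ifs with h
    · exact hconst x h
    · rw [max_eq_left (not_lt.1 h)]
  rw [heq]
  exact Measurable.ite measurableSet_Iio measurable_const hmono.measurable

/-! ### Pointwise optimality of the parametric densities -/

/-- The ratio `paramDensity₀ / paramDensity₁` as a function of the nominal likelihood ratio. -/
def densityRatio (lam₀ lam₁ mu₀ mu₁ l : ℝ) : ℝ :=
  (lam₁ + lam₁ / lam₀) * lambertTerm lam₀ lam₁ mu₀ mu₁ l

section Pointwise

variable {Ω : Type*} {lam₀ lam₁ mu₀ mu₁ : ℝ} {f₀ f₁ : Ω → ℝ} {y : Ω}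

theorem lambertTerm_pos {l : ℝ} (h₀ : 0 < lam₀) (h₁ : 0 < lam₁) (hl : 0 < l) :
    0 < lambertTerm lam₀ lam₁ mu₀ mu₁ l :=
  (lambertW_pos_spec (by positivity)).1

theorem densityRatio_pos {l : ℝ} (h₀ : 0 < lam₀) (h₁ : 0 < lam₁) (hl : 0 < l) :
    0 < densityRatio lam₀ lam₁ mu₀ mu₁ l :=
  mul_pos (by positivity) (lambertTerm_pos h₀ h₁ hl)

theorem log_densityRatio {l : ℝ} (h₀ : 0 < lam₀) (h₁ : 0 < lam₁) (hl : 0 < l) :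
    Real.log (densityRatio lam₀ lam₁ mu₀ mu₁ l) + lam₀ / (1 + lam₀) *
      (densityRatio lam₀ lam₁ mu₀ mu₁ l / lam₁ + Real.log l) =
      (-lam₁ - lam₁ * mu₀ + lam₀ * mu₁) / ((1 + lam₀) * lam₁) := by
  have hw := lambertTerm_pos (mu₀ := mu₀) (mu₁ := mu₁) h₀ h₁ hl
  have hW : Real.log (lambertTerm lam₀ lam₁ mu₀ mu₁ l) + lambertTerm lam₀ lam₁ mu₀ mu₁ l
      = Real.log (lam₀ * Real.exp ((-lam₁ - lam₁ * mu₀ + lam₀ * mu₁) / ((1 + lam₀) * lam₁))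
    * l ^ (-(lam₀ / (1 + lam₀))) / ((1 + lam₀) * lam₁)) := log_lambertW_add (by positivity)
  have hk : lam₁ + lam₁ / lam₀ = (1 + lam₀) * lam₁ / lam₀ := by field_simp; ring
  rw [Real.log_div (by positivity) (by positivity), Real.log_mul (by positivity) (by positivity),
    Real.log_mul (by positivity) (by positivity), Real.log_exp, Real.log_rpow hl] at hW
  unfold densityRatio
  rw [hk, Real.log_mul (by positivity) hw.ne', Real.log_div (by positivity) (by positivity)]
  have : lam₀ / (1 + lam₀) * ((1 + lam₀) * lam₁ / lam₀ * lambertTerm lam₀ lam₁ mu₀ mu₁ l / lam₁)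
      = lambertTerm lam₀ lam₁ mu₀ mu₁ l := by field_simp
  rw [mul_add, this]
  linarith

theorem paramDensity₀_eq (h₀ : 0 < lam₀) (h₁ : 0 < lam₁) (hf₀ : 0 < f₀ y) (hf₁ : 0 < f₁ y) :
    paramDensity₀ lam₀ lam₁ mu₀ mu₁ f₀ f₁ y =
      densityRatio lam₀ lam₁ mu₀ mu₁ (f₁ y / f₀ y) ^ (-(1 / lam₀))
        * Real.exp (-1 - (1 + mu₀) / lam₀) * f₀ y := by
  have hw := lambertTerm_pos (mu₀ := mu₀) (mu₁ := mu₁) h₀ h₁ (div_pos hf₁ hf₀)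
  rw [densityRatio, Real.mul_rpow (by positivity) hw.le, paramDensity₀]
  ring

theorem paramDensity₀_pos (h₀ : 0 < lam₀) (h₁ : 0 < lam₁) (hf₀ : 0 < f₀ y) (hf₁ : 0 < f₁ y) :
    0 < paramDensity₀ lam₀ lam₁ mu₀ mu₁ f₀ f₁ y := by
  have := densityRatio_pos (mu₀ := mu₀) (mu₁ := mu₁) h₀ h₁ (div_pos hf₁ hf₀)
  rw [paramDensity₀_eq h₀ h₁ hf₀ hf₁]
  positivity

theorem paramDensity₁_pos (h₀ : 0 < lam₀) (h₁ : 0 < lam₁) (hf₀ : 0 < f₀ y) (hf₁ : 0 < f₁ y) :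
    0 < paramDensity₁ lam₀ lam₁ mu₀ mu₁ f₀ f₁ y := by
  have hw := lambertTerm_pos (mu₀ := mu₀) (mu₁ := mu₁) h₀ h₁ (div_pos hf₁ hf₀)
  unfold paramDensity₁
  positivity

theorem paramDensity₀_eq_mul (h₀ : 0 < lam₀) (h₁ : 0 < lam₁) (hf₀ : 0 < f₀ y) (hf₁ : 0 < f₁ y) :
    paramDensity₀ lam₀ lam₁ mu₀ mu₁ f₀ f₁ y = densityRatio lam₀ lam₁ mu₀ mu₁ (f₁ y / f₀ y) *
      paramDensity₁ lam₀ lam₁ mu₀ mu₁ f₀ f₁ y := by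
  have hw := lambertTerm_pos (mu₀ := mu₀) (mu₁ := mu₁) h₀ h₁ (div_pos hf₁ hf₀)
  have hk : 0 < lam₁ + lam₁ / lam₀ := by positivity
  have he : -(1 / lam₀) = 1 + -((1 + lam₀) / lam₀) := by field_simp; ring
  rw [densityRatio, paramDensity₀, paramDensity₁, he, Real.rpow_add hk, Real.rpow_add hw,
    Real.rpow_one, Real.rpow_one]
  ring

theorem paramDensity_div (h₀ : 0 < lam₀) (h₁ : 0 < lam₁) (hf₀ : 0 < f₀ y) (hf₁ : 0 < f₁ y) :
    paramDensity₀ lam₀ lam₁ mu₀ mu₁ f₀ f₁ y / paramDensity₁ lam₀ lam₁ mu₀ mu₁ f₀ f₁ y =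
      densityRatio lam₀ lam₁ mu₀ mu₁ (f₁ y / f₀ y) := by
  rw [paramDensity₀_eq_mul h₀ h₁ hf₀ hf₁, mul_div_assoc,
    div_self (paramDensity₁_pos h₀ h₁ hf₀ hf₁).ne', mul_one]

/-- The stationarity condition of the pointwise Lagrangian in the first density. -/
theorem paramDensity₀_stationary (h₀ : 0 < lam₀) (h₁ : 0 < lam₁) (hf₀ : 0 < f₀ y)
    (hf₁ : 0 < f₁ y) :
    Real.log (densityRatio lam₀ lam₁ mu₀ mu₁ (f₁ y / f₀ y)) + 1 +
      lam₀ * (Real.log (paramDensity₀ lam₀ lam₁ mu₀ mu₁ f₀ f₁ y / f₀ y) + 1) + mu₀ = 0 := by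
  have hu := densityRatio_pos (mu₀ := mu₀) (mu₁ := mu₁) h₀ h₁ (div_pos hf₁ hf₀)
  rw [paramDensity₀_eq h₀ h₁ hf₀ hf₁, mul_div_assoc, div_self hf₀.ne', mul_one,
    Real.log_mul (by positivity) (by positivity), Real.log_exp, Real.log_rpow hu]
  field_simp
  ring

/-- The stationarity condition of the pointwise Lagrangian in the second density. -/
theorem paramDensity₁_stationary (h₀ : 0 < lam₀) (h₁ : 0 < lam₁) (hf₀ : 0 < f₀ y)
    (hf₁ : 0 < f₁ y) :
    -densityRatio lam₀ lam₁ mu₀ mu₁ (f₁ y / f₀ y) +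
      lam₁ * (Real.log (paramDensity₁ lam₀ lam₁ mu₀ mu₁ f₀ f₁ y / f₁ y) + 1) + mu₁ = 0 := by
  have hl := div_pos hf₁ hf₀
  have hu := densityRatio_pos (mu₀ := mu₀) (mu₁ := mu₁) h₀ h₁ hl
  have hg := paramDensity₁_pos (mu₀ := mu₀) (mu₁ := mu₁) h₀ h₁ hf₀ hf₁
  have hs := paramDensity₀_stationary (mu₀ := mu₀) (mu₁ := mu₁) h₀ h₁ hf₀ hf₁
  have hlog := log_densityRatio (mu₀ := mu₀) (mu₁ := mu₁) h₀ h₁ hl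
  rw [paramDensity₀_eq_mul h₀ h₁ hf₀ hf₁, Real.log_div (by positivity) hf₀.ne',
    Real.log_mul hu.ne' hg.ne'] at hs
  rw [Real.log_div hf₁.ne' hf₀.ne'] at hlog
  rw [Real.log_div hg.ne' hf₁.ne']
  set u := densityRatio lam₀ lam₁ mu₀ mu₁ (f₁ y / f₀ y)
  set G := Real.log (paramDensity₁ lam₀ lam₁ mu₀ mu₁ f₀ f₁ y)
  generalize Real.log (f₀ y) = A at *
  generalize Real.log (f₁ y) = B at *
  generalize Real.log u = U at *
  field_simp at hlog
  have : lam₀ * (-u + lam₁ * (G - B + 1) + mu₁) = 0 := by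
    linear_combination lam₁ * hs - hlog
  rcases mul_eq_zero.1 this with h | h
  · exact absurd h h₀.ne'
  · exact h

/-- The Gibbs inequality `t log t - t + v ≥ t log v` in homogeneous form. -/
theorem mul_log_div_ge {a b v : ℝ} (ha : 0 < a) (hb : 0 < b) (hv : 0 < v) :
    a * (Real.log v + 1) - v * b ≤ a * Real.log (a / b) := by
  have h := Real.log_le_sub_one_of_pos (x := v * b / a) (by positivity)
  rw [Real.log_div (by positivity) ha.ne', Real.log_mul hv.ne' hb.ne'] at h
  rw [Real.log_div ha.ne' hb.ne']
  have h2 := mul_le_mul_of_nonneg_left h ha.le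
  have h3 : a * (v * b / a - 1) = v * b - a := by field_simp
  nlinarith

/-- The parametric densities minimize the pointwise Lagrangian. -/
theorem lagrangian_ge (h₀ : 0 < lam₀) (h₁ : 0 < lam₁) (hf₀ : 0 < f₀ y) (hf₁ : 0 < f₁ y)
    {x₀ x₁ : ℝ} (hx₀ : 0 < x₀) (hx₁ : 0 < x₁) :
    -(lam₀ * paramDensity₀ lam₀ lam₁ mu₀ mu₁ f₀ f₁ y
      + lam₁ * paramDensity₁ lam₀ lam₁ mu₀ mu₁ f₀ f₁ y) ≤
    x₀ * Real.log (x₀ / x₁) + lam₀ * (x₀ * Real.log (x₀ / f₀ y))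
      + lam₁ * (x₁ * Real.log (x₁ / f₁ y)) + mu₀ * x₀ + mu₁ * x₁ := by
  have hl := div_pos hf₁ hf₀
  have hu := densityRatio_pos (mu₀ := mu₀) (mu₁ := mu₁) h₀ h₁ hl
  have hg₀ := paramDensity₀_pos (mu₀ := mu₀) (mu₁ := mu₁) h₀ h₁ hf₀ hf₁
  have hg₁ := paramDensity₁_pos (mu₀ := mu₀) (mu₁ := mu₁) h₀ h₁ hf₀ hf₁
  have s₀ := paramDensity₀_stationary (mu₀ := mu₀) (mu₁ := mu₁) h₀ h₁ hf₀ hf₁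
  have s₁ := paramDensity₁_stationary (mu₀ := mu₀) (mu₁ := mu₁) h₀ h₁ hf₀ hf₁
  have i := mul_log_div_ge hx₀ hx₁ hu
  have i₀ := mul_le_mul_of_nonneg_left
    (mul_log_div_ge hx₀ hf₀ (v := paramDensity₀ lam₀ lam₁ mu₀ mu₁ f₀ f₁ y / f₀ y)
      (by positivity)) h₀.le
  have i₁ := mul_le_mul_of_nonneg_left
    (mul_log_div_ge hx₁ hf₁ (v := paramDensity₁ lam₀ lam₁ mu₀ mu₁ f₀ f₁ y / f₁ y)
      (by positivity)) h₁.le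
  rw [div_mul_cancel₀ _ hf₀.ne'] at i₀
  rw [div_mul_cancel₀ _ hf₁.ne'] at i₁
  linear_combination i + i₀ + i₁ - x₀ * s₀ - x₁ * s₁

/-- The value at the parametric densities of the Lagrangian with other multipliers differs from
the minimum for the original multipliers by a linear function of the change of multipliers. -/
theorem lagrangian_eq (h₀ : 0 < lam₀) (h₁ : 0 < lam₁) (hf₀ : 0 < f₀ y) (hf₁ : 0 < f₁ y)
    (a₀ a₁ b₀ b₁ : ℝ) (g₀ g₁ : ℝ) (hg₀ : g₀ = paramDensity₀ lam₀ lam₁ mu₀ mu₁ f₀ f₁ y)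
    (hg₁ : g₁ = paramDensity₁ lam₀ lam₁ mu₀ mu₁ f₀ f₁ y) :
    g₀ * Real.log (g₀ / g₁) + a₀ * (g₀ * Real.log (g₀ / f₀ y))
      + a₁ * (g₁ * Real.log (g₁ / f₁ y)) + b₀ * g₀ + b₁ * g₁ =
    -(lam₀ * g₀ + lam₁ * g₁) + (a₀ - lam₀) * (g₀ * Real.log (g₀ / f₀ y))
      + (a₁ - lam₁) * (g₁ * Real.log (g₁ / f₁ y)) + (b₀ - mu₀) * g₀ + (b₁ - mu₁) * g₁ := by
  have s₀ := paramDensity₀_stationary (mu₀ := mu₀) (mu₁ := mu₁) h₀ h₁ hf₀ hf₁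
  have s₁ := paramDensity₁_stationary (mu₀ := mu₀) (mu₁ := mu₁) h₀ h₁ hf₀ hf₁
  have hm := paramDensity₀_eq_mul (mu₀ := mu₀) (mu₁ := mu₁) h₀ h₁ hf₀ hf₁
  rw [← hg₀] at s₀ hm
  rw [← hg₁] at s₁ hm
  have hr : g₀ / g₁ = densityRatio lam₀ lam₁ mu₀ mu₁ (f₁ y / f₀ y) := by
    rw [hg₀, hg₁, paramDensity_div h₀ h₁ hf₀ hf₁]
  rw [hr]
  linear_combination g₀ * s₀ + g₁ * s₁ - hm

end Pointwise

/-! ### Measurability of the parametric densities -/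

section Measurability

variable {Ω : Type*} [MeasurableSpace Ω] {f₀ f₁ : Ω → ℝ}

theorem measurable_lambertTerm (lam₀ lam₁ mu₀ mu₁ : ℝ) :
    Measurable (lambertTerm lam₀ lam₁ mu₀ mu₁) := by
  unfold lambertTerm
  exact measurable_lambertW.comp (by fun_prop)

theorem measurable_paramDensity₀ (lam₀ lam₁ mu₀ mu₁ : ℝ) (hf₀ : Measurable f₀)
    (hf₁ : Measurable f₁) : Measurable (paramDensity₀ lam₀ lam₁ mu₀ mu₁ f₀ f₁) := by
  have := (measurable_lambertTerm lam₀ lam₁ mu₀ mu₁).comp (hf₁.div hf₀)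
  exact ((this.pow_const (-(1 / lam₀))).const_mul _).mul hf₀

theorem measurable_paramDensity₁ (lam₀ lam₁ mu₀ mu₁ : ℝ) (hf₀ : Measurable f₀)
    (hf₁ : Measurable f₁) : Measurable (paramDensity₁ lam₀ lam₁ mu₀ mu₁ f₀ f₁) := by
  have := (measurable_lambertTerm lam₀ lam₁ mu₀ mu₁).comp (hf₁.div hf₀)
  exact ((this.pow_const (-((1 + lam₀) / lam₀))).const_mul _).mul hf₀

end Measurability

/-! ### The Gibbs variational inequality -/

section Gibbs

variable {Ω : Type*} [MeasurableSpace Ω] {P Q : Measure Ω} [IsProbabilityMeasure P]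
  [IsProbabilityMeasure Q] {w : Ω → ℝ}

theorem lintegral_exp_sub_llr_le (hac : P ≪ Q) (hw : Measurable w)
    (hmass : ∫⁻ y, ENNReal.ofReal (Real.exp (w y)) ∂Q ≤ 1) :
    ∫⁻ y, ENNReal.ofReal (Real.exp (w y - llr P Q y)) ∂P ≤ 1 := by
  rw [← lintegral_rnDeriv_mul hac (by fun_prop)]
  refine le_trans (lintegral_mono_ae ?_) hmass
  filter_upwards [Measure.rnDeriv_ne_top P Q] with y hy
  rcases eq_or_ne (P.rnDeriv Q y) 0 with h0 | h0
  · simp [h0]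
  · have hpos : 0 < (P.rnDeriv Q y).toReal := ENNReal.toReal_pos h0 hy
    nth_rewrite 1 [← ENNReal.ofReal_toReal hy]
    rw [← ENNReal.ofReal_mul hpos.le, llr_def]
    simp only [Real.exp_sub, Real.exp_log hpos]
    rw [mul_div_cancel₀ _ hpos.ne']

theorem integral_llr_eq_toReal_klDiv (hkl : klDiv P Q ≠ ∞) :
    ∫ y, llr P Q y ∂P = (klDiv P Q).toReal := by
  rw [toReal_klDiv_of_measure_eq (klDiv_ne_top_iff.1 hkl).1 (by simp)]

theorem integrable_exp_sub_llr (hac : P ≪ Q) (hw : Measurable w)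
    (hmass : ∫⁻ y, ENNReal.ofReal (Real.exp (w y)) ∂Q ≤ 1) :
    Integrable (fun y => Real.exp (w y - llr P Q y)) P := by
  refine ⟨by fun_prop, ?_⟩
  rw [hasFiniteIntegral_iff_ofReal (ae_of_all _ fun _ => (Real.exp_pos _).le)]
  exact (lintegral_exp_sub_llr_le hac hw hmass).trans_lt ENNReal.one_lt_top

theorem integral_exp_sub_llr_le (hac : P ≪ Q) (hw : Measurable w)
    (hmass : ∫⁻ y, ENNReal.ofReal (Real.exp (w y)) ∂Q ≤ 1) :
    ∫ y, Real.exp (w y - llr P Q y) ∂P ≤ 1 := by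
  rw [integral_eq_lintegral_of_nonneg_ae (ae_of_all _ fun _ => (Real.exp_pos _).le)
    (by fun_prop)]
  exact ENNReal.toReal_le_of_le_ofReal zero_le_one
    (by simpa using lintegral_exp_sub_llr_le hac hw hmass)

/-- A log-density with respect to `Q` is bounded above by a `P`-integrable function as soon as
`D_KL(P, Q)` is finite. -/
theorem exists_integrable_ge (hkl : klDiv P Q ≠ ∞) (hw : Measurable w)
    (hmass : ∫⁻ y, ENNReal.ofReal (Real.exp (w y)) ∂Q ≤ 1) :
    ∃ b : Ω → ℝ, Integrable b P ∧ ∀ y, w y ≤ b y := by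
  obtain ⟨hac, hint⟩ := klDiv_ne_top_iff.1 hkl
  refine ⟨fun y => llr P Q y + Real.exp (w y - llr P Q y),
    hint.add (integrable_exp_sub_llr hac hw hmass), fun y => ?_⟩
  linarith [Real.add_one_le_exp (w y - llr P Q y)]

/-- The Gibbs inequality: the mean of a log-density is at most the divergence. -/
theorem integral_le_toReal_klDiv (hkl : klDiv P Q ≠ ∞) (hw : Measurable w)
    (hmass : ∫⁻ y, ENNReal.ofReal (Real.exp (w y)) ∂Q ≤ 1) (hwi : Integrable w P) :
    ∫ y, w y ∂P ≤ (klDiv P Q).toReal := by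
  obtain ⟨hac, hint⟩ := klDiv_ne_top_iff.1 hkl
  have hexp := integrable_exp_sub_llr hac hw hmass
  have hsub : Integrable (fun y => Real.exp (w y - llr P Q y) - 1) P :=
    hexp.sub (integrable_const _)
  have h : ∫ y, w y ∂P ≤ ∫ y, (llr P Q y + (Real.exp (w y - llr P Q y) - 1)) ∂P :=
    integral_mono hwi (hint.add hsub) fun y => by
      simp only
      linarith [Real.add_one_le_exp (w y - llr P Q y)]
  rw [integral_add hint hsub, integral_sub hexp (integrable_const _),
    integral_llr_eq_toReal_klDiv hkl] at h
  simp only [integral_const, probReal_univ, smul_eq_mul, mul_one] at h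
  linarith [integral_exp_sub_llr_le hac hw hmass]

/-- The equality case of the Gibbs inequality. -/
theorem eq_withDensity_of_toReal_klDiv_le (hkl : klDiv P Q ≠ ∞) (hw : Measurable w)
    (hmass : ∫⁻ y, ENNReal.ofReal (Real.exp (w y)) ∂Q ≤ 1) (hwi : Integrable w P)
    (heq : (klDiv P Q).toReal ≤ ∫ y, w y ∂P) :
    P = Q.withDensity fun y => ENNReal.ofReal (Real.exp (w y)) := by
  obtain ⟨hac, hint⟩ := klDiv_ne_top_iff.1 hkl
  have hexp := integrable_exp_sub_llr hac hw hmass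
  have hsub : Integrable (fun y => Real.exp (w y - llr P Q y) - 1) P :=
    hexp.sub (integrable_const _)
  have hsub' : Integrable (fun y => w y - llr P Q y) P := hwi.sub hint
  have hd : Integrable (fun y => Real.exp (w y - llr P Q y) - 1 - (w y - llr P Q y)) P :=
    hsub.sub hsub'
  have hnn : 0 ≤ fun y => Real.exp (w y - llr P Q y) - 1 - (w y - llr P Q y) := fun y => by
    simp only [Pi.zero_apply]
    linarith [Real.add_one_le_exp (w y - llr P Q y)]
  have hzero : ∫ y, (Real.exp (w y - llr P Q y) - 1 - (w y - llr P Q y)) ∂P = 0 := by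
    refine le_antisymm ?_ (integral_nonneg hnn)
    rw [integral_sub hsub hsub',
      integral_sub hexp (integrable_const _), integral_sub hwi hint,
      integral_llr_eq_toReal_klDiv hkl]
    simp only [integral_const, probReal_univ, smul_eq_mul, mul_one]
    linarith [integral_exp_sub_llr_le hac hw hmass]
  have hae : ∀ᵐ y ∂P, w y = llr P Q y := by
    filter_upwards [(integral_eq_zero_iff_of_nonneg hnn hd).1 hzero] with y hy
    by_contra hne
    have := Real.add_one_lt_exp (sub_ne_zero.2 hne)
    simp only [Pi.zero_apply] at hy
    linarith
  have hle : P ≤ Q.withDensity fun y => ENNReal.ofReal (Real.exp (w y)) := by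
    conv_lhs => rw [← Measure.withDensity_rnDeriv_eq P Q hac]
    refine withDensity_mono ?_
    rw [← Measure.withDensity_rnDeriv_eq P Q hac,
      ae_withDensity_iff (Measure.measurable_rnDeriv P Q),
      Measure.withDensity_rnDeriv_eq P Q hac] at hae
    filter_upwards [hae, Measure.rnDeriv_ne_top P Q] with y hy htop
    rcases eq_or_ne (P.rnDeriv Q y) 0 with h0 | h0
    · simp [h0]
    · have hpos : 0 < (P.rnDeriv Q y).toReal := ENNReal.toReal_pos h0 htop
      rw [hy h0, llr_def]
      simp only [Real.exp_log hpos, ENNReal.ofReal_toReal htop, le_refl]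
  have : IsFiniteMeasure (Q.withDensity fun y => ENNReal.ofReal (Real.exp (w y))) :=
    isFiniteMeasure_withDensity (hmass.trans_lt ENNReal.one_lt_top).ne
  refine Measure.eq_of_le_of_measure_univ_eq hle (le_antisymm (hle _) ?_)
  simpa using hmass

end Gibbs

/-! ### Distributions with positive densities -/

section Dist

variable {Ω : Type*} [MeasurableSpace Ω] {μ : Measure Ω} {f g : Ω → ℝ}

theorem IsPosDensity.lintegral_eq (hf : IsPosDensity μ f) :
    ∫⁻ y, ENNReal.ofReal (f y) ∂μ = 1 := by
  rw [← ofReal_integral_eq_lintegral_ofReal hf.2.2.1 (hf.2.1.mono fun y hy => hy.le), hf.2.2.2,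
    ENNReal.ofReal_one]

theorem IsPosDensity.isProbabilityMeasure (hf : IsPosDensity μ f) :
    IsProbabilityMeasure (distOf μ f) :=
  ⟨by rw [distOf, withDensity_apply _ MeasurableSet.univ, setLIntegral_univ, hf.lintegral_eq]⟩

theorem distOf_absolutelyContinuous : distOf μ f ≪ μ := withDensity_absolutelyContinuous _ _

theorem IsPosDensity.absolutelyContinuous (hf : IsPosDensity μ f) : μ ≪ distOf μ f :=
  withDensity_absolutelyContinuous' hf.1.ennreal_ofReal.aemeasurable
    (hf.2.1.mono fun y hy => by simpa using hy)

theorem withDensity_distOf (hf : IsPosDensity μ f) (hg : IsPosDensity μ g) :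
    (distOf μ f).withDensity (fun y => ENNReal.ofReal (Real.exp (Real.log (g y / f y)))) =
      distOf μ g := by
  have hm : Measurable fun y => ENNReal.ofReal (Real.exp (Real.log (g y / f y))) :=
    (Real.measurable_exp.comp (Real.measurable_log.comp (hg.1.div hf.1))).ennreal_ofReal
  rw [distOf, ← withDensity_mul _ hf.1.ennreal_ofReal hm, distOf]
  refine withDensity_congr_ae ?_
  filter_upwards [hf.2.1, hg.2.1] with y hfy hgy
  rw [Pi.mul_apply, Real.exp_log (div_pos hgy hfy), ← ENNReal.ofReal_mul hfy.le,
    mul_div_cancel₀ _ hfy.ne']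

theorem lintegral_exp_log_div (hf : IsPosDensity μ f) (hg : IsPosDensity μ g) :
    ∫⁻ y, ENNReal.ofReal (Real.exp (Real.log (g y / f y))) ∂(distOf μ f) = 1 := by
  have := hg.isProbabilityMeasure
  have h := measure_univ (μ := distOf μ g)
  rwa [← withDensity_distOf hf hg, withDensity_apply _ MeasurableSet.univ, setLIntegral_univ] at h

theorem llr_distOf [SigmaFinite μ] (hf : IsPosDensity μ f) (hg : IsPosDensity μ g) :
    llr (distOf μ g) (distOf μ f) =ᵐ[μ] fun y => Real.log (g y / f y) := by
  have := hf.isProbabilityMeasure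
  have hm : Measurable fun y => ENNReal.ofReal (Real.exp (Real.log (g y / f y))) :=
    (Real.measurable_exp.comp (Real.measurable_log.comp (hg.1.div hf.1))).ennreal_ofReal
  have h := Measure.rnDeriv_withDensity (distOf μ f) hm
  rw [withDensity_distOf hf hg] at h
  filter_upwards [hf.absolutelyContinuous.ae_le h] with y hy
  rw [llr_def]
  simp only [hy]
  rw [ENNReal.toReal_ofReal (Real.exp_pos _).le, Real.log_exp]

theorem distOf_absolutelyContinuous_distOf (hf : IsPosDensity μ f) :
    distOf μ g ≪ distOf μ f :=
  distOf_absolutelyContinuous.trans hf.absolutelyContinuous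

theorem integrable_log_of_klDiv_ne_top [SigmaFinite μ] (hf : IsPosDensity μ f)
    (hg : IsPosDensity μ g) (h : klDiv (distOf μ g) (distOf μ f) ≠ ∞) :
    Integrable (fun y => Real.log (g y / f y)) (distOf μ g) :=
  (klDiv_ne_top_iff.1 h).2.congr (distOf_absolutelyContinuous.ae_le (llr_distOf hf hg))

theorem klDiv_distOf [SigmaFinite μ] (hf : IsPosDensity μ f) (hg : IsPosDensity μ g)
    (hi : Integrable (fun y => Real.log (g y / f y)) (distOf μ g)) :
    klDiv (distOf μ g) (distOf μ f) =
      ENNReal.ofReal (∫ y, Real.log (g y / f y) ∂(distOf μ g)) := by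
  have := hf.isProbabilityMeasure
  have := hg.isProbabilityMeasure
  have hae : llr (distOf μ g) (distOf μ f) =ᵐ[distOf μ g] fun y => Real.log (g y / f y) :=
    distOf_absolutelyContinuous.ae_le (llr_distOf hf hg)
  rw [klDiv_of_ac_of_integrable (distOf_absolutelyContinuous_distOf hf) (hi.congr hae.symm),
    integral_congr_ae hae]
  simp

theorem integral_log_nonneg [SigmaFinite μ] (hf : IsPosDensity μ f) (hg : IsPosDensity μ g)
    (hi : Integrable (fun y => Real.log (g y / f y)) (distOf μ g)) :
    0 ≤ ∫ y, Real.log (g y / f y) ∂(distOf μ g) := by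
  have := hf.isProbabilityMeasure
  have := hg.isProbabilityMeasure
  have hae : llr (distOf μ g) (distOf μ f) =ᵐ[distOf μ g] fun y => Real.log (g y / f y) :=
    distOf_absolutelyContinuous.ae_le (llr_distOf hf hg)
  have h := integral_llr_add_sub_measure_univ_nonneg
    (distOf_absolutelyContinuous_distOf (g := g) hf) (hi.congr hae.symm)
  rw [integral_congr_ae hae] at h
  simpa using h

theorem toReal_klDiv_distOf [SigmaFinite μ] (hf : IsPosDensity μ f) (hg : IsPosDensity μ g)
    (hi : Integrable (fun y => Real.log (g y / f y)) (distOf μ g)) :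
    (klDiv (distOf μ g) (distOf μ f)).toReal =
      ∫ y, Real.log (g y / f y) ∂(distOf μ g) := by
  rw [klDiv_distOf hf hg hi, ENNReal.toReal_ofReal (integral_log_nonneg hf hg hi)]

theorem integral_distOf (hf : IsPosDensity μ f) (v : Ω → ℝ) :
    ∫ y, v y ∂(distOf μ f) = ∫ y, f y * v y ∂μ := by
  rw [distOf, integral_withDensity_eq_integral_toReal_smul hf.1.ennreal_ofReal
    (ae_of_all _ fun _ => ENNReal.ofReal_lt_top)]
  refine integral_congr_ae ?_
  filter_upwards [hf.2.1] with y hy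
  rw [ENNReal.toReal_ofReal hy.le, smul_eq_mul]

theorem integrable_distOf_iff (hf : IsPosDensity μ f) {v : Ω → ℝ} :
    Integrable v (distOf μ f) ↔ Integrable (fun y => f y * v y) μ := by
  rw [distOf, integrable_withDensity_iff_integrable_smul' hf.1.ennreal_ofReal
    (ae_of_all _ fun _ => ENNReal.ofReal_lt_top)]
  refine integrable_congr ?_
  filter_upwards [hf.2.1] with y hy
  rw [ENNReal.toReal_ofReal hy.le, smul_eq_mul]

end Dist

/-! ### Sufficiency of the stationarity conditions -/

section Sufficiency

variable {Ω : Type*} [MeasurableSpace Ω]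

/-- The Karush-Kuhn-Tucker conditions for minimizing `D_KL(G₀, G₁)` over the two
Kullback-Leibler neighborhoods: `g₀`, `g₁` are feasible with both constraints active, and the
pointwise Lagrangian with positive multipliers `lam₀`, `lam₁` is stationary at `(g₀, g₁)`. -/
structure IsKKTPair (μ : Measure Ω) (f₀ f₁ : Ω → ℝ) (ε₀ ε₁ lam₀ lam₁ mu₀ mu₁ : ℝ)
    (g₀ g₁ : Ω → ℝ) : Prop where
  nominal₀ : IsPosDensity μ f₀
  nominal₁ : IsPosDensity μ f₁
  radius₀_pos : 0 < ε₀
  radius₁_pos : 0 < ε₁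
  density₀ : IsPosDensity μ g₀
  density₁ : IsPosDensity μ g₁
  lam₀_pos : 0 < lam₀
  lam₁_pos : 0 < lam₁
  klDiv₀ : klDiv (distOf μ g₀) (distOf μ f₀) = ENNReal.ofReal ε₀
  klDiv₁ : klDiv (distOf μ g₁) (distOf μ f₁) = ENNReal.ofReal ε₁
  stationary₀ : ∀ᵐ y ∂μ, Real.log (g₀ y / g₁ y) + 1 +
    lam₀ * (Real.log (g₀ y / f₀ y) + 1) + mu₀ = 0
  stationary₁ : ∀ᵐ y ∂μ, -(g₀ y / g₁ y) + lam₁ * (Real.log (g₁ y / f₁ y) + 1) + mu₁ = 0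

variable {μ : Measure Ω} {f₀ f₁ g₀ g₁ : Ω → ℝ}
  {ε₀ ε₁ lam₀ lam₁ mu₀ mu₁ : ℝ}

theorem measurable_log_div {f g : Ω → ℝ} (hf : Measurable f) (hg : Measurable g) :
    Measurable fun y => Real.log (g y / f y) := Real.measurable_log.comp (hg.div hf)

theorem klDiv_ne_top_of_mem {F H : Measure Ω} {ε : ℝ} (hH : H ∈ klClass F ε) :
    klDiv H F ≠ ∞ := (hH.2.trans_lt ENNReal.ofReal_lt_top).ne

theorem absolutelyContinuous_of_mem {f : Ω → ℝ} {H : Measure Ω} {ε : ℝ}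
    (hH : H ∈ klClass (distOf μ f) ε) : H ≪ μ :=
  (klDiv_ne_top_iff.1 (klDiv_ne_top_of_mem hH)).1.trans distOf_absolutelyContinuous

/-- The mean of a log-density under a member of a Kullback-Leibler neighborhood is at most the
radius. -/
theorem integral_log_div_le_of_mem {f g : Ω → ℝ} (hf : IsPosDensity μ f) (hg : IsPosDensity μ g)
    {ε : ℝ} (hε : 0 < ε) {H : Measure Ω} (hH : H ∈ klClass (distOf μ f) ε)
    (hi : Integrable (fun y => Real.log (g y / f y)) H) :
    ∫ y, Real.log (g y / f y) ∂H ≤ ε := by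
  have := hf.isProbabilityMeasure
  have := hH.1
  refine (integral_le_toReal_klDiv (klDiv_ne_top_of_mem hH) (measurable_log_div hf.1 hg.1)
    (lintegral_exp_log_div hf hg).le hi).trans ?_
  exact ENNReal.toReal_le_of_le_ofReal hε.le hH.2

/-- The only member of a Kullback-Leibler neighborhood under which the log-density has mean equal
to the radius is the distribution with that density. -/
theorem eq_distOf_of_le_integral {f g : Ω → ℝ} (hf : IsPosDensity μ f) (hg : IsPosDensity μ g)
    {ε : ℝ} (hε : 0 < ε) {H : Measure Ω} (hH : H ∈ klClass (distOf μ f) ε)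
    (hi : Integrable (fun y => Real.log (g y / f y)) H)
    (hle : ε ≤ ∫ y, Real.log (g y / f y) ∂H) : H = distOf μ g := by
  have := hf.isProbabilityMeasure
  have := hH.1
  rw [← withDensity_distOf hf hg]
  exact eq_withDensity_of_toReal_klDiv_le (klDiv_ne_top_of_mem hH) (measurable_log_div hf.1 hg.1)
    (lintegral_exp_log_div hf hg).le hi
    ((ENNReal.toReal_le_of_le_ofReal hε.le hH.2).trans hle)

theorem integral_log_div_eq [SigmaFinite μ] {f g : Ω → ℝ} (hf : IsPosDensity μ f) (hg : IsPosDensity μ g)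
    {ε : ℝ} (hε : 0 < ε) (h : klDiv (distOf μ g) (distOf μ f) = ENNReal.ofReal ε) :
    Integrable (fun y => Real.log (g y / f y)) (distOf μ g) ∧
      ∫ y, Real.log (g y / f y) ∂(distOf μ g) = ε := by
  have hi := integrable_log_of_klDiv_ne_top hf hg (by simp [h])
  refine ⟨hi, ?_⟩
  rw [← toReal_klDiv_distOf hf hg hi, h, ENNReal.toReal_ofReal hε.le]

namespace IsKKTPair

theorem mem₀ (K : IsKKTPair μ f₀ f₁ ε₀ ε₁ lam₀ lam₁ mu₀ mu₁ g₀ g₁) :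
    distOf μ g₀ ∈ klClass (distOf μ f₀) ε₀ :=
  ⟨K.density₀.isProbabilityMeasure, K.klDiv₀.le⟩

theorem mem₁ (K : IsKKTPair μ f₀ f₁ ε₀ ε₁ lam₀ lam₁ mu₀ mu₁ g₀ g₁) :
    distOf μ g₁ ∈ klClass (distOf μ f₁) ε₁ :=
  ⟨K.density₁.isProbabilityMeasure, K.klDiv₁.le⟩

theorem ae_log_eq₀ (K : IsKKTPair μ f₀ f₁ ε₀ ε₁ lam₀ lam₁ mu₀ mu₁ g₀ g₁) :
    ∀ᵐ y ∂μ, Real.log (g₀ y / g₁ y) =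
    -1 - mu₀ - lam₀ - lam₀ * Real.log (g₀ y / f₀ y) := by
  filter_upwards [K.stationary₀] with y hy
  linarith

theorem ae_div_eq₁ (K : IsKKTPair μ f₀ f₁ ε₀ ε₁ lam₀ lam₁ mu₀ mu₁ g₀ g₁) :
    ∀ᵐ y ∂μ, g₀ y / g₁ y = lam₁ * Real.log (g₁ y / f₁ y) + (lam₁ + mu₁) := by
  filter_upwards [K.stationary₁] with y hy
  linarith

theorem integrable_log₀ [SigmaFinite μ]
    (K : IsKKTPair μ f₀ f₁ ε₀ ε₁ lam₀ lam₁ mu₀ mu₁ g₀ g₁) :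
    Integrable (fun y => Real.log (g₀ y / g₁ y)) (distOf μ g₀) := by
  have hi := (integral_log_div_eq K.nominal₀ K.density₀ K.radius₀_pos K.klDiv₀).1
  have := K.density₀.isProbabilityMeasure
  exact ((integrable_const (-1 - mu₀ - lam₀)).sub (hi.const_mul lam₀)).congr
    (EventuallyEq.symm (distOf_absolutelyContinuous.ae_le K.ae_log_eq₀))

theorem integral_log₀ [SigmaFinite μ]
    (K : IsKKTPair μ f₀ f₁ ε₀ ε₁ lam₀ lam₁ mu₀ mu₁ g₀ g₁) :
    ∫ y, Real.log (g₀ y / g₁ y) ∂(distOf μ g₀) =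
    -1 - mu₀ - lam₀ - lam₀ * ε₀ := by
  have := K.density₀.isProbabilityMeasure
  obtain ⟨hi, he⟩ := integral_log_div_eq K.nominal₀ K.density₀ K.radius₀_pos K.klDiv₀
  rw [integral_congr_ae (distOf_absolutelyContinuous.ae_le K.ae_log_eq₀),
    integral_sub (integrable_const _) (hi.const_mul _), integral_const_mul, he]
  simp

/-- The density ratio `g₀ / g₁` has mean at most one under every member of the second class. This
is the variational inequality of the minimization in the second argument. -/
theorem lintegral_ratio_le [SigmaFinite μ]
    (K : IsKKTPair μ f₀ f₁ ε₀ ε₁ lam₀ lam₁ mu₀ mu₁ g₀ g₁)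
    {H : Measure Ω} (hH : H ∈ klClass (distOf μ f₁) ε₁) :
    ∫⁻ y, ENNReal.ofReal (Real.exp (Real.log (g₀ y / g₁ y))) ∂H ≤ 1 := by
  have := K.nominal₁.isProbabilityMeasure
  have := K.density₁.isProbabilityMeasure
  have := hH.1
  have hac := absolutelyContinuous_of_mem hH
  have hl₁ := K.lam₁_pos
  obtain ⟨hi₁, he₁⟩ := integral_log_div_eq K.nominal₁ K.density₁ K.radius₁_pos K.klDiv₁
  have hpos : ∀ᵐ y ∂μ, 0 < g₀ y / g₁ y := by
    filter_upwards [K.density₀.2.1, K.density₁.2.1] with y h0 h1 using div_pos h0 h1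
  -- the ratio has mean one under `g₁`, which determines the normalizing constant
  have hone : lam₁ * ε₁ + (lam₁ + mu₁) = 1 := by
    have h : ∫ y, g₀ y / g₁ y ∂(distOf μ g₁) = 1 := by
      rw [integral_distOf K.density₁, ← K.density₀.2.2.2]
      refine integral_congr_ae ?_
      filter_upwards [K.density₁.2.1] with y h1
      rw [mul_div_cancel₀ _ h1.ne']
    rw [integral_congr_ae (distOf_absolutelyContinuous.ae_le K.ae_div_eq₁),
      integral_add (hi₁.const_mul _) (integrable_const _), integral_const_mul, he₁] at h
    simpa using h
  obtain ⟨b, hb, hle⟩ := exists_integrable_ge (klDiv_ne_top_of_mem hH)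
    (measurable_log_div K.nominal₁.1 K.density₁.1) (lintegral_exp_log_div K.nominal₁ K.density₁).le
  have hi : Integrable (fun y => Real.log (g₁ y / f₁ y)) H := by
    refine integrable_of_le_of_le (g₁ := fun _ => -(lam₁ + mu₁) / lam₁) (g₂ := b)
      (measurable_log_div K.nominal₁.1 K.density₁.1).aestronglyMeasurable ?_ (ae_of_all _ hle)
      (integrable_const _) hb
    filter_upwards [hac.ae_le K.ae_div_eq₁, hac.ae_le hpos] with y h1 h2
    rw [div_le_iff₀ hl₁]
    linarith
  have hle₁ := integral_log_div_le_of_mem K.nominal₁ K.density₁ K.radius₁_pos hH hi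
  have hae : (fun y => Real.exp (Real.log (g₀ y / g₁ y))) =ᵐ[H]
      fun y => lam₁ * Real.log (g₁ y / f₁ y) + (lam₁ + mu₁) := by
    filter_upwards [hac.ae_le K.ae_div_eq₁, hac.ae_le hpos] with y h1 h2
    rw [Real.exp_log h2, h1]
  rw [← ofReal_integral_eq_lintegral_ofReal
    (((hi.const_mul lam₁).add (integrable_const _)).congr hae.symm)
    (ae_of_all _ fun _ => (Real.exp_pos _).le), integral_congr_ae hae,
    integral_add (hi.const_mul _) (integrable_const _), integral_const_mul]
  simp only [integral_const, probReal_univ, smul_eq_mul, one_mul]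
  rw [← ENNReal.ofReal_one]
  exact ENNReal.ofReal_le_ofReal (by nlinarith)

/-- If `D_KL(H₀, H₁)` is finite, then `log (g₀ / g₁)` and `log (g₀ / f₀)` are `H₀`-integrable:
the first is bounded above through `H₁`, the second through `f₀`, and each is a decreasing affine
function of the other. -/
theorem integral_log_le [SigmaFinite μ]
    (K : IsKKTPair μ f₀ f₁ ε₀ ε₁ lam₀ lam₁ mu₀ mu₁ g₀ g₁)
    {H₀ H₁ : Measure Ω} (hH₀ : H₀ ∈ klClass (distOf μ f₀) ε₀)
    (hH₁ : H₁ ∈ klClass (distOf μ f₁) ε₁) (hne : klDiv H₀ H₁ ≠ ∞) :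
    Integrable (fun y => Real.log (g₀ y / f₀ y)) H₀ ∧
    Integrable (fun y => Real.log (g₀ y / g₁ y)) H₀ ∧
    ∫ y, Real.log (g₀ y / g₁ y) ∂H₀ =
      -1 - mu₀ - lam₀ - lam₀ * ∫ y, Real.log (g₀ y / f₀ y) ∂H₀ := by
  have := K.nominal₀.isProbabilityMeasure
  have := hH₀.1
  have := hH₁.1
  have hac := absolutelyContinuous_of_mem hH₀
  have hl₀ := K.lam₀_pos
  have hae := hac.ae_le K.ae_log_eq₀
  obtain ⟨b, hb, hble⟩ := exists_integrable_ge (klDiv_ne_top_of_mem hH₀)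
    (measurable_log_div K.nominal₀.1 K.density₀.1) (lintegral_exp_log_div K.nominal₀ K.density₀).le
  obtain ⟨c, hc, hcle⟩ := exists_integrable_ge hne
    (measurable_log_div K.density₁.1 K.density₀.1) (K.lintegral_ratio_le hH₁)
  have hi : Integrable (fun y => Real.log (g₀ y / f₀ y)) H₀ := by
    refine integrable_of_le_of_le (g₁ := fun y => ((-1 - mu₀ - lam₀) - c y) / lam₀) (g₂ := b)
      (measurable_log_div K.nominal₀.1 K.density₀.1).aestronglyMeasurable ?_ (ae_of_all _ hble)
      (((integrable_const _).sub hc).div_const _) hb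
    filter_upwards [hae] with y hy
    rw [div_le_iff₀ hl₀]
    linarith [hcle y]
  refine ⟨hi, ((integrable_const _).sub (hi.const_mul lam₀)).congr (EventuallyEq.symm hae), ?_⟩
  rw [integral_congr_ae hae, integral_sub (integrable_const _) (hi.const_mul _),
    integral_const_mul]
  simp

theorem klDiv_eq [SigmaFinite μ]
    (K : IsKKTPair μ f₀ f₁ ε₀ ε₁ lam₀ lam₁ mu₀ mu₁ g₀ g₁) :
    klDiv (distOf μ g₀) (distOf μ g₁) =
    ENNReal.ofReal (-1 - mu₀ - lam₀ - lam₀ * ε₀) := by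
  rw [klDiv_distOf K.density₁ K.density₀ K.integrable_log₀,
    K.integral_log₀]

theorem toReal_klDiv_eq [SigmaFinite μ]
    (K : IsKKTPair μ f₀ f₁ ε₀ ε₁ lam₀ lam₁ mu₀ mu₁ g₀ g₁) :
    (klDiv (distOf μ g₀) (distOf μ g₁)).toReal =
    -1 - mu₀ - lam₀ - lam₀ * ε₀ := by
  rw [toReal_klDiv_distOf K.density₁ K.density₀ K.integrable_log₀,
    K.integral_log₀]

theorem toReal_klDiv_le [SigmaFinite μ]
    (K : IsKKTPair μ f₀ f₁ ε₀ ε₁ lam₀ lam₁ mu₀ mu₁ g₀ g₁)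
    {H₀ H₁ : Measure Ω} (hH₀ : H₀ ∈ klClass (distOf μ f₀) ε₀)
    (hH₁ : H₁ ∈ klClass (distOf μ f₁) ε₁) (hne : klDiv H₀ H₁ ≠ ∞) :
    (klDiv (distOf μ g₀) (distOf μ g₁)).toReal ≤ (klDiv H₀ H₁).toReal := by
  have := hH₀.1
  have := hH₁.1
  obtain ⟨hi, hi', he⟩ := K.integral_log_le hH₀ hH₁ hne
  have h1 := integral_le_toReal_klDiv hne (measurable_log_div K.density₁.1 K.density₀.1)
    (K.lintegral_ratio_le hH₁) hi'
  have h2 := integral_log_div_le_of_mem K.nominal₀ K.density₀ K.radius₀_pos hH₀ hi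
  rw [K.toReal_klDiv_eq]
  nlinarith [K.lam₀_pos]

/-- A KKT pair is the unique minimizer. -/
theorem isTypeILeastFavorable_iff [SigmaFinite μ]
    (K : IsKKTPair μ f₀ f₁ ε₀ ε₁ lam₀ lam₁ mu₀ mu₁ g₀ g₁)
    (G₀ G₁ : Measure Ω) :
    IsTypeILeastFavorable (klClass (distOf μ f₀) ε₀) (klClass (distOf μ f₁) ε₁) G₀ G₁ ↔
      G₀ = distOf μ g₀ ∧ G₁ = distOf μ g₁ := by
  constructor
  · rintro ⟨hG₀, hG₁, hmin⟩
    have := hG₀.1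
    have := hG₁.1
    have hle := hmin _ K.mem₀ _ K.mem₁
    have hfin : klDiv (distOf μ g₀) (distOf μ g₁) ≠ ∞ := by
      simp [K.klDiv_eq]
    have hne : klDiv G₀ G₁ ≠ ∞ := ne_top_of_le_ne_top hfin hle
    have hle' := ENNReal.toReal_mono hfin hle
    rw [K.toReal_klDiv_eq] at hle'
    obtain ⟨hi, hi', he⟩ := K.integral_log_le hG₀ hG₁ hne
    have hm := measurable_log_div K.density₁.1 K.density₀.1
    have hmass := K.lintegral_ratio_le hG₁
    have h1 := integral_le_toReal_klDiv hne hm hmass hi'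
    have h2 := integral_log_div_le_of_mem K.nominal₀ K.density₀ K.radius₀_pos hG₀ hi
    have hl₀ := K.lam₀_pos
    have e₀ : G₀ = distOf μ g₀ := by
      refine eq_distOf_of_le_integral K.nominal₀ K.density₀ K.radius₀_pos hG₀ hi ?_
      by_contra hlt
      nlinarith
    refine ⟨e₀, ?_⟩
    -- equality in the Gibbs inequality recovers `G₁` from `G₀` by the density `g₁ / g₀`
    have e₁ := eq_withDensity_of_toReal_klDiv_le hne hm hmass hi' (by nlinarith)
    have e₂ := withDensity_distOf K.density₁ K.density₀
    have hme : Measurable fun y => ENNReal.ofReal (Real.exp (Real.log (g₀ y / g₁ y))) :=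
      (Real.measurable_exp.comp hm).ennreal_ofReal
    have hinv : ∀ ν : Measure Ω, (ν.withDensity fun y =>
        ENNReal.ofReal (Real.exp (Real.log (g₀ y / g₁ y)))).withDensity
        (fun y => ENNReal.ofReal (Real.exp (Real.log (g₀ y / g₁ y))))⁻¹ = ν := fun ν =>
      withDensity_inv_same hme
        (ae_of_all _ fun y => by simpa using Real.exp_pos _) (ae_of_all _ fun y => by simp)
    rw [← hinv G₁, ← e₁, e₀, ← e₂, hinv]
  · rintro ⟨rfl, rfl⟩
    refine ⟨K.mem₀, K.mem₁, fun H₀ hH₀ H₁ hH₁ => ?_⟩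
    by_cases hne : klDiv H₀ H₁ = ∞
    · simp [hne]
    · rw [← ENNReal.toReal_le_toReal (by simp [K.klDiv_eq]) hne]
      exact K.toReal_klDiv_le hH₀ hH₁ hne

end IsKKTPair

end Sufficiency

/-! ### Product measures and the weak law of large numbers -/

section Product

variable {Ω : Type*} [MeasurableSpace Ω]

theorem lintegral_pi_prod (P : Measure Ω) [IsProbabilityMeasure P] {n : ℕ}
    {φ : Fin n → Ω → ℝ≥0∞} (hφ : ∀ k, Measurable (φ k)) :
    ∫⁻ y, ∏ k, φ k (y k) ∂(Measure.pi fun _ : Fin n => P) = ∏ k, ∫⁻ x, φ k x ∂P := by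
  have h := ProbabilityTheory.lintegral_prod_eq_prod_lintegral_of_indepFun Finset.univ
    (fun (k : Fin n) (y : Fin n → Ω) => φ k (y k))
    (ProbabilityTheory.iIndepFun_pi (μ := fun _ : Fin n => P) (X := φ)
      fun k => (hφ k).aemeasurable) (fun k => (hφ k).comp (measurable_pi_apply k))
  rw [h]
  refine Finset.prod_congr rfl fun k _ => ?_
  exact (measurePreserving_eval (fun _ : Fin n => P) k).lintegral_comp (hφ k)

theorem pi_withDensity (P : Measure Ω) [IsProbabilityMeasure P] (n : ℕ) {φ : Ω → ℝ≥0∞}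
    (hφ : Measurable φ) [IsProbabilityMeasure (P.withDensity φ)] :
    (Measure.pi fun _ : Fin n => P.withDensity φ) =
      (Measure.pi fun _ : Fin n => P).withDensity fun y => ∏ k, φ (y k) := by
  refine Measure.pi_eq fun s hs => ?_
  rw [withDensity_apply _ (MeasurableSet.univ_pi hs), ← lintegral_indicator (.univ_pi hs)]
  have h : ∀ y : Fin n → Ω, (Set.univ.pi s).indicator (fun y => ∏ k, φ (y k)) y =
      ∏ k, (s k).indicator φ (y k) := by
    intro y
    by_cases hy : y ∈ Set.univ.pi s
    · rw [Set.indicator_of_mem hy]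
      exact Finset.prod_congr rfl fun k _ => (Set.indicator_of_mem (hy k trivial) _).symm
    · rw [Set.indicator_of_notMem hy]
      simp only [Set.mem_pi, not_forall] at hy
      obtain ⟨k, -, hk⟩ := hy
      exact (Finset.prod_eq_zero (Finset.mem_univ k) (Set.indicator_of_notMem hk _)).symm
  simp_rw [h]
  rw [lintegral_pi_prod P fun k => hφ.indicator (hs k)]
  refine Finset.prod_congr rfl fun k _ => ?_
  rw [lintegral_indicator (hs k), withDensity_apply _ (hs k)]

theorem measurePreserving_infinitePi_fin (Q : Measure Ω) [IsProbabilityMeasure Q] (n : ℕ) :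
    MeasurePreserving (fun (ω : ℕ → Ω) (k : Fin n) => ω k)
      (Measure.infinitePi fun _ : ℕ => Q) (Measure.pi fun _ : Fin n => Q) := by
  have hm : Measurable fun (ω : ℕ → Ω) (k : Fin n) => ω k := by fun_prop
  refine ⟨hm, (Measure.pi_eq fun s hs => ?_).symm⟩
  rw [Measure.map_apply hm (MeasurableSet.univ_pi hs)]
  have hpre : (fun (ω : ℕ → Ω) (k : Fin n) => ω k) ⁻¹' Set.univ.pi s =
      Set.pi (Finset.range n : Set ℕ) fun i => if h : i < n then s ⟨i, h⟩ else Set.univ := by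
    ext ω
    simp only [Set.mem_preimage, Set.mem_pi, Set.mem_univ, forall_true_left, Finset.coe_range,
      Set.mem_Iio]
    constructor
    · intro h i hi
      rw [dif_pos hi]
      exact h ⟨i, hi⟩
    · intro h k
      have := h k k.2
      rwa [dif_pos k.2] at this
  rw [hpre, Measure.infinitePi_pi, Finset.prod_range]
  · refine Finset.prod_congr rfl fun k _ => ?_
    rw [dif_pos k.2]
  · intro i hi
    rw [dif_pos (Finset.mem_range.1 hi)]
    exact hs _

theorem measurable_empMean {X : Ω → ℝ} (hX : Measurable X) (n : ℕ) :
    Measurable (empMean X n) := by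
  unfold empMean
  fun_prop

theorem ae_tendsto_mean (Q : Measure Ω) [IsProbabilityMeasure Q] {X : Ω → ℝ} (hX : Measurable X)
    (hi : Integrable X Q) : ∀ᵐ ω ∂(Measure.infinitePi fun _ : ℕ => Q),
      Tendsto (fun n : ℕ => (∑ i ∈ Finset.range n, X (ω i)) / n) atTop (𝓝 (∫ x, X x ∂Q)) := by
  have hmp := fun i => measurePreserving_eval_infinitePi (fun _ : ℕ => Q) i
  have hind := ProbabilityTheory.iIndepFun_infinitePi (P := fun _ : ℕ => Q)
    (X := fun _ : ℕ => X) fun _ => hX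
  have h := ProbabilityTheory.strong_law_ae_real (μ := Measure.infinitePi fun _ : ℕ => Q)
    (fun i ω => X (ω i)) ((hmp 0).integrable_comp_of_integrable hi)
    (fun i j hij => hind.indepFun hij) (fun i => ?_)
  · rwa [show ∫ ω : ℕ → Ω, X (ω 0) ∂(Measure.infinitePi fun _ : ℕ => Q) = ∫ x, X x ∂Q by
      conv_rhs => rw [← (hmp 0).map_eq]
      rw [integral_map (hmp 0).measurable.aemeasurable hX.aestronglyMeasurable]] at h
  · refine ⟨(hX.comp (hmp i).measurable).aemeasurable,
      (hX.comp (hmp 0).measurable).aemeasurable, ?_⟩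
    have hc : ∀ j, (Measure.infinitePi fun _ : ℕ => Q).map (fun ω : ℕ → Ω => X (ω j)) =
        Q.map X := fun j => by
      conv_rhs => rw [← (hmp j).map_eq]
      rw [Measure.map_map hX (hmp j).measurable]
      rfl
    rw [hc, hc]

/-- Weak law of large numbers for two statistics at once. -/
theorem eventually_half_le_pi (Q : Measure Ω) [IsProbabilityMeasure Q] {X Z : Ω → ℝ} {a b : ℝ}
    (hX : Measurable X) (hZ : Measurable Z) (hXi : Integrable X Q) (hZi : Integrable Z Q)
    (ha : ∫ x, X x ∂Q < a) (hb : ∫ x, Z x ∂Q < b) :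
    ∀ᶠ n : ℕ in atTop, 2⁻¹ ≤ (Measure.pi fun _ : Fin n => Q)
      {y | empMean X n y < a ∧ empMean Z n y < b} := by
  have hms : ∀ n, MeasurableSet {y | empMean X n y < a ∧ empMean Z n y < b} := fun n =>
    (measurableSet_lt (measurable_empMean hX n) measurable_const).inter
      (measurableSet_lt (measurable_empMean hZ n) measurable_const)
  have hmp := measurePreserving_infinitePi_fin Q
  have h := tendsto_measure_of_ae_tendsto_indicator_of_isFiniteMeasure (α := ℕ → Ω)
    (μ := Measure.infinitePi fun _ : ℕ => Q) (atTop : Filter ℕ) (A := Set.univ)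
    (As := fun n => (fun (ω : ℕ → Ω) (k : Fin n) => ω k) ⁻¹'
      {y | empMean X n y < a ∧ empMean Z n y < b}) MeasurableSet.univ
    (fun n => (hmp n).measurable (hms n)) ?_
  · simp only [(hmp _).measure_preimage (hms _).nullMeasurableSet, measure_univ] at h
    exact h.eventually_const_le (by simp)
  · filter_upwards [ae_tendsto_mean Q hX hXi, ae_tendsto_mean Q hZ hZi] with ω h1 h2
    filter_upwards [h1.eventually_lt_const ha, h2.eventually_lt_const hb] with n hn1 hn2
    simp only [Set.mem_preimage, Set.mem_ofPred_eq, Set.mem_univ, iff_true, empMean]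
    rw [Finset.sum_range] at hn1 hn2
    exact ⟨hn1, hn2⟩

end Product

/-! ### Exponential bounds for empirical means -/

section Rates

variable {Ω : Type*} [MeasurableSpace Ω]

theorem log_div_natCast_le {p : ℝ≥0∞} {n : ℕ} (hn : 0 < n) {c : ℝ}
    (h : p ≤ ENNReal.ofReal (Real.exp (n * c))) : ENNReal.log p / (n : EReal) ≤ c := by
  rw [EReal.div_le_iff_le_mul (by exact_mod_cast hn) (EReal.natCast_ne_top n)]
  refine (ENNReal.log_le_log h).trans ?_
  rw [ENNReal.log_ofReal_of_pos (Real.exp_pos _), Real.log_exp, EReal.coe_mul]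
  exact le_of_eq (by rfl)

theorem le_log_div_natCast {p : ℝ≥0∞} {n : ℕ} (hn : 0 < n) {c : ℝ}
    (h : ENNReal.ofReal (Real.exp (n * c)) ≤ p) : (c : EReal) ≤ ENNReal.log p / (n : EReal) := by
  rw [EReal.le_div_iff_mul_le (by exact_mod_cast hn) (EReal.natCast_ne_top n)]
  refine le_trans ?_ (ENNReal.log_le_log h)
  rw [ENNReal.log_ofReal_of_pos (Real.exp_pos _), Real.log_exp, EReal.coe_mul, mul_comm]
  exact le_of_eq (by rfl)

/-- Chernoff bound for a statistic whose exponential has mean at most one. -/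
theorem pi_le_empMean_le (H : Measure Ω) [IsProbabilityMeasure H] {V : Ω → ℝ} (hV : Measurable V)
    (hmass : ∫⁻ x, ENNReal.ofReal (Real.exp (V x)) ∂H ≤ 1) (t : ℝ) {n : ℕ} (hn : 0 < n) :
    (Measure.pi fun _ : Fin n => H) {y | t ≤ empMean V n y} ≤
      ENNReal.ofReal (Real.exp (n * -t)) := by
  have hφ : Measurable fun x => ENNReal.ofReal (Real.exp (V x)) := by fun_prop
  have hint : ∫⁻ y, ∏ k, ENNReal.ofReal (Real.exp (V (y k))) ∂(Measure.pi fun _ : Fin n => H)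
      ≤ 1 := by
    rw [lintegral_pi_prod H (φ := fun _ x => ENNReal.ofReal (Real.exp (V x))) fun _ => hφ]
    exact Finset.prod_le_one' fun _ _ => hmass
  have hsub : {y | t ≤ empMean V n y} ⊆ {y : Fin n → Ω | ENNReal.ofReal (Real.exp (n * t)) ≤
      ∏ k, ENNReal.ofReal (Real.exp (V (y k)))} := by
    intro y hy
    have hn' : (0 : ℝ) < n := by exact_mod_cast hn
    simp only [Set.mem_ofPred_eq, empMean] at hy ⊢
    rw [le_div_iff₀ hn'] at hy
    rw [← ENNReal.ofReal_prod_of_nonneg fun _ _ => (Real.exp_pos _).le, ← Real.exp_sum]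
    exact ENNReal.ofReal_le_ofReal (Real.exp_le_exp.2 (by linarith))
  have hmk := meas_ge_le_lintegral_div (μ := Measure.pi fun _ : Fin n => H)
    (f := fun y => ∏ k, ENNReal.ofReal (Real.exp (V (y k))))
    (Finset.measurable_prod _ fun k _ => hφ.comp (measurable_pi_apply k)).aemeasurable
    (ε := ENNReal.ofReal (Real.exp (n * t))) (by simpa using Real.exp_pos _) (by simp)
  refine (measure_mono hsub).trans (hmk.trans ?_)
  refine (ENNReal.div_le_div_right hint _).trans ?_
  rw [mul_neg, Real.exp_neg, ENNReal.ofReal_inv_of_pos (Real.exp_pos _), one_div]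

/-- Change of measure: if the statistic has mean below `t` under the distribution with
`P`-density `r`, then under `P` the event `S_n < t` has exponential rate at least minus the
divergence. -/
theorem eventually_le_rate (P : Measure Ω) [IsProbabilityMeasure P] {r X : Ω → ℝ}
    (hr : IsPosDensity P r) (hX : Measurable X) (hXi : Integrable X (distOf P r))
    (hri : Integrable (fun x => Real.log (r x)) (distOf P r)) {t d : ℝ}
    (ht : ∫ x, X x ∂(distOf P r) < t) (hd : ∫ x, Real.log (r x) ∂(distOf P r) < d)
    {c : ℝ} (hc : c < -d) :
    ∀ᶠ n : ℕ in atTop, (c : EReal) ≤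
      ENNReal.log ((Measure.pi fun _ : Fin n => P) {y | empMean X n y < t}) / (n : EReal) := by
  have hQ := hr.isProbabilityMeasure
  have hlog : Measurable fun x => Real.log (r x) := Real.measurable_log.comp hr.1
  have hlarge : ∀ᶠ n : ℕ in atTop, Real.exp (n * (c + d)) ≤ 2⁻¹ := by
    have h : Tendsto (fun n : ℕ => Real.exp (n * (c + d))) atTop (𝓝 0) :=
      Real.tendsto_exp_atBot.comp (tendsto_natCast_atTop_atTop.atTop_mul_const_of_neg (by linarith))
    exact h.eventually_le_const (by norm_num)
  filter_upwards [eventually_half_le_pi (distOf P r) hX hlog hXi hri ht hd, hlarge,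
    eventually_gt_atTop 0] with n hhalf hn hn0
  refine le_log_div_natCast hn0 ?_
  have hn' : (0 : ℝ) < n := by exact_mod_cast hn0
  set A : Set (Fin n → Ω) := {y | empMean X n y < t ∧ empMean (fun x => Real.log (r x)) n y < d}
  have hA : MeasurableSet A :=
    (measurableSet_lt (measurable_empMean hX n) measurable_const).inter
      (measurableSet_lt (measurable_empMean hlog n) measurable_const)
  have hbound : (Measure.pi fun _ : Fin n => distOf P r) A ≤
      ENNReal.ofReal (Real.exp (n * d)) * (Measure.pi fun _ : Fin n => P) A := by
    have hQ' : IsProbabilityMeasure (P.withDensity fun x => ENNReal.ofReal (r x)) := hQ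
    rw [distOf, pi_withDensity P n hr.1.ennreal_ofReal, withDensity_apply _ hA,
      ← setLIntegral_const]
    refine setLIntegral_mono' hA fun y hy => ?_
    by_cases hpos : ∀ k, 0 < r (y k)
    · rw [← ENNReal.ofReal_prod_of_nonneg fun k _ => (hpos k).le]
      refine ENNReal.ofReal_le_ofReal ?_
      have h2 := hy.2
      rw [empMean, div_lt_iff₀ hn'] at h2
      calc ∏ k, r (y k) = Real.exp (∑ k, Real.log (r (y k))) := by
            rw [Real.exp_sum]
            exact Finset.prod_congr rfl fun k _ => (Real.exp_log (hpos k)).symm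
        _ ≤ Real.exp (n * d) := Real.exp_le_exp.2 (by linarith)
    · obtain ⟨k, hk⟩ := not_forall.1 hpos
      rw [Finset.prod_eq_zero (Finset.mem_univ k)
        (ENNReal.ofReal_eq_zero.2 (not_lt.1 hk))]
      exact zero_le
  have hsub : (Measure.pi fun _ : Fin n => P) A ≤
      (Measure.pi fun _ : Fin n => P) {y | empMean X n y < t} := measure_mono fun y hy => hy.1
  refine le_trans ?_ hsub
  have hexp : Real.exp (n * c) = Real.exp (n * (c + d)) * Real.exp (-(n * d)) := by
    rw [← Real.exp_add]
    ring_nf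
  have hchain := hhalf.trans hbound
  calc ENNReal.ofReal (Real.exp (n * c))
      = ENNReal.ofReal (Real.exp (n * (c + d))) * ENNReal.ofReal (Real.exp (-(n * d))) := by
        rw [hexp, ENNReal.ofReal_mul (Real.exp_pos _).le]
    _ ≤ ENNReal.ofReal (Real.exp (n * d)) * (Measure.pi fun _ : Fin n => P) A *
        ENNReal.ofReal (Real.exp (-(n * d))) := by
        gcongr
        refine le_trans ?_ hchain
        refine (ENNReal.ofReal_le_ofReal hn).trans (le_of_eq ?_)
        rw [ENNReal.ofReal_inv_of_pos two_pos]
        simp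
    _ = (Measure.pi fun _ : Fin n => P) A := by
        rw [mul_right_comm, ← ENNReal.ofReal_mul (Real.exp_pos _).le, ← Real.exp_add]
        simp

/-- A small bounded change of density that strictly decreases the mean of a nonconstant
statistic. -/
theorem exists_tilt (G : Measure Ω) [IsProbabilityMeasure G] {X : Ω → ℝ} (hX : Measurable X)
    (hXi : Integrable X G) (hne : ¬ ∀ᵐ x ∂G, X x = ∫ z, X z ∂G) {δ : ℝ} (hδ : 0 < δ)
    (hδ1 : δ < 1) :
    ∃ q : Ω → ℝ, IsPosDensity G q ∧ (∀ x, |q x - 1| ≤ δ) ∧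
      ∫ x, q x * X x ∂G < ∫ x, X x ∂G := by
  set m := ∫ z, X z ∂G
  set A : Set Ω := {x | X x < m}
  have hA : MeasurableSet A := measurableSet_lt hX measurable_const
  set p : ℝ := G.real A
  have hp0 : 0 ≤ p := measureReal_nonneg
  have hp1 : p ≤ 1 := measureReal_le_one
  have hYi : Integrable (fun x => m - X x) G := (integrable_const _).sub hXi
  -- the mean deficit on `A` is positive, since otherwise `X ≥ m` a.e., hence `X = m` a.e.
  have hpos : 0 < ∫ x in A, (m - X x) ∂G := by
    refine lt_of_le_of_ne (setIntegral_nonneg hA fun x hx => ?_) fun h0 => hne ?_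
    · have : X x < m := hx
      linarith
    have hA0 : ∀ᵐ x ∂G, m ≤ X x := by
      have h := (setIntegral_eq_zero_iff_of_nonneg_ae (μ := G) (s := A) (f := fun x => m - X x)
        ((ae_restrict_iff' hA).2 (ae_of_all _ fun x hx => by
          have : X x < m := hx
          simp only [Pi.zero_apply]
          linarith)) hYi.integrableOn).1 h0.symm
      filter_upwards [(ae_restrict_iff' hA).1 h] with x hx
      by_contra hlt
      have := hx (not_le.1 hlt)
      simp only [Pi.zero_apply] at this
      exact hlt (by linarith)
    have h2 : ∫ x, (X x - m) ∂G = 0 := by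
      rw [integral_sub hXi (integrable_const _)]
      simp [m]
    have h3 := (integral_eq_zero_iff_of_nonneg_ae (hA0.mono fun x hx => by
      simp only [Pi.zero_apply, Pi.sub_apply]
      linarith) (hXi.sub (integrable_const m))).1 h2
    filter_upwards [h3] with x hx
    simp only [Pi.zero_apply, Pi.sub_apply] at hx
    linarith
  have hset : ∫ x in A, X x ∂G < p * m := by
    rw [integral_sub (integrable_const _).integrableOn hXi.integrableOn, setIntegral_const] at hpos
    simpa [p] using hpos
  set q : Ω → ℝ := fun x => (1 - δ * p) + δ * A.indicator (fun _ => (1 : ℝ)) x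
  have hind : ∀ x, A.indicator (fun _ => (1 : ℝ)) x = 0 ∨ A.indicator (fun _ => (1 : ℝ)) x = 1 :=
    fun x => by
      by_cases hx : x ∈ A
      · exact Or.inr (Set.indicator_of_mem hx _)
      · exact Or.inl (Set.indicator_of_notMem hx _)
  have hqδ : ∀ x, |q x - 1| ≤ δ := fun x => by
    simp only [q]
    rw [abs_le]
    rcases hind x with h | h <;> rw [h] <;> constructor <;> nlinarith
  have hii : Integrable (A.indicator fun _ => (1 : ℝ)) G := (integrable_const _).indicator hA
  refine ⟨q, ⟨?_, ae_of_all _ fun x => ?_, ?_, ?_⟩, hqδ, ?_⟩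
  · exact measurable_const.add ((measurable_const.indicator hA).const_mul _)
  · linarith [(abs_le.1 (hqδ x)).1]
  · exact (integrable_const _).add (hii.const_mul _)
  · rw [integral_add (integrable_const _) (hii.const_mul _), integral_const_mul,
      integral_indicator hA, setIntegral_const]
    simp [p]
  · have he : (fun x => q x * X x) = fun x => (1 - δ * p) * X x + δ * A.indicator X x := by
      funext x
      simp only [q]
      by_cases hx : x ∈ A
      · rw [Set.indicator_of_mem hx, Set.indicator_of_mem hx]; ring
      · rw [Set.indicator_of_notMem hx, Set.indicator_of_notMem hx]; ring
    rw [he, integral_add (hXi.const_mul _) ((hXi.indicator hA).const_mul _), integral_const_mul,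
      integral_const_mul, integral_indicator hA]
    nlinarith

/-- Large-deviation lower bound at the mean: if `G` has `P`-density `exp V`, then under `P` the
event that `S_n` falls below the `G`-mean of `X` has exponential rate at least
`-D_KL(G, P) = -𝔼_G[V]`. -/
theorem eventually_le_rate_at_mean (P G : Measure Ω) [IsProbabilityMeasure P] {V X : Ω → ℝ}
    (hV : IsPosDensity P fun x => Real.exp (V x)) (hG : G = distOf P fun x => Real.exp (V x))
    (hVi : Integrable V G) (hX : Measurable X) (hXi : Integrable X G)
    (hne : ¬ ∀ᵐ x ∂G, X x = ∫ z, X z ∂G) {c : ℝ} (hc : c < -∫ x, V x ∂G) :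
    ∀ᶠ n : ℕ in atTop, (c : EReal) ≤ ENNReal.log ((Measure.pi fun _ : Fin n => P)
      {y | empMean X n y < ∫ x, X x ∂G}) / (n : EReal) := by
  have hGp : IsProbabilityMeasure G := hG ▸ hV.isProbabilityMeasure
  set M := ∫ x, |V x| ∂G
  have hM : 0 ≤ M := integral_nonneg fun x => abs_nonneg _
  obtain ⟨δ, hδ0, hδ1, hδ⟩ : ∃ δ : ℝ, 0 < δ ∧ δ < 1 ∧ c < -(∫ x, V x ∂G + δ * (3 + M)) := by
    refine ⟨min (1 / 2) ((-c - ∫ x, V x ∂G) / (2 * (3 + M))), ?_, ?_, ?_⟩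
    · exact lt_min (by norm_num) (div_pos (by linarith) (by linarith))
    · exact (min_le_left _ _).trans_lt (by norm_num)
    · have h := mul_le_mul_of_nonneg_right (min_le_right (1 / 2 : ℝ)
        ((-c - ∫ x, V x ∂G) / (2 * (3 + M)))) (by linarith : 0 ≤ 3 + M)
      have h2 : (-c - ∫ x, V x ∂G) / (2 * (3 + M)) * (3 + M) = (-c - ∫ x, V x ∂G) / 2 := by
        have : 3 + M ≠ 0 := by linarith
        field_simp
      linarith
  obtain ⟨q, hq, hq1, hqX⟩ := exists_tilt G hX hXi hne hδ0 hδ1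
  have hqpos : ∀ x, 0 < q x := fun x => by linarith [(abs_le.1 (hq1 x)).1]
  have hqle : ∀ x, q x ≤ 1 + δ := fun x => by linarith [(abs_le.1 (hq1 x)).2]
  have hbdd : ∀ {U : Ω → ℝ}, Integrable U G → Integrable (fun x => q x * U x) G := fun hU =>
    hU.bdd_mul (c := 1 + δ) hq.1.aestronglyMeasurable (ae_of_all _ fun x => by
      rw [Real.norm_eq_abs, abs_of_pos (hqpos x)]
      exact hqle x)
  have hr : IsPosDensity P fun x => Real.exp (V x) * q x := by
    refine ⟨hV.1.mul hq.1, ae_of_all _ fun x => mul_pos (Real.exp_pos _) (hqpos x), ?_, ?_⟩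
    · have := hq.2.2.1
      rwa [hG, integrable_distOf_iff hV] at this
    · have := hq.2.2.2
      rwa [hG, integral_distOf hV] at this
  have hdist : distOf P (fun x => Real.exp (V x) * q x) = distOf G q := by
    rw [hG, distOf, distOf, distOf, ← withDensity_mul _ hV.1.ennreal_ofReal hq.1.ennreal_ofReal]
    congr 1
    funext x
    rw [Pi.mul_apply, ENNReal.ofReal_mul (Real.exp_pos _).le]
  have hlog : ∀ x, Real.log (Real.exp (V x) * q x) = V x + Real.log (q x) := fun x => by
    rw [Real.log_mul (Real.exp_pos _).ne' (hqpos x).ne', Real.log_exp]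
  have hlq : ∀ x, q x * Real.log (q x) ≤ 2 * δ := fun x => by
    have h1 := Real.log_le_sub_one_of_pos (hqpos x)
    have h2 := hqle x
    have h3 := hqpos x
    rcases le_total (Real.log (q x)) 0 with h | h <;> nlinarith
  have hlqi : Integrable (fun x => q x * Real.log (q x)) G := by
    refine hbdd (Integrable.of_bound (C := max |Real.log (1 - δ)| |Real.log (1 + δ)|)
      (Real.measurable_log.comp hq.1).aestronglyMeasurable (ae_of_all _ fun x => ?_))
    rw [Real.norm_eq_abs]
    exact abs_le_max_abs_abs
      (Real.log_le_log (by linarith) (by linarith [(abs_le.1 (hq1 x)).1]))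
      (Real.log_le_log (hqpos x) (hqle x))
  have hVq := hbdd hVi
  have hsum : (fun x => q x * Real.log (Real.exp (V x) * q x)) =
      fun x => q x * V x + q x * Real.log (q x) := by
    funext x
    rw [hlog, mul_add]
  refine eventually_le_rate P hr hX ?_ ?_ ?_ ?_ hδ
  · rw [hdist, integrable_distOf_iff hq]
    exact hbdd hXi
  · rw [hdist, integrable_distOf_iff hq, hsum]
    exact hVq.add hlqi
  · rwa [hdist, integral_distOf hq]
  · rw [hdist, integral_distOf hq, hsum, integral_add hVq hlqi]
    have h1 : ∫ x, q x * Real.log (q x) ∂G ≤ 2 * δ := by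
      refine (integral_mono hlqi (integrable_const (2 * δ)) hlq).trans ?_
      simp
    have h2 : ∫ x, q x * V x ∂G ≤ ∫ x, (V x + δ * |V x|) ∂G := by
      refine integral_mono hVq (hVi.add (hVi.abs.const_mul δ)) fun x => ?_
      have h := abs_le.1 ((abs_mul (q x - 1) (V x)).le.trans
        (mul_le_mul_of_nonneg_right (hq1 x) (abs_nonneg (V x))))
      simp only
      nlinarith [h.2]
    rw [integral_add hVi (hVi.abs.const_mul δ), integral_const_mul] at h2
    change _ ≤ _ + δ * M at h2
    nlinarith

end Rates

/-! ### Error exponents of the optimal test -/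

section Exponents

variable {Ω : Type*} [MeasurableSpace Ω] {μ : Measure Ω} {f₀ f₁ g₀ g₁ : Ω → ℝ}
  {ε₀ ε₁ lam₀ lam₁ mu₀ mu₁ : ℝ}

theorem tendsto_of_real_bounds {u : ℕ → EReal} {a : ℝ}
    (hl : ∀ c : ℝ, c < a → ∀ᶠ n in atTop, (c : EReal) ≤ u n)
    (hu : ∀ᶠ n in atTop, u n ≤ a) : Tendsto u atTop (𝓝 (a : EReal)) := by
  refine tendsto_order.2 ⟨fun b hb => ?_, fun b hb => hu.mono fun n hn => hn.trans_lt hb⟩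
  obtain ⟨c, hbc, hca⟩ := EReal.lt_iff_exists_real_btwn.1 hb
  exact (hl c (EReal.coe_lt_coe_iff.1 hca)).mono fun n hn => hbc.trans_le hn

theorem empMean_neg {Ω : Type*} (X : Ω → ℝ) (n : ℕ) (y : Fin n → Ω) :
    empMean (fun x => -X x) n y = -empMean X n y := by
  simp [empMean, Finset.sum_neg_distrib, neg_div]

theorem setOf_lt_subset_setOf_le {α : Type*} (f g : α → ℝ) :
    {y | f y < g y} ⊆ {y | f y ≤ g y} := fun y hy => by
  have h : f y < g y := hy
  exact h.le

theorem eventually_rate_le_zero (H : Measure Ω) [IsProbabilityMeasure H]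
    (A : (n : ℕ) → Set (Fin n → Ω)) :
    ∀ᶠ n : ℕ in atTop,
      ENNReal.log ((Measure.pi fun _ : Fin n => H) (A n)) / (n : EReal) ≤ (0 : ℝ) := by
  filter_upwards [eventually_gt_atTop 0] with n hn
  exact log_div_natCast_le hn (by simpa using prob_le_one)

namespace IsKKTPair

theorem coe_klDiv_eq [SigmaFinite μ]
    (K : IsKKTPair μ f₀ f₁ ε₀ ε₁ lam₀ lam₁ mu₀ mu₁ g₀ g₁) :
    -(klDiv (distOf μ g₀) (distOf μ g₁) : EReal) =
      ((-∫ y, Real.log (g₀ y / g₁ y) ∂(distOf μ g₀) : ℝ) : EReal) := by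
  rw [klDiv_distOf K.density₁ K.density₀ K.integrable_log₀, EReal.coe_ennreal_ofReal,
    max_eq_left (integral_log_nonneg K.density₁ K.density₀ K.integrable_log₀), EReal.coe_neg]

/-- The log-likelihood ratio is not constant, because a constant one would make the two least
favorable distributions equal. -/
theorem not_ae_const (K : IsKKTPair μ f₀ f₁ ε₀ ε₁ lam₀ lam₁ mu₀ mu₁ g₀ g₁)
    (hdisj : Disjoint (klClass (distOf μ f₀) ε₀) (klClass (distOf μ f₁) ε₁)) (m : ℝ) :
    ¬ ∀ᵐ y ∂(distOf μ g₀), Real.log (g₀ y / g₁ y) = m := by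
  intro h
  have hae : ∀ᵐ y ∂μ, g₀ y = Real.exp m * g₁ y := by
    filter_upwards [K.density₀.absolutelyContinuous.ae_le h, K.density₀.2.1, K.density₁.2.1]
      with y hy h0 h1
    rw [← hy, Real.exp_log (div_pos h0 h1), div_mul_cancel₀ _ h1.ne']
  have h1 : Real.exp m = 1 := by
    have := K.density₀.2.2.2
    rwa [integral_congr_ae hae, integral_const_mul, K.density₁.2.2.2, mul_one] at this
  have heq : distOf μ g₀ = distOf μ g₁ := by
    refine withDensity_congr_ae ?_
    filter_upwards [hae] with y hy
    rw [hy, h1, one_mul]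
  exact Set.disjoint_left.1 hdisj K.mem₀ (heq ▸ K.mem₁)

theorem tendsto_rate₀ [SigmaFinite μ]
    (K : IsKKTPair μ f₀ f₁ ε₀ ε₁ lam₀ lam₁ mu₀ mu₁ g₀ g₁)
    (hdisj : Disjoint (klClass (distOf μ f₀) ε₀) (klClass (distOf μ f₁) ε₁))
    (A : (n : ℕ) → Set (Fin n → Ω))
    (hA : ∀ n, {y | empMean (fun y => Real.log (g₀ y / g₁ y)) n y <
      ∫ y, Real.log (g₀ y / g₁ y) ∂(distOf μ g₀)} ⊆ A n) :
    Tendsto (fun n : ℕ => ENNReal.log ((Measure.pi fun _ : Fin n => distOf μ g₀) (A n)) /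
      (n : EReal)) atTop (𝓝 0) := by
  have := K.density₀.isProbabilityMeasure
  refine tendsto_of_real_bounds (a := 0) (fun c hc => ?_) (eventually_rate_le_zero _ _)
  have hone : IsPosDensity (distOf μ g₀) fun _ => Real.exp 0 := by
    refine ⟨measurable_const, ae_of_all _ fun _ => Real.exp_pos 0, integrable_const _, ?_⟩
    simp
  have h := eventually_le_rate_at_mean (distOf μ g₀) (distOf μ g₀) (V := fun _ => 0) hone
    (by simp [distOf]) (integrable_const _)
    (measurable_log_div K.density₁.1 K.density₀.1) K.integrable_log₀
    (K.not_ae_const hdisj _) (c := c) (by simpa using hc)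
  filter_upwards [h, eventually_gt_atTop 0] with n hn hn0
  exact hn.trans (EReal.div_le_div_right_of_nonneg (by positivity)
    (ENNReal.log_le_log (measure_mono (hA n))))

theorem eventually_rate₁_le [SigmaFinite μ]
    (K : IsKKTPair μ f₀ f₁ ε₀ ε₁ lam₀ lam₁ mu₀ mu₁ g₀ g₁)
    {H : Measure Ω} (hH : H ∈ klClass (distOf μ f₁) ε₁) (B : (n : ℕ) → Set (Fin n → Ω))
    (hB : ∀ n, B n ⊆ {y | ∫ y, Real.log (g₀ y / g₁ y) ∂(distOf μ g₀) ≤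
      empMean (fun y => Real.log (g₀ y / g₁ y)) n y}) :
    ∀ᶠ n : ℕ in atTop, ENNReal.log ((Measure.pi fun _ : Fin n => H) (B n)) / (n : EReal) ≤
      ((-∫ y, Real.log (g₀ y / g₁ y) ∂(distOf μ g₀) : ℝ) : EReal) := by
  have := hH.1
  filter_upwards [eventually_gt_atTop 0] with n hn
  exact log_div_natCast_le hn ((measure_mono (hB n)).trans
    (pi_le_empMean_le H (measurable_log_div K.density₁.1 K.density₀.1) (K.lintegral_ratio_le hH)
      _ hn))

theorem tendsto_rate₁ [SigmaFinite μ]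
    (K : IsKKTPair μ f₀ f₁ ε₀ ε₁ lam₀ lam₁ mu₀ mu₁ g₀ g₁)
    (hdisj : Disjoint (klClass (distOf μ f₀) ε₀) (klClass (distOf μ f₁) ε₁))
    (B : (n : ℕ) → Set (Fin n → Ω))
    (hB : ∀ n, B n ⊆ {y | ∫ y, Real.log (g₀ y / g₁ y) ∂(distOf μ g₀) ≤
      empMean (fun y => Real.log (g₀ y / g₁ y)) n y})
    (hB' : ∀ n, {y | ∫ y, Real.log (g₀ y / g₁ y) ∂(distOf μ g₀) <
      empMean (fun y => Real.log (g₀ y / g₁ y)) n y} ⊆ B n) :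
    Tendsto (fun n : ℕ => ENNReal.log ((Measure.pi fun _ : Fin n => distOf μ g₁) (B n)) /
      (n : EReal)) atTop (𝓝 (-(klDiv (distOf μ g₀) (distOf μ g₁) : EReal))) := by
  have := K.density₁.isProbabilityMeasure
  rw [K.coe_klDiv_eq]
  refine tendsto_of_real_bounds (fun c hc => ?_) (K.eventually_rate₁_le K.mem₁ B hB)
  have hm := measurable_log_div K.density₁.1 K.density₀.1
  have hdens : IsPosDensity (distOf μ g₁) fun y => Real.exp (Real.log (g₀ y / g₁ y)) := by
    have hl := lintegral_exp_log_div K.density₁ K.density₀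
    have hme := Real.measurable_exp.comp hm
    refine ⟨hme, ae_of_all _ fun _ => Real.exp_pos _, ⟨hme.aestronglyMeasurable, ?_⟩, ?_⟩
    · rw [hasFiniteIntegral_iff_ofReal (ae_of_all _ fun _ => (Real.exp_pos _).le), hl]
      exact ENNReal.one_lt_top
    · rw [integral_eq_lintegral_of_nonneg_ae (ae_of_all _ fun _ => (Real.exp_pos _).le)
        hme.aestronglyMeasurable, hl, ENNReal.toReal_one]
  have h := eventually_le_rate_at_mean (distOf μ g₁) (distOf μ g₀) hdens
    (withDensity_distOf K.density₁ K.density₀).symm K.integrable_log₀ hm.neg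
    K.integrable_log₀.neg ?_ hc
  · filter_upwards [h, eventually_gt_atTop 0] with n hn hn0
    refine hn.trans (EReal.div_le_div_right_of_nonneg (by positivity)
      (ENNReal.log_le_log (measure_mono fun y hy => hB' n ?_)))
    have hy' : empMean (fun y => -Real.log (g₀ y / g₁ y)) n y <
        ∫ y, -Real.log (g₀ y / g₁ y) ∂(distOf μ g₀) := hy
    rw [empMean_neg, integral_neg] at hy'
    exact neg_lt_neg_iff.1 hy'
  · intro hc'
    refine K.not_ae_const hdisj (-∫ y, -Real.log (g₀ y / g₁ y) ∂(distOf μ g₀)) ?_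
    filter_upwards [hc'] with y hy
    have hy' : -Real.log (g₀ y / g₁ y) = ∫ y, -Real.log (g₀ y / g₁ y) ∂(distOf μ g₀) := hy
    linarith

end IsKKTPair

theorem log_div_swap (a b : ℝ) : Real.log (a / b) = -Real.log (b / a) := by
  rw [← Real.log_inv, inv_div]

/-- The test with the statistic `log (g₁ / g₀)` and the threshold at its mean under `g₀`. -/
theorem IsKKTPair.typeI_robust [SigmaFinite μ]
    (K : IsKKTPair μ f₀ f₁ ε₀ ε₁ lam₀ lam₁ mu₀ mu₁ g₀ g₁)
    (hdisj : Disjoint (klClass (distOf μ f₀) ε₀) (klClass (distOf μ f₁) ε₁)) {t : ℝ}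
    (ht : t = ∫ y, Real.log (g₁ y / g₀ y) ∂(distOf μ g₀)) :
    IsAsymptoticallyMinimaxRobust (klClass (distOf μ f₀) ε₀) (klClass (distOf μ f₁) ε₁)
      (distOf μ g₀) (distOf μ g₁) (fun y => Real.log (g₁ y / g₀ y)) t ∧
    Tendsto (upperRate (fun y => Real.log (g₁ y / g₀ y)) t (distOf μ g₀)) atTop (𝓝 0) ∧
    Tendsto (lowerRate (fun y => Real.log (g₁ y / g₀ y)) t (distOf μ g₁)) atTop
      (𝓝 (-(klDiv (distOf μ g₀) (distOf μ g₁) : EReal))) := by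
  have hX : (fun y => Real.log (g₁ y / g₀ y)) = fun y => -Real.log (g₀ y / g₁ y) :=
    funext fun y => log_div_swap _ _
  rw [hX, integral_neg] at ht
  rw [hX]
  have hup : ∀ n, {y : Fin n → Ω | t < empMean (fun y => -Real.log (g₀ y / g₁ y)) n y} =
      {y | empMean (fun y => Real.log (g₀ y / g₁ y)) n y <
        ∫ y, Real.log (g₀ y / g₁ y) ∂(distOf μ g₀)} := fun n => by
    ext y
    rw [Set.mem_ofPred_eq, Set.mem_ofPred_eq, empMean_neg, ht, neg_lt_neg_iff]
  have hlow : ∀ n, {y : Fin n → Ω | empMean (fun y => -Real.log (g₀ y / g₁ y)) n y ≤ t} =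
      {y | ∫ y, Real.log (g₀ y / g₁ y) ∂(distOf μ g₀) ≤
        empMean (fun y => Real.log (g₀ y / g₁ y)) n y} := fun n => by
    ext y
    rw [Set.mem_ofPred_eq, Set.mem_ofPred_eq, empMean_neg, ht, neg_le_neg_iff]
  have h0 := K.tendsto_rate₀ hdisj
    (fun n => {y | t < empMean (fun y => -Real.log (g₀ y / g₁ y)) n y}) fun n => (hup n).ge
  have h1 := K.tendsto_rate₁ hdisj
    (fun n => {y | empMean (fun y => -Real.log (g₀ y / g₁ y)) n y ≤ t})
    (fun n => (hlow n).le) fun n => by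
      rw [hlow]
      exact setOf_lt_subset_setOf_le _ _
  refine ⟨⟨_, _, h0, h1, fun H hH => ?_, fun H hH => ?_⟩, h0, h1⟩
  · have := hH.1
    exact limsup_le_of_le isCobounded_le_of_bot (eventually_rate_le_zero H _)
  · rw [K.coe_klDiv_eq]
    exact limsup_le_of_le isCobounded_le_of_bot
      (K.eventually_rate₁_le hH _ fun n => (hlow n).le)

/-- The test with the statistic `log (g₁ / g₀)` and the threshold at its mean under `g₁`; here
the pair `(g₁, g₀)` solves the problem with the nominal data interchanged. -/
theorem IsKKTPair.typeII_robust [SigmaFinite μ]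
    (K : IsKKTPair μ f₁ f₀ ε₁ ε₀ lam₀ lam₁ mu₀ mu₁ g₁ g₀)
    (hdisj : Disjoint (klClass (distOf μ f₀) ε₀) (klClass (distOf μ f₁) ε₁)) {t : ℝ}
    (ht : t = ∫ y, Real.log (g₁ y / g₀ y) ∂(distOf μ g₁)) :
    IsAsymptoticallyMinimaxRobust (klClass (distOf μ f₀) ε₀) (klClass (distOf μ f₁) ε₁)
      (distOf μ g₀) (distOf μ g₁) (fun y => Real.log (g₁ y / g₀ y)) t ∧
    Tendsto (lowerRate (fun y => Real.log (g₁ y / g₀ y)) t (distOf μ g₁)) atTop (𝓝 0) ∧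
    Tendsto (upperRate (fun y => Real.log (g₁ y / g₀ y)) t (distOf μ g₀)) atTop
      (𝓝 (-(klDiv (distOf μ g₁) (distOf μ g₀) : EReal))) := by
  subst ht
  have h0 := K.tendsto_rate₀ hdisj.symm
    (fun n => {y | empMean (fun y => Real.log (g₁ y / g₀ y)) n y ≤
      ∫ y, Real.log (g₁ y / g₀ y) ∂(distOf μ g₁)}) fun n => setOf_lt_subset_setOf_le _ _
  have h1 := K.tendsto_rate₁ hdisj.symm
    (fun n => {y | ∫ y, Real.log (g₁ y / g₀ y) ∂(distOf μ g₁) <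
      empMean (fun y => Real.log (g₁ y / g₀ y)) n y}) (fun n => setOf_lt_subset_setOf_le _ _)
    fun n => le_rfl
  refine ⟨⟨_, _, h1, h0, fun H hH => ?_, fun H hH => ?_⟩, h0, h1⟩
  · rw [K.coe_klDiv_eq]
    exact limsup_le_of_le isCobounded_le_of_bot
      (K.eventually_rate₁_le hH _ fun n => setOf_lt_subset_setOf_le _ _)
  · have := hH.1
    exact limsup_le_of_le isCobounded_le_of_bot (eventually_rate_le_zero H _)

theorem isTypeIILeastFavorable_iff_swap {𝒢₀ 𝒢₁ : Set (Measure Ω)} {G₀ G₁ : Measure Ω} :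
    IsTypeIILeastFavorable 𝒢₀ 𝒢₁ G₀ G₁ ↔ IsTypeILeastFavorable 𝒢₁ 𝒢₀ G₁ G₀ :=
  ⟨fun ⟨h₀, h₁, h⟩ => ⟨h₁, h₀, fun H₁ hH₁ H₀ hH₀ => h H₀ hH₀ H₁ hH₁⟩,
    fun ⟨h₁, h₀, h⟩ => ⟨h₀, h₁, fun H₀ hH₀ H₁ hH₁ => h H₁ hH₁ H₀ hH₀⟩⟩

end Exponents

/-- Every solution of the four parameter equations gives a KKT pair. -/
theorem ParamEquations.isKKTPair {Ω : Type*} [MeasurableSpace Ω] {μ : Measure Ω}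
    {f₀ f₁ : Ω → ℝ} (hf₀ : IsPosDensity μ f₀) (hf₁ : IsPosDensity μ f₁) {ε₀ ε₁ : ℝ}
    (hε₀ : 0 < ε₀) (hε₁ : 0 < ε₁) {lam₀ lam₁ mu₀ mu₁ : ℝ} (h₀ : 0 < lam₀) (h₁ : 0 < lam₁)
    (h : ParamEquations μ f₀ f₁ ε₀ ε₁ lam₀ lam₁ mu₀ mu₁) :
    IsKKTPair μ f₀ f₁ ε₀ ε₁ lam₀ lam₁ mu₀ mu₁ (paramDensity₀ lam₀ lam₁ mu₀ mu₁ f₀ f₁)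
      (paramDensity₁ lam₀ lam₁ mu₀ mu₁ f₀ f₁) := by
  obtain ⟨hg₀, hg₁, hD₀, hD₁⟩ := h
  refine ⟨hf₀, hf₁, hε₀, hε₁, ⟨measurable_paramDensity₀ _ _ _ _ hf₀.1 hf₁.1, ?_, ?_, hg₀⟩,
    ⟨measurable_paramDensity₁ _ _ _ _ hf₀.1 hf₁.1, ?_, ?_, hg₁⟩, h₀, h₁, hD₀, hD₁, ?_, ?_⟩
  · filter_upwards [hf₀.2.1, hf₁.2.1] with y h2 h3 using paramDensity₀_pos h₀ h₁ h2 h3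
  · exact Integrable.of_integral_ne_zero (by simp [hg₀])
  · filter_upwards [hf₀.2.1, hf₁.2.1] with y h2 h3 using paramDensity₁_pos h₀ h₁ h2 h3
  · exact Integrable.of_integral_ne_zero (by simp [hg₁])
  · filter_upwards [hf₀.2.1, hf₁.2.1] with y h2 h3
    rw [← paramDensity₀_stationary (mu₀ := mu₀) (mu₁ := mu₁) h₀ h₁ h2 h3,
      paramDensity_div h₀ h₁ h2 h3]
  · filter_upwards [hf₀.2.1, hf₁.2.1] with y h2 h3
    rw [← paramDensity₁_stationary (mu₀ := mu₀) (mu₁ := mu₁) h₀ h₁ h2 h3,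
      paramDensity_div h₀ h₁ h2 h3]

/-! ### The geometric family between the nominal densities -/

section Geometric

variable {Ω : Type*} [MeasurableSpace Ω] {μ : Measure Ω} {f₀ f₁ : Ω → ℝ}

/-- The unnormalized geometric mixture `f₀ ^ (1 - s) * f₁ ^ s`, written as an exponential tilting
of `f₀` by the nominal log-likelihood ratio. -/
def geoKernel (f₀ f₁ : Ω → ℝ) (s : ℝ) (y : Ω) : ℝ :=
  f₀ y * Real.exp (s * Real.log (f₁ y / f₀ y))

/-- The Hellinger integral `∫ f₀ ^ (1 - s) * f₁ ^ s`. -/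
def geoMass (μ : Measure Ω) (f₀ f₁ : Ω → ℝ) (s : ℝ) : ℝ := ∫ y, geoKernel f₀ f₁ s y ∂μ

/-- The integral of the nominal log-likelihood ratio against the unnormalized geometric mixture. -/
def geoLog (μ : Measure Ω) (f₀ f₁ : Ω → ℝ) (s : ℝ) : ℝ :=
  ∫ y, geoKernel f₀ f₁ s y * Real.log (f₁ y / f₀ y) ∂μ

/-- The normalized geometric mixture. -/
def geoDensity (μ : Measure Ω) (f₀ f₁ : Ω → ℝ) (s : ℝ) (y : Ω) : ℝ :=
  geoKernel f₀ f₁ s y / geoMass μ f₀ f₁ s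

/-- The divergence of the geometric mixture from the first nominal distribution. -/
def geoDiv₀ (μ : Measure Ω) (f₀ f₁ : Ω → ℝ) (s : ℝ) : ℝ :=
  s * (geoLog μ f₀ f₁ s / geoMass μ f₀ f₁ s) - Real.log (geoMass μ f₀ f₁ s)

/-- The divergence of the geometric mixture from the second nominal distribution. -/
def geoDiv₁ (μ : Measure Ω) (f₀ f₁ : Ω → ℝ) (s : ℝ) : ℝ :=
  (s - 1) * (geoLog μ f₀ f₁ s / geoMass μ f₀ f₁ s) - Real.log (geoMass μ f₀ f₁ s)

theorem exp_mul_le {s : ℝ} (h0 : 0 ≤ s) (h1 : s ≤ 1) (L : ℝ) :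
    Real.exp (s * L) ≤ 1 + Real.exp L := by
  rcases le_total 0 L with h | h
  · have : Real.exp (s * L) ≤ Real.exp L := Real.exp_le_exp.2 (by nlinarith)
    linarith
  · have : Real.exp (s * L) ≤ 1 := Real.exp_le_one_iff.2 (by nlinarith)
    linarith [Real.exp_pos L]

theorem exp_mul_mul_abs_le {a s : ℝ} (ha : 0 < a) (h0 : a ≤ s) (h1 : s ≤ 1 - a) (L : ℝ) :
    Real.exp (s * L) * |L| ≤ 1 / a * (1 + Real.exp L) := by
  have key : |L| ≤ 1 / a * Real.exp (a * |L|) := by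
    rw [one_div, ← div_eq_inv_mul, le_div_iff₀ ha]
    linarith [Real.add_one_le_exp (a * |L|)]
  have hle : Real.exp (s * L) * Real.exp (a * |L|) ≤ 1 + Real.exp L := by
    rw [← Real.exp_add]
    rcases le_total 0 L with h | h
    · rw [abs_of_nonneg h]
      have : Real.exp (s * L + a * L) ≤ Real.exp L := Real.exp_le_exp.2 (by nlinarith)
      linarith
    · rw [abs_of_nonpos h]
      have : Real.exp (s * L + a * -L) ≤ 1 := Real.exp_le_one_iff.2 (by nlinarith)
      linarith [Real.exp_pos L]
  calc Real.exp (s * L) * |L| ≤ Real.exp (s * L) * (1 / a * Real.exp (a * |L|)) := by gcongr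
    _ = 1 / a * (Real.exp (s * L) * Real.exp (a * |L|)) := by ring
    _ ≤ 1 / a * (1 + Real.exp L) := by gcongr

theorem mul_one_add_exp_log_div {a b : ℝ} (ha : 0 < a) (hb : 0 < b) :
    a * (1 + Real.exp (Real.log (b / a))) = a + b := by
  rw [Real.exp_log (div_pos hb ha), mul_add, mul_one, mul_div_cancel₀ _ ha.ne']

theorem measurable_geoKernel (hf₀ : Measurable f₀) (hf₁ : Measurable f₁) (s : ℝ) :
    Measurable (geoKernel f₀ f₁ s) :=
  hf₀.mul (Real.measurable_exp.comp ((measurable_log_div hf₀ hf₁).const_mul s))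

theorem ae_norm_geoKernel_le (hf₀ : IsPosDensity μ f₀) (hf₁ : IsPosDensity μ f₁) {s : ℝ}
    (h0 : 0 ≤ s) (h1 : s ≤ 1) : ∀ᵐ y ∂μ, ‖geoKernel f₀ f₁ s y‖ ≤ f₀ y + f₁ y := by
  filter_upwards [hf₀.2.1, hf₁.2.1] with y hy0 hy1
  rw [geoKernel, Real.norm_eq_abs, abs_of_pos (by positivity), ← mul_one_add_exp_log_div hy0 hy1]
  exact mul_le_mul_of_nonneg_left (exp_mul_le h0 h1 _) hy0.le

theorem ae_norm_geoKernel_mul_log_le (hf₀ : IsPosDensity μ f₀) (hf₁ : IsPosDensity μ f₁)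
    {a s : ℝ} (ha : 0 < a) (h0 : a ≤ s) (h1 : s ≤ 1 - a) :
    ∀ᵐ y ∂μ, ‖geoKernel f₀ f₁ s y * Real.log (f₁ y / f₀ y)‖ ≤ 1 / a * (f₀ y + f₁ y) := by
  filter_upwards [hf₀.2.1, hf₁.2.1] with y hy0 hy1
  rw [geoKernel, Real.norm_eq_abs, abs_mul, abs_of_pos (by positivity),
    ← mul_one_add_exp_log_div hy0 hy1, mul_assoc, mul_left_comm (1 / a)]
  exact mul_le_mul_of_nonneg_left (exp_mul_mul_abs_le ha h0 h1 _) hy0.le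

theorem integrable_geoKernel (hf₀ : IsPosDensity μ f₀) (hf₁ : IsPosDensity μ f₁) {s : ℝ}
    (h0 : 0 ≤ s) (h1 : s ≤ 1) : Integrable (geoKernel f₀ f₁ s) μ :=
  (hf₀.2.2.1.add hf₁.2.2.1).mono' (measurable_geoKernel hf₀.1 hf₁.1 s).aestronglyMeasurable
    (ae_norm_geoKernel_le hf₀ hf₁ h0 h1)

theorem integrable_geoKernel_mul_log (hf₀ : IsPosDensity μ f₀) (hf₁ : IsPosDensity μ f₁) {s : ℝ}
    (h0 : 0 < s) (h1 : s < 1) :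
    Integrable (fun y => geoKernel f₀ f₁ s y * Real.log (f₁ y / f₀ y)) μ :=
  ((hf₀.2.2.1.add hf₁.2.2.1).const_mul (1 / min s (1 - s))).mono'
    ((measurable_geoKernel hf₀.1 hf₁.1 s).mul (measurable_log_div hf₀.1 hf₁.1)).aestronglyMeasurable
    (ae_norm_geoKernel_mul_log_le hf₀ hf₁ (lt_min h0 (by linarith)) (min_le_left _ _)
      (by linarith [min_le_right s (1 - s)]))

theorem continuousOn_geoMass (hf₀ : IsPosDensity μ f₀) (hf₁ : IsPosDensity μ f₁) :
    ContinuousOn (geoMass μ f₀ f₁) (Set.Icc 0 1) := by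
  refine continuousOn_of_dominated (bound := fun y => f₀ y + f₁ y)
    (fun s _ => (measurable_geoKernel hf₀.1 hf₁.1 s).aestronglyMeasurable)
    (fun s hs => ae_norm_geoKernel_le hf₀ hf₁ hs.1 hs.2) (hf₀.2.2.1.add hf₁.2.2.1)
    (ae_of_all _ fun y => ?_)
  unfold geoKernel
  fun_prop

theorem continuousOn_geoLog (hf₀ : IsPosDensity μ f₀) (hf₁ : IsPosDensity μ f₁) :
    ContinuousOn (geoLog μ f₀ f₁) (Set.Ioo 0 1) := by
  intro s hs
  refine ContinuousAt.continuousWithinAt ?_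
  have ha : 0 < min s (1 - s) / 2 := by
    have := lt_min hs.1 (sub_pos.2 hs.2)
    linarith
  have hIcc : Set.Icc (min s (1 - s) / 2) (1 - min s (1 - s) / 2) ∈ 𝓝 s := by
    refine Icc_mem_nhds ?_ ?_
    · linarith [min_le_left s (1 - s)]
    · linarith [min_le_right s (1 - s)]
  refine continuousAt_of_dominated
    (bound := fun y => 1 / (min s (1 - s) / 2) * (f₀ y + f₁ y))
    (Eventually.of_forall fun s => ((measurable_geoKernel hf₀.1 hf₁.1 s).mul
      (measurable_log_div hf₀.1 hf₁.1)).aestronglyMeasurable)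
    (mem_of_superset hIcc fun r hr => ae_norm_geoKernel_mul_log_le hf₀ hf₁ ha hr.1 hr.2)
    ((hf₀.2.2.1.add hf₁.2.2.1).const_mul _) (ae_of_all _ fun y => ?_)
  unfold geoKernel
  fun_prop

theorem geoMass_zero (hf₀ : IsPosDensity μ f₀) : geoMass μ f₀ f₁ 0 = 1 := by
  simp [geoMass, geoKernel, hf₀.2.2.2]

theorem geoMass_one (hf₀ : IsPosDensity μ f₀) (hf₁ : IsPosDensity μ f₁) :
    geoMass μ f₀ f₁ 1 = 1 := by
  refine Eq.trans ?_ hf₁.2.2.2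
  refine integral_congr_ae ?_
  filter_upwards [hf₀.2.1, hf₁.2.1] with y hy0 hy1
  rw [geoKernel, one_mul, Real.exp_log (div_pos hy1 hy0), mul_div_cancel₀ _ hy0.ne']

theorem geoMass_pos (hf₀ : IsPosDensity μ f₀) (hf₁ : IsPosDensity μ f₁) {s : ℝ}
    (h0 : 0 ≤ s) (h1 : s ≤ 1) : 0 < geoMass μ f₀ f₁ s := by
  have hpos : ∀ᵐ y ∂μ, 0 < geoKernel f₀ f₁ s y := by
    filter_upwards [hf₀.2.1] with y hy using mul_pos hy (Real.exp_pos _)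
  refine lt_of_le_of_ne (integral_nonneg_of_ae (hpos.mono fun y hy => hy.le)) fun h => ?_
  have hz := (integral_eq_zero_iff_of_nonneg_ae (hpos.mono fun y hy => hy.le)
    (integrable_geoKernel hf₀ hf₁ h0 h1)).1 h.symm
  have hfalse : ∀ᵐ _ ∂μ, False := by
    filter_upwards [hz, hpos] with y h1 h2
    simp only [Pi.zero_apply] at h1
    linarith
  have hμ : μ = 0 := by simpa using hfalse
  have := hf₀.2.2.2
  simp [hμ] at this

theorem isPosDensity_geoDensity (hf₀ : IsPosDensity μ f₀) (hf₁ : IsPosDensity μ f₁) {s : ℝ}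
    (h0 : 0 ≤ s) (h1 : s ≤ 1) : IsPosDensity μ (geoDensity μ f₀ f₁ s) := by
  have hZ := geoMass_pos hf₀ hf₁ h0 h1
  refine ⟨(measurable_geoKernel hf₀.1 hf₁.1 s).div_const _, ?_,
    (integrable_geoKernel hf₀ hf₁ h0 h1).div_const _, ?_⟩
  · filter_upwards [hf₀.2.1] with y hy using div_pos (mul_pos hy (Real.exp_pos _)) hZ
  · simp only [geoDensity]
    rw [integral_div]
    exact div_self hZ.ne'

theorem log_geoDensity_div₀ {s : ℝ} {y : Ω} (hZ : 0 < geoMass μ f₀ f₁ s) (hy0 : 0 < f₀ y) :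
    Real.log (geoDensity μ f₀ f₁ s y / f₀ y) =
      s * Real.log (f₁ y / f₀ y) - Real.log (geoMass μ f₀ f₁ s) := by
  have : geoDensity μ f₀ f₁ s y / f₀ y =
      Real.exp (s * Real.log (f₁ y / f₀ y)) / geoMass μ f₀ f₁ s := by
    rw [geoDensity, geoKernel]
    field_simp
  rw [this, Real.log_div (Real.exp_pos _).ne' hZ.ne', Real.log_exp]

theorem log_geoDensity_div₁ {s : ℝ} {y : Ω} (hZ : 0 < geoMass μ f₀ f₁ s) (hy0 : 0 < f₀ y)
    (hy1 : 0 < f₁ y) :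
    Real.log (geoDensity μ f₀ f₁ s y / f₁ y) =
      (s - 1) * Real.log (f₁ y / f₀ y) - Real.log (geoMass μ f₀ f₁ s) := by
  have hpos : 0 < geoDensity μ f₀ f₁ s y := div_pos (mul_pos hy0 (Real.exp_pos _)) hZ
  have h := log_geoDensity_div₀ hZ hy0
  rw [Real.log_div hpos.ne' hy0.ne'] at h
  rw [Real.log_div hpos.ne' hy1.ne', sub_mul, Real.log_div hy1.ne' hy0.ne', one_mul]
  rw [Real.log_div hy1.ne' hy0.ne'] at h
  linarith

/-- Affine functions of the nominal log-likelihood ratio are integrable against the geometric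
mixture. -/
theorem integral_geoDensity_mul (hf₀ : IsPosDensity μ f₀) (hf₁ : IsPosDensity μ f₁) {s : ℝ}
    (h0 : 0 < s) (h1 : s < 1) (a b : ℝ) :
    Integrable (fun y => geoDensity μ f₀ f₁ s y * (a * Real.log (f₁ y / f₀ y) + b)) μ ∧
    ∫ y, geoDensity μ f₀ f₁ s y * (a * Real.log (f₁ y / f₀ y) + b) ∂μ =
      a * (geoLog μ f₀ f₁ s / geoMass μ f₀ f₁ s) + b := by
  have hd := isPosDensity_geoDensity hf₀ hf₁ h0.le h1.le
  have hL := (integrable_geoKernel_mul_log hf₀ hf₁ h0 h1).const_mul (a / geoMass μ f₀ f₁ s)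
  have he : (fun y => geoDensity μ f₀ f₁ s y * (a * Real.log (f₁ y / f₀ y) + b)) = fun y =>
      a / geoMass μ f₀ f₁ s * (geoKernel f₀ f₁ s y * Real.log (f₁ y / f₀ y)) +
        b * geoDensity μ f₀ f₁ s y := by
    funext y
    simp only [geoDensity]
    ring
  rw [he]
  refine ⟨hL.add (hd.2.2.1.const_mul b), ?_⟩
  rw [integral_add hL (hd.2.2.1.const_mul b), integral_const_mul, integral_const_mul,
    hd.2.2.2, geoLog]
  ring

theorem integral_geoDensity_log₀ (hf₀ : IsPosDensity μ f₀) (hf₁ : IsPosDensity μ f₁) {s : ℝ}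
    (h0 : 0 < s) (h1 : s < 1) :
    Integrable (fun y => geoDensity μ f₀ f₁ s y * Real.log (geoDensity μ f₀ f₁ s y / f₀ y)) μ ∧
    ∫ y, geoDensity μ f₀ f₁ s y * Real.log (geoDensity μ f₀ f₁ s y / f₀ y) ∂μ =
      geoDiv₀ μ f₀ f₁ s := by
  obtain ⟨hi, he⟩ := integral_geoDensity_mul hf₀ hf₁ h0 h1 s (-Real.log (geoMass μ f₀ f₁ s))
  have hae : (fun y => geoDensity μ f₀ f₁ s y * (s * Real.log (f₁ y / f₀ y) +
      -Real.log (geoMass μ f₀ f₁ s))) =ᵐ[μ]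
      fun y => geoDensity μ f₀ f₁ s y * Real.log (geoDensity μ f₀ f₁ s y / f₀ y) := by
    filter_upwards [hf₀.2.1] with y hy0
    rw [log_geoDensity_div₀ (geoMass_pos hf₀ hf₁ h0.le h1.le) hy0, ← sub_eq_add_neg]
  exact ⟨hi.congr hae, (integral_congr_ae hae).symm.trans he⟩

theorem integral_geoDensity_log₁ (hf₀ : IsPosDensity μ f₀) (hf₁ : IsPosDensity μ f₁) {s : ℝ}
    (h0 : 0 < s) (h1 : s < 1) :
    Integrable (fun y => geoDensity μ f₀ f₁ s y * Real.log (geoDensity μ f₀ f₁ s y / f₁ y)) μ ∧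
    ∫ y, geoDensity μ f₀ f₁ s y * Real.log (geoDensity μ f₀ f₁ s y / f₁ y) ∂μ =
      geoDiv₁ μ f₀ f₁ s := by
  obtain ⟨hi, he⟩ := integral_geoDensity_mul hf₀ hf₁ h0 h1 (s - 1)
    (-Real.log (geoMass μ f₀ f₁ s))
  have hae : (fun y => geoDensity μ f₀ f₁ s y * ((s - 1) * Real.log (f₁ y / f₀ y) +
      -Real.log (geoMass μ f₀ f₁ s))) =ᵐ[μ]
      fun y => geoDensity μ f₀ f₁ s y * Real.log (geoDensity μ f₀ f₁ s y / f₁ y) := by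
    filter_upwards [hf₀.2.1, hf₁.2.1] with y hy0 hy1
    rw [log_geoDensity_div₁ (geoMass_pos hf₀ hf₁ h0.le h1.le) hy0 hy1, ← sub_eq_add_neg]
  exact ⟨hi.congr hae, (integral_congr_ae hae).symm.trans he⟩

/-- Two members of the geometric family have finite divergence from each other. -/
theorem integrable_geoDensity_log_div (hf₀ : IsPosDensity μ f₀) (hf₁ : IsPosDensity μ f₁)
    {s t : ℝ} (hs0 : 0 < s) (hs1 : s < 1) (ht0 : 0 < t) (ht1 : t < 1) :
    Integrable (fun y => geoDensity μ f₀ f₁ s y *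
      Real.log (geoDensity μ f₀ f₁ s y / geoDensity μ f₀ f₁ t y)) μ := by
  refine (integral_geoDensity_mul hf₀ hf₁ hs0 hs1 (s - t)
    (Real.log (geoMass μ f₀ f₁ t) - Real.log (geoMass μ f₀ f₁ s))).1.congr ?_
  have hZs := geoMass_pos hf₀ hf₁ hs0.le hs1.le
  have hZt := geoMass_pos hf₀ hf₁ ht0.le ht1.le
  filter_upwards [hf₀.2.1] with y hy0
  have h1 := log_geoDensity_div₀ (f₁ := f₁) hZs hy0
  have h2 := log_geoDensity_div₀ (f₁ := f₁) hZt hy0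
  have p1 : 0 < geoDensity μ f₀ f₁ s y := div_pos (mul_pos hy0 (Real.exp_pos _)) hZs
  have p2 : 0 < geoDensity μ f₀ f₁ t y := div_pos (mul_pos hy0 (Real.exp_pos _)) hZt
  rw [Real.log_div p1.ne' hy0.ne'] at h1
  rw [Real.log_div p2.ne' hy0.ne'] at h2
  rw [Real.log_div p1.ne' p2.ne']
  congr 1
  linarith

theorem geoDiv_combination (s : ℝ) :
    (1 - s) * geoDiv₀ μ f₀ f₁ s + s * geoDiv₁ μ f₀ f₁ s = -Real.log (geoMass μ f₀ f₁ s) := by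
  unfold geoDiv₀ geoDiv₁
  ring

theorem klDiv_of_integral_mul_log [SigmaFinite μ] {f g : Ω → ℝ} (hf : IsPosDensity μ f)
    (hg : IsPosDensity μ g) (hi : Integrable (fun y => g y * Real.log (g y / f y)) μ) :
    klDiv (distOf μ g) (distOf μ f) = ENNReal.ofReal (∫ y, g y * Real.log (g y / f y) ∂μ) ∧
      0 ≤ ∫ y, g y * Real.log (g y / f y) ∂μ := by
  have hi' := (integrable_distOf_iff hg).2 hi
  rw [← integral_distOf hg fun y => Real.log (g y / f y)]
  exact ⟨klDiv_distOf hf hg hi', integral_log_nonneg hf hg hi'⟩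

theorem geoDiv₀_nonneg [SigmaFinite μ] (hf₀ : IsPosDensity μ f₀) (hf₁ : IsPosDensity μ f₁)
    {s : ℝ} (h0 : 0 < s) (h1 : s < 1) : 0 ≤ geoDiv₀ μ f₀ f₁ s := by
  obtain ⟨hi, he⟩ := integral_geoDensity_log₀ hf₀ hf₁ h0 h1
  exact he ▸ (klDiv_of_integral_mul_log hf₀ (isPosDensity_geoDensity hf₀ hf₁ h0.le h1.le) hi).2

theorem geoDiv₁_nonneg [SigmaFinite μ] (hf₀ : IsPosDensity μ f₀) (hf₁ : IsPosDensity μ f₁)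
    {s : ℝ} (h0 : 0 < s) (h1 : s < 1) : 0 ≤ geoDiv₁ μ f₀ f₁ s := by
  obtain ⟨hi, he⟩ := integral_geoDensity_log₁ hf₀ hf₁ h0 h1
  exact he ▸ (klDiv_of_integral_mul_log hf₁ (isPosDensity_geoDensity hf₀ hf₁ h0.le h1.le) hi).2

theorem lt_geoDiv₁_of_disjoint [SigmaFinite μ] (hf₀ : IsPosDensity μ f₀)
    (hf₁ : IsPosDensity μ f₁) {ε₀ ε₁ : ℝ}
    (hdisj : Disjoint (klClass (distOf μ f₀) ε₀) (klClass (distOf μ f₁) ε₁))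
    {s : ℝ} (h0 : 0 < s) (h1 : s < 1) (hs0 : geoDiv₀ μ f₀ f₁ s ≤ ε₀) :
    ε₁ < geoDiv₁ μ f₀ f₁ s := by
  by_contra hs1
  have hd := isPosDensity_geoDensity hf₀ hf₁ h0.le h1.le
  obtain ⟨hi₀, he₀⟩ := integral_geoDensity_log₀ hf₀ hf₁ h0 h1
  obtain ⟨hi₁, he₁⟩ := integral_geoDensity_log₁ hf₀ hf₁ h0 h1
  have hp := hd.isProbabilityMeasure
  have hnot := Set.disjoint_left.1 hdisj
  refine @hnot (distOf μ (geoDensity μ f₀ f₁ s)) ⟨hp, ?_⟩ ⟨hp, ?_⟩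
  · rw [(klDiv_of_integral_mul_log hf₀ hd hi₀).1, he₀]
    exact ENNReal.ofReal_le_ofReal hs0
  · rw [(klDiv_of_integral_mul_log hf₁ hd hi₁).1, he₁]
    exact ENNReal.ofReal_le_ofReal (not_lt.1 hs1)

theorem exists_geoDiv₀_lt [SigmaFinite μ] (hf₀ : IsPosDensity μ f₀) (hf₁ : IsPosDensity μ f₁)
    {η : ℝ} (hη : 0 < η) : ∃ s, 0 < s ∧ s < 1 ∧ geoDiv₀ μ f₀ f₁ s < η := by
  have hc : ContinuousWithinAt (fun s => -Real.log (geoMass μ f₀ f₁ s)) (Set.Icc 0 1) 0 :=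
    (((continuousOn_geoMass hf₀ hf₁) 0 (by simp)).log (by simp [geoMass_zero hf₀])).neg
  have hlt : ∀ᶠ s in 𝓝[Set.Icc 0 1] (0 : ℝ), -Real.log (geoMass μ f₀ f₁ s) < η / 2 :=
    hc.eventually_lt_const (by simp [geoMass_zero hf₀, hη])
  have hlt' : ∀ᶠ s in 𝓝[>] (0 : ℝ), -Real.log (geoMass μ f₀ f₁ s) < η / 2 := by
    refine Filter.Eventually.filter_mono ?_ hlt
    exact nhdsWithin_le_of_mem (Icc_mem_nhdsGT zero_lt_one)
  obtain ⟨s, hs, hs0, hs1⟩ := (hlt'.and (Ioo_mem_nhdsGT (show (0 : ℝ) < 1 / 2 by norm_num))).exists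
  refine ⟨s, hs0, by linarith, ?_⟩
  have h := geoDiv_combination (μ := μ) (f₀ := f₀) (f₁ := f₁) s
  have h₀ := geoDiv₀_nonneg hf₀ hf₁ hs0 (by linarith)
  have h₁ := geoDiv₁_nonneg hf₀ hf₁ hs0 (by linarith)
  nlinarith

theorem exists_geoDiv₁_lt [SigmaFinite μ] (hf₀ : IsPosDensity μ f₀) (hf₁ : IsPosDensity μ f₁)
    {η : ℝ} (hη : 0 < η) : ∃ s, 0 < s ∧ s < 1 ∧ geoDiv₁ μ f₀ f₁ s < η := by
  have hc : ContinuousWithinAt (fun s => -Real.log (geoMass μ f₀ f₁ s)) (Set.Icc 0 1) 1 :=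
    (((continuousOn_geoMass hf₀ hf₁) 1 (by simp)).log (by simp [geoMass_one hf₀ hf₁])).neg
  have hlt : ∀ᶠ s in 𝓝[Set.Icc 0 1] (1 : ℝ), -Real.log (geoMass μ f₀ f₁ s) < η / 2 :=
    hc.eventually_lt_const (by simp [geoMass_one hf₀ hf₁, hη])
  have hlt' : ∀ᶠ s in 𝓝[<] (1 : ℝ), -Real.log (geoMass μ f₀ f₁ s) < η / 2 := by
    refine Filter.Eventually.filter_mono ?_ hlt
    exact nhdsWithin_le_of_mem (Icc_mem_nhdsLT zero_lt_one)
  obtain ⟨s, hs, hs0, hs1⟩ := (hlt'.and (Ioo_mem_nhdsLT (show (1 / 2 : ℝ) < 1 by norm_num))).exists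
  refine ⟨s, by linarith, hs1, ?_⟩
  have h := geoDiv_combination (μ := μ) (f₀ := f₀) (f₁ := f₁) s
  have h₀ := geoDiv₀_nonneg hf₀ hf₁ (by linarith) hs1
  have h₁ := geoDiv₁_nonneg hf₀ hf₁ (by linarith) hs1
  nlinarith

/-- Disjoint neighborhoods are separated by a Rényi-type divergence: the geometric mixture on
the boundary of the first neighborhood lies outside the second one. -/
theorem exists_separating [SigmaFinite μ] (hf₀ : IsPosDensity μ f₀) (hf₁ : IsPosDensity μ f₁)
    {ε₀ ε₁ : ℝ} (hε₀ : 0 < ε₀) (hε₁ : 0 < ε₁)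
    (hdisj : Disjoint (klClass (distOf μ f₀) ε₀) (klClass (distOf μ f₁) ε₁)) :
    ∃ s, 0 < s ∧ s < 1 ∧ (1 - s) * ε₀ + s * ε₁ < -Real.log (geoMass μ f₀ f₁ s) := by
  have hcont : ContinuousOn (geoDiv₀ μ f₀ f₁) (Set.Ioo 0 1) := by
    have hZ := (continuousOn_geoMass hf₀ hf₁).mono Set.Ioo_subset_Icc_self
    have hne : ∀ s ∈ Set.Ioo (0 : ℝ) 1, geoMass μ f₀ f₁ s ≠ 0 := fun s hs =>
      (geoMass_pos hf₀ hf₁ hs.1.le hs.2.le).ne'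
    exact (continuousOn_id.mul ((continuousOn_geoLog hf₀ hf₁).div hZ hne)).sub (hZ.log hne)
  obtain ⟨a, ha0, ha1, ha⟩ := exists_geoDiv₀_lt hf₀ hf₁ hε₀
  obtain ⟨b, hb0, hb1, hb⟩ := exists_geoDiv₁_lt hf₀ hf₁ hε₁
  have hb' : ε₀ ≤ geoDiv₀ μ f₀ f₁ b := by
    by_contra hlt
    exact lt_asymm hb (lt_geoDiv₁_of_disjoint hf₀ hf₁ hdisj hb0 hb1 (not_le.1 hlt).le)
  obtain ⟨s, hs, hse⟩ := isPreconnected_Ioo.intermediate_value (a := a) (b := b) ⟨ha0, ha1⟩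
    ⟨hb0, hb1⟩ hcont ⟨ha.le, hb'⟩
  refine ⟨s, hs.1, hs.2, ?_⟩
  have h := lt_geoDiv₁_of_disjoint hf₀ hf₁ hdisj hs.1 hs.2 hse.le
  rw [← geoDiv_combination, hse]
  nlinarith [hs.1]

end Geometric

/-! ### Domination and continuity in the parameters -/

theorem abs_mul_log_le {t : ℝ} (ht : 0 < t) : |t * Real.log t| ≤ 1 + t ^ 2 := by
  rw [abs_le]
  have h1 := Real.log_le_sub_one_of_pos ht
  have h2 := Real.one_sub_inv_le_log_of_pos ht
  have h3 := mul_le_mul_of_nonneg_left h2 ht.le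
  rw [mul_sub, mul_inv_cancel₀ ht.ne'] at h3
  constructor <;> nlinarith

/-- The constant that bounds the parametric densities and their entropy integrands relative to
`f₀ + f₁`; it depends continuously on the parameters. -/
def dominationConst (lam₀ lam₁ mu₀ mu₁ : ℝ) : ℝ :=
  1 + Real.exp (-1 - (1 + mu₀) / lam₀) + Real.exp (-1 - (1 + mu₀) / lam₀) ^ 2
    + Real.exp ((1 - mu₁) / lam₁ - 1) + Real.exp ((1 - mu₁) / lam₁ - 1) ^ 2
    + Real.exp (-1 - (1 + mu₀) / lam₀) * ((1 + |mu₁|) / lam₁ + 1)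
    + Real.exp ((1 - mu₁) / lam₁ - 1) * ((2 + |mu₀|) / lam₀ + 1)

section Domination

variable {Ω : Type*} {lam₀ lam₁ mu₀ mu₁ : ℝ} {f₀ f₁ : Ω → ℝ} {y : Ω}

/-- The case `g₁ ≤ g₀` is controlled by `f₀`, the case `g₀ ≤ g₁` by `f₁`. -/
theorem paramDensity_bounds (h₀ : 0 < lam₀) (h₁ : 0 < lam₁) (hf₀ : 0 < f₀ y) (hf₁ : 0 < f₁ y)
    {g₀ g₁ : ℝ} (hg₀ : g₀ = paramDensity₀ lam₀ lam₁ mu₀ mu₁ f₀ f₁ y)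
    (hg₁ : g₁ = paramDensity₁ lam₀ lam₁ mu₀ mu₁ f₀ f₁ y) :
    |g₀| ≤ dominationConst lam₀ lam₁ mu₀ mu₁ * (f₀ y + f₁ y) ∧
    |g₁| ≤ dominationConst lam₀ lam₁ mu₀ mu₁ * (f₀ y + f₁ y) ∧
    |g₀ * Real.log (g₀ / f₀ y)| ≤ dominationConst lam₀ lam₁ mu₀ mu₁ * (f₀ y + f₁ y) ∧
    |g₁ * Real.log (g₁ / f₁ y)| ≤ dominationConst lam₀ lam₁ mu₀ mu₁ * (f₀ y + f₁ y) := by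
  have p₀ := paramDensity₀_pos (mu₀ := mu₀) (mu₁ := mu₁) h₀ h₁ hf₀ hf₁
  have p₁ := paramDensity₁_pos (mu₀ := mu₀) (mu₁ := mu₁) h₀ h₁ hf₀ hf₁
  have s₀ := paramDensity₀_stationary (mu₀ := mu₀) (mu₁ := mu₁) h₀ h₁ hf₀ hf₁
  have s₁ := paramDensity₁_stationary (mu₀ := mu₀) (mu₁ := mu₁) h₀ h₁ hf₀ hf₁
  have hm := paramDensity₀_eq_mul (mu₀ := mu₀) (mu₁ := mu₁) h₀ h₁ hf₀ hf₁
  have hu := densityRatio_pos (mu₀ := mu₀) (mu₁ := mu₁) h₀ h₁ (div_pos hf₁ hf₀)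
  rw [← hg₀] at p₀ s₀ hm
  rw [← hg₁] at p₁ s₁ hm
  set u := densityRatio lam₀ lam₁ mu₀ mu₁ (f₁ y / f₀ y)
  set E := Real.exp (-1 - (1 + mu₀) / lam₀) with hE
  set F := Real.exp ((1 - mu₁) / lam₁ - 1) with hF
  have hE0 : 0 < E := Real.exp_pos _
  have hF0 : 0 < F := Real.exp_pos _
  have a₀ : 0 ≤ (2 + |mu₀|) / lam₀ + 1 := by positivity
  have a₁ : 0 ≤ (1 + |mu₁|) / lam₁ + 1 := by positivity
  have l₀ : Real.log (g₀ / f₀ y) = -1 - (1 + mu₀) / lam₀ - Real.log u / lam₀ := by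
    field_simp
    linear_combination s₀
  have l₁ : Real.log (g₁ / f₁ y) = (u - mu₁) / lam₁ - 1 := by
    field_simp
    linear_combination s₁
  have hC : dominationConst lam₀ lam₁ mu₀ mu₁ = 1 + E + E ^ 2 + F + F ^ 2
      + E * ((1 + |mu₁|) / lam₁ + 1) + F * ((2 + |mu₀|) / lam₀ + 1) := rfl
  have hEa := mul_nonneg hE0.le a₁
  have hFa := mul_nonneg hF0.le a₀
  -- it suffices to bound by a partial sum of the constant times one of the two densities
  have fin₀ : ∀ {x c : ℝ}, x ≤ c * f₀ y → c ≤ dominationConst lam₀ lam₁ mu₀ mu₁ →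
      x ≤ dominationConst lam₀ lam₁ mu₀ mu₁ * (f₀ y + f₁ y) := fun {x c} hx hc => by
    have hC0 : 0 ≤ dominationConst lam₀ lam₁ mu₀ mu₁ := by rw [hC]; positivity
    nlinarith [mul_le_mul_of_nonneg_right hc hf₀.le, mul_nonneg hC0 hf₁.le]
  have fin₁ : ∀ {x c : ℝ}, x ≤ c * f₁ y → c ≤ dominationConst lam₀ lam₁ mu₀ mu₁ →
      x ≤ dominationConst lam₀ lam₁ mu₀ mu₁ * (f₀ y + f₁ y) := fun {x c} hx hc => by
    have hC0 : 0 ≤ dominationConst lam₀ lam₁ mu₀ mu₁ := by rw [hC]; positivity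
    nlinarith [mul_le_mul_of_nonneg_right hc hf₁.le, mul_nonneg hC0 hf₀.le]
  have hE2 := sq_nonneg E
  have hF2 := sq_nonneg F
  have c₁ : E ≤ dominationConst lam₀ lam₁ mu₀ mu₁ := by
    linarith only [hC, hE0, hF0, hE2, hF2, hEa, hFa]
  have c₂ : F ≤ dominationConst lam₀ lam₁ mu₀ mu₁ := by
    linarith only [hC, hE0, hF0, hE2, hF2, hEa, hFa]
  have c₃ : 1 + E ^ 2 ≤ dominationConst lam₀ lam₁ mu₀ mu₁ := by
    linarith only [hC, hE0, hF0, hE2, hF2, hEa, hFa]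
  have c₄ : 1 + F ^ 2 ≤ dominationConst lam₀ lam₁ mu₀ mu₁ := by
    linarith only [hC, hE0, hF0, hE2, hF2, hEa, hFa]
  have c₅ : E * ((1 + |mu₁|) / lam₁ + 1) ≤ dominationConst lam₀ lam₁ mu₀ mu₁ := by
    linarith only [hC, hE0, hF0, hE2, hF2, hEa, hFa]
  have c₆ : F * ((2 + |mu₀|) / lam₀ + 1) ≤ dominationConst lam₀ lam₁ mu₀ mu₁ := by
    linarith only [hC, hE0, hF0, hE2, hF2, hEa, hFa]
  rw [abs_of_pos p₀, abs_of_pos p₁]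
  rcases le_total 1 u with h | h
  · have hlog : 0 ≤ Real.log u := Real.log_nonneg h
    have ht : g₀ / f₀ y ≤ E := by
      rw [← Real.exp_log (div_pos p₀ hf₀), l₀]
      refine Real.exp_le_exp.2 ?_
      have : 0 ≤ Real.log u / lam₀ := by positivity
      linarith only [this]
    have b₀ : g₀ ≤ E * f₀ y := (div_le_iff₀ hf₀).1 ht
    have b₁ : g₁ ≤ E * f₀ y := (hm ▸ le_mul_of_one_le_left p₁.le h : g₁ ≤ g₀).trans b₀
    have b₂ : |g₀ * Real.log (g₀ / f₀ y)| ≤ (1 + E ^ 2) * f₀ y := by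
      have hx := abs_mul_log_le (div_pos p₀ hf₀)
      have he : g₀ * Real.log (g₀ / f₀ y) = g₀ / f₀ y * Real.log (g₀ / f₀ y) * f₀ y := by
        field_simp
      rw [he, abs_mul, abs_of_pos hf₀]
      refine mul_le_mul_of_nonneg_right (hx.trans ?_) hf₀.le
      have := pow_le_pow_left₀ (div_pos p₀ hf₀).le ht 2
      linarith only [this]
    have b₃ : |g₁ * Real.log (g₁ / f₁ y)| ≤ (E * ((1 + |mu₁|) / lam₁ + 1)) * f₀ y := by
      have hx : |Real.log (g₁ / f₁ y)| ≤ (u + |mu₁|) / lam₁ + 1 := by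
        rw [l₁]
        refine (abs_sub _ _).trans ?_
        rw [abs_one, abs_div, abs_of_pos h₁]
        have : |u - mu₁| ≤ u + |mu₁| := (abs_sub _ _).trans (by rw [abs_of_pos hu])
        gcongr
      rw [abs_mul, abs_of_pos p₁]
      calc g₁ * |Real.log (g₁ / f₁ y)| ≤ g₁ * ((u + |mu₁|) / lam₁ + 1) := by gcongr
        _ = (u * g₁ + |mu₁| * g₁) / lam₁ + g₁ := by ring
        _ ≤ (E * f₀ y + |mu₁| * (E * f₀ y)) / lam₁ + E * f₀ y := by
          rw [← hm]
          gcongr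
        _ = _ := by ring
    exact ⟨fin₀ b₀ c₁, fin₀ b₁ c₁, fin₀ b₂ c₃, fin₀ b₃ c₅⟩
  · have ht : g₁ / f₁ y ≤ F := by
      rw [← Real.exp_log (div_pos p₁ hf₁), l₁]
      refine Real.exp_le_exp.2 ?_
      gcongr
    have b₁ : g₁ ≤ F * f₁ y := (div_le_iff₀ hf₁).1 ht
    have b₀ : g₀ ≤ F * f₁ y := (hm ▸ mul_le_of_le_one_left p₁.le h : g₀ ≤ g₁).trans b₁
    have b₃ : |g₁ * Real.log (g₁ / f₁ y)| ≤ (1 + F ^ 2) * f₁ y := by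
      have hx := abs_mul_log_le (div_pos p₁ hf₁)
      have he : g₁ * Real.log (g₁ / f₁ y) = g₁ / f₁ y * Real.log (g₁ / f₁ y) * f₁ y := by
        field_simp
      rw [he, abs_mul, abs_of_pos hf₁]
      refine mul_le_mul_of_nonneg_right (hx.trans ?_) hf₁.le
      have := pow_le_pow_left₀ (div_pos p₁ hf₁).le ht 2
      linarith only [this]
    have b₂ : |g₀ * Real.log (g₀ / f₀ y)| ≤ (F * ((2 + |mu₀|) / lam₀ + 1)) * f₁ y := by
      have hlogu : |u * Real.log u| ≤ 1 := by
        have h1 := Real.log_nonpos hu.le h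
        have h2 := Real.one_sub_inv_le_log_of_pos hu
        have h3 := mul_le_mul_of_nonneg_left h2 hu.le
        rw [mul_sub, mul_inv_cancel₀ hu.ne', mul_one] at h3
        rw [abs_of_nonpos (mul_nonpos_of_nonneg_of_nonpos hu.le h1)]
        linarith only [h3, hu]
      have hx : |u * Real.log (g₀ / f₀ y)| ≤ (2 + |mu₀|) / lam₀ + 1 := by
        have he : u * Real.log (g₀ / f₀ y) =
            -(u * (1 + (1 + mu₀) / lam₀) + u * Real.log u / lam₀) := by
          rw [l₀]; ring
        rw [he, abs_neg]
        refine (abs_add_le _ _).trans ?_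
        rw [abs_mul, abs_of_pos hu, abs_div (u * Real.log u), abs_of_pos h₀]
        have h1 : |1 + (1 + mu₀) / lam₀| ≤ 1 + (1 + |mu₀|) / lam₀ := by
          refine (abs_add_le _ _).trans ?_
          rw [abs_one, abs_div, abs_of_pos h₀]
          have : |1 + mu₀| ≤ 1 + |mu₀| := (abs_add_le _ _).trans (by rw [abs_one])
          gcongr
        have h2 : u * |1 + (1 + mu₀) / lam₀| ≤ 1 * (1 + (1 + |mu₀|) / lam₀) := by gcongr
        have h3 : |u * Real.log u| / lam₀ ≤ 1 / lam₀ := by gcongr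
        have h4 : (2 + |mu₀|) / lam₀ = (1 + |mu₀|) / lam₀ + 1 / lam₀ := by ring
        linarith only [h2, h3, h4]
      have he : g₀ * Real.log (g₀ / f₀ y) = g₁ * (u * Real.log (g₀ / f₀ y)) := by
        nth_rewrite 1 [hm]
        ring
      rw [he, abs_mul, abs_of_pos p₁]
      calc g₁ * |u * Real.log (g₀ / f₀ y)| ≤ F * f₁ y * ((2 + |mu₀|) / lam₀ + 1) := by gcongr
        _ = _ := by ring
    exact ⟨fin₁ b₀ c₂, fin₁ b₁ c₂, fin₁ b₂ c₆, fin₁ b₃ c₄⟩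

end Domination

/-- The space of parameters `(lam₀, lam₁, mu₀, mu₁)`. -/
abbrev Param : Type := ℝ × ℝ × ℝ × ℝ

section Continuity

variable {Ω : Type*} {f₀ f₁ : Ω → ℝ} {y : Ω}

/-- `paramDensity₀` as a function of the parameter vector. -/
def dens₀ (f₀ f₁ : Ω → ℝ) (p : Param) (y : Ω) : ℝ :=
  paramDensity₀ p.1 p.2.1 p.2.2.1 p.2.2.2 f₀ f₁ y

/-- `paramDensity₁` as a function of the parameter vector. -/
def dens₁ (f₀ f₁ : Ω → ℝ) (p : Param) (y : Ω) : ℝ :=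
  paramDensity₁ p.1 p.2.1 p.2.2.1 p.2.2.2 f₀ f₁ y

theorem continuousAt_lambertTerm {p : Param} (h₀ : 0 < p.1) (h₁ : 0 < p.2.1) {l : ℝ}
    (hl : 0 < l) :
    ContinuousAt (fun p : Param => lambertTerm p.1 p.2.1 p.2.2.1 p.2.2.2 l) p := by
  have hne : 1 + p.1 ≠ 0 := by positivity
  have hne' : (1 + p.1) * p.2.1 ≠ 0 := by positivity
  unfold lambertTerm
  refine ContinuousAt.comp' (g := lambertW) (continuousAt_lambertW (by positivity)) ?_
  have h1 : ContinuousAt (fun p : Param => (-p.2.1 - p.2.1 * p.2.2.1 + p.1 * p.2.2.2) /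
      ((1 + p.1) * p.2.1)) p := ContinuousAt.div (by fun_prop) (by fun_prop) hne'
  have h2 : ContinuousAt (fun p : Param => -(p.1 / (1 + p.1))) p := by
    fun_prop (disch := exact hne)
  refine ContinuousAt.div ?_ (by fun_prop) hne'
  exact (ContinuousAt.mul (by fun_prop) h1.rexp).mul
    (ContinuousAt.rpow continuousAt_const h2 (Or.inl hl.ne'))

theorem continuousAt_dens₀ {p : Param} (h₀ : 0 < p.1) (h₁ : 0 < p.2.1) (hf₀ : 0 < f₀ y)
    (hf₁ : 0 < f₁ y) : ContinuousAt (fun p => dens₀ f₀ f₁ p y) p := by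
  have hl := div_pos hf₁ hf₀
  have hk : p.2.1 + p.2.1 / p.1 ≠ 0 := by positivity
  have hw := (lambertTerm_pos (mu₀ := p.2.2.1) (mu₁ := p.2.2.2) h₀ h₁ hl).ne'
  have hW := continuousAt_lambertTerm h₀ h₁ hl
  have he : ContinuousAt (fun p : Param => -(1 / p.1)) p :=
    (ContinuousAt.div (by fun_prop) (by fun_prop) h₀.ne').neg
  have hkc : ContinuousAt (fun p : Param => p.2.1 + p.2.1 / p.1) p :=
    ContinuousAt.add (by fun_prop) (ContinuousAt.div (by fun_prop) (by fun_prop) h₀.ne')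
  have hx : ContinuousAt (fun p : Param => -1 - (1 + p.2.2.1) / p.1) p :=
    continuousAt_const.sub (ContinuousAt.div (by fun_prop) (by fun_prop) h₀.ne')
  unfold dens₀ paramDensity₀
  exact (((hkc.rpow he (Or.inl hk)).mul hx.rexp).mul (hW.rpow he (Or.inl hw))).mul
    continuousAt_const

theorem continuousAt_dens₁ {p : Param} (h₀ : 0 < p.1) (h₁ : 0 < p.2.1) (hf₀ : 0 < f₀ y)
    (hf₁ : 0 < f₁ y) : ContinuousAt (fun p => dens₁ f₀ f₁ p y) p := by
  have hl := div_pos hf₁ hf₀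
  have hk : p.2.1 + p.2.1 / p.1 ≠ 0 := by positivity
  have hw := (lambertTerm_pos (mu₀ := p.2.2.1) (mu₁ := p.2.2.2) h₀ h₁ hl).ne'
  have hW := continuousAt_lambertTerm h₀ h₁ hl
  have he : ContinuousAt (fun p : Param => -((1 + p.1) / p.1)) p :=
    (ContinuousAt.div (by fun_prop) (by fun_prop) h₀.ne').neg
  have hkc : ContinuousAt (fun p : Param => p.2.1 + p.2.1 / p.1) p :=
    ContinuousAt.add (by fun_prop) (ContinuousAt.div (by fun_prop) (by fun_prop) h₀.ne')
  have hx : ContinuousAt (fun p : Param => -1 - (1 + p.2.2.1) / p.1) p :=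
    continuousAt_const.sub (ContinuousAt.div (by fun_prop) (by fun_prop) h₀.ne')
  unfold dens₁ paramDensity₁
  exact (((hkc.rpow he (Or.inl hk)).mul hx.rexp).mul (hW.rpow he (Or.inl hw))).mul
    continuousAt_const

theorem continuousAt_dominationConst {p : Param} (h₀ : 0 < p.1) (h₁ : 0 < p.2.1) :
    ContinuousAt (fun p : Param => dominationConst p.1 p.2.1 p.2.2.1 p.2.2.2) p := by
  unfold dominationConst
  fun_prop (disch := positivity)

variable [MeasurableSpace Ω] {μ : Measure Ω}

theorem continuousAt_integral_of_dominationConst (hf₀ : Integrable f₀ μ) (hf₁ : Integrable f₁ μ)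
    {Φ : Param → Ω → ℝ} (hm : ∀ p, Measurable (Φ p))
    (hb : ∀ p : Param, 0 < p.1 → 0 < p.2.1 → ∀ᵐ y ∂μ,
      |Φ p y| ≤ dominationConst p.1 p.2.1 p.2.2.1 p.2.2.2 * (f₀ y + f₁ y))
    (hnn : ∀ᵐ y ∂μ, 0 ≤ f₀ y + f₁ y)
    {p : Param} (h₀ : 0 < p.1) (h₁ : 0 < p.2.1)
    (hc : ∀ᵐ y ∂μ, ContinuousAt (fun p => Φ p y) p) :
    ContinuousAt (fun p => ∫ y, Φ p y ∂μ) p := by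
  have hC := (continuousAt_dominationConst h₀ h₁).eventually_le_const
    (lt_add_one (dominationConst p.1 p.2.1 p.2.2.1 p.2.2.2))
  have e₀ : ∀ᶠ q : Param in 𝓝 p, 0 < q.1 := continuous_fst.continuousAt.eventually_const_lt h₀
  have e₁ : ∀ᶠ q : Param in 𝓝 p, 0 < q.2.1 :=
    (continuous_fst.comp continuous_snd).continuousAt.eventually_const_lt h₁
  refine continuousAt_of_dominated
    (bound := fun y => (dominationConst p.1 p.2.1 p.2.2.1 p.2.2.2 + 1) * (f₀ y + f₁ y))
    (Eventually.of_forall fun q => (hm q).aestronglyMeasurable) ?_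
    ((hf₀.add hf₁).const_mul _) hc
  filter_upwards [hC, e₀, e₁] with q hq q0 q1
  filter_upwards [hb q q0 q1, hnn] with y hy hy'
  exact hy.trans (mul_le_mul_of_nonneg_right hq hy')

end Continuity

/-! ### The dual function -/

section Dual

variable {Ω : Type*} [MeasurableSpace Ω] {μ : Measure Ω} {f₀ f₁ : Ω → ℝ}

/-- The dual function of the minimization problem: the minimum of the Lagrangian for the
multipliers `p = (lam₀, lam₁, mu₀, mu₁)`. -/
def dualFun (μ : Measure Ω) (f₀ f₁ : Ω → ℝ) (ε₀ ε₁ : ℝ) (p : Param) : ℝ :=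
  -p.1 * ε₀ - p.2.1 * ε₁ - p.2.2.1 - p.2.2.2 -
    (p.1 * ∫ y, dens₀ f₀ f₁ p y ∂μ + p.2.1 * ∫ y, dens₁ f₀ f₁ p y ∂μ)

theorem measurable_dens₀ (hf₀ : Measurable f₀) (hf₁ : Measurable f₁) (p : Param) :
    Measurable (dens₀ f₀ f₁ p) := measurable_paramDensity₀ _ _ _ _ hf₀ hf₁

theorem measurable_dens₁ (hf₀ : Measurable f₀) (hf₁ : Measurable f₁) (p : Param) :
    Measurable (dens₁ f₀ f₁ p) := measurable_paramDensity₁ _ _ _ _ hf₀ hf₁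

theorem ae_dens_pos (hf₀ : IsPosDensity μ f₀) (hf₁ : IsPosDensity μ f₁) {p : Param}
    (h₀ : 0 < p.1) (h₁ : 0 < p.2.1) : ∀ᵐ y ∂μ, 0 < dens₀ f₀ f₁ p y ∧ 0 < dens₁ f₀ f₁ p y := by
  filter_upwards [hf₀.2.1, hf₁.2.1] with y y0 y1
  exact ⟨paramDensity₀_pos h₀ h₁ y0 y1, paramDensity₁_pos h₀ h₁ y0 y1⟩

theorem ae_dens_bounds (hf₀ : IsPosDensity μ f₀) (hf₁ : IsPosDensity μ f₁) {p : Param}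
    (h₀ : 0 < p.1) (h₁ : 0 < p.2.1) : ∀ᵐ y ∂μ,
    |dens₀ f₀ f₁ p y| ≤ dominationConst p.1 p.2.1 p.2.2.1 p.2.2.2 * (f₀ y + f₁ y) ∧
    |dens₁ f₀ f₁ p y| ≤ dominationConst p.1 p.2.1 p.2.2.1 p.2.2.2 * (f₀ y + f₁ y) ∧
    |dens₀ f₀ f₁ p y * Real.log (dens₀ f₀ f₁ p y / f₀ y)| ≤
      dominationConst p.1 p.2.1 p.2.2.1 p.2.2.2 * (f₀ y + f₁ y) ∧
    |dens₁ f₀ f₁ p y * Real.log (dens₁ f₀ f₁ p y / f₁ y)| ≤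
      dominationConst p.1 p.2.1 p.2.2.1 p.2.2.2 * (f₀ y + f₁ y) := by
  filter_upwards [hf₀.2.1, hf₁.2.1] with y y0 y1
  exact paramDensity_bounds h₀ h₁ y0 y1 rfl rfl

theorem integrable_of_dominationConst (hf₀ : IsPosDensity μ f₀) (hf₁ : IsPosDensity μ f₁)
    {p : Param} {φ : Ω → ℝ} (hm : Measurable φ)
    (hb : ∀ᵐ y ∂μ, |φ y| ≤ dominationConst p.1 p.2.1 p.2.2.1 p.2.2.2 * (f₀ y + f₁ y)) :
    Integrable φ μ :=
  ((hf₀.2.2.1.add hf₁.2.2.1).const_mul _).mono' hm.aestronglyMeasurable hb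

theorem integrable_dens (hf₀ : IsPosDensity μ f₀) (hf₁ : IsPosDensity μ f₁) {p : Param}
    (h₀ : 0 < p.1) (h₁ : 0 < p.2.1) :
    Integrable (dens₀ f₀ f₁ p) μ ∧ Integrable (dens₁ f₀ f₁ p) μ ∧
    Integrable (fun y => dens₀ f₀ f₁ p y * Real.log (dens₀ f₀ f₁ p y / f₀ y)) μ ∧
    Integrable (fun y => dens₁ f₀ f₁ p y * Real.log (dens₁ f₀ f₁ p y / f₁ y)) μ := by
  have hb := ae_dens_bounds hf₀ hf₁ h₀ h₁
  have m₀ := measurable_dens₀ hf₀.1 hf₁.1 p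
  have m₁ := measurable_dens₁ hf₀.1 hf₁.1 p
  exact ⟨integrable_of_dominationConst hf₀ hf₁ m₀ (hb.mono fun y h => h.1),
    integrable_of_dominationConst hf₀ hf₁ m₁ (hb.mono fun y h => h.2.1),
    integrable_of_dominationConst hf₀ hf₁ (m₀.mul (measurable_log_div hf₀.1 m₀))
      (hb.mono fun y h => h.2.2.1),
    integrable_of_dominationConst hf₀ hf₁ (m₁.mul (measurable_log_div hf₁.1 m₁))
      (hb.mono fun y h => h.2.2.2)⟩

theorem continuousAt_integral_dens (hf₀ : IsPosDensity μ f₀) (hf₁ : IsPosDensity μ f₁)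
    {p : Param} (h₀ : 0 < p.1) (h₁ : 0 < p.2.1) :
    ContinuousAt (fun p => ∫ y, dens₀ f₀ f₁ p y ∂μ) p ∧
    ContinuousAt (fun p => ∫ y, dens₁ f₀ f₁ p y ∂μ) p ∧
    ContinuousAt (fun p => ∫ y, dens₀ f₀ f₁ p y * Real.log (dens₀ f₀ f₁ p y / f₀ y) ∂μ) p ∧
    ContinuousAt (fun p => ∫ y, dens₁ f₀ f₁ p y * Real.log (dens₁ f₀ f₁ p y / f₁ y) ∂μ) p := by
  have m₀ := measurable_dens₀ hf₀.1 hf₁.1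
  have m₁ := measurable_dens₁ hf₀.1 hf₁.1
  have hnn : ∀ᵐ y ∂μ, 0 ≤ f₀ y + f₁ y := by
    filter_upwards [hf₀.2.1, hf₁.2.1] with y y0 y1 using (add_pos y0 y1).le
  refine ⟨?_, ?_, ?_, ?_⟩
  · refine continuousAt_integral_of_dominationConst hf₀.2.2.1 hf₁.2.2.1 m₀
      (fun q q0 q1 => (ae_dens_bounds hf₀ hf₁ q0 q1).mono fun y h => h.1) hnn h₀ h₁ ?_
    filter_upwards [hf₀.2.1, hf₁.2.1] with y y0 y1 using continuousAt_dens₀ h₀ h₁ y0 y1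
  · refine continuousAt_integral_of_dominationConst hf₀.2.2.1 hf₁.2.2.1 m₁
      (fun q q0 q1 => (ae_dens_bounds hf₀ hf₁ q0 q1).mono fun y h => h.2.1) hnn h₀ h₁ ?_
    filter_upwards [hf₀.2.1, hf₁.2.1] with y y0 y1 using continuousAt_dens₁ h₀ h₁ y0 y1
  · refine continuousAt_integral_of_dominationConst hf₀.2.2.1 hf₁.2.2.1
      (fun q => (m₀ q).mul (measurable_log_div hf₀.1 (m₀ q)))
      (fun q q0 q1 => (ae_dens_bounds hf₀ hf₁ q0 q1).mono fun y h => h.2.2.1) hnn h₀ h₁ ?_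
    filter_upwards [hf₀.2.1, hf₁.2.1] with y y0 y1
    have hc := continuousAt_dens₀ h₀ h₁ y0 y1
    exact hc.mul ((hc.div_const _).log (div_pos (paramDensity₀_pos h₀ h₁ y0 y1) y0).ne')
  · refine continuousAt_integral_of_dominationConst hf₀.2.2.1 hf₁.2.2.1
      (fun q => (m₁ q).mul (measurable_log_div hf₁.1 (m₁ q)))
      (fun q q0 q1 => (ae_dens_bounds hf₀ hf₁ q0 q1).mono fun y h => h.2.2.2) hnn h₀ h₁ ?_
    filter_upwards [hf₀.2.1, hf₁.2.1] with y y0 y1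
    have hc := continuousAt_dens₁ h₀ h₁ y0 y1
    exact hc.mul ((hc.div_const _).log (div_pos (paramDensity₁_pos h₀ h₁ y0 y1) y1).ne')

theorem continuousAt_dualFun (hf₀ : IsPosDensity μ f₀) (hf₁ : IsPosDensity μ f₁) (ε₀ ε₁ : ℝ)
    {p : Param} (h₀ : 0 < p.1) (h₁ : 0 < p.2.1) :
    ContinuousAt (dualFun μ f₀ f₁ ε₀ ε₁) p := by
  obtain ⟨c₀, c₁, -, -⟩ := continuousAt_integral_dens hf₀ hf₁ h₀ h₁
  unfold dualFun
  exact ContinuousAt.sub (by fun_prop)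
    ((continuous_fst.continuousAt.mul c₀).add
      ((continuous_fst.comp continuous_snd).continuousAt.mul c₁))

/-- Weak duality: the dual function is at most the Lagrangian at every pair of positive
integrable functions, normalized or not. -/
theorem dualFun_le (hf₀ : IsPosDensity μ f₀) (hf₁ : IsPosDensity μ f₁) (ε₀ ε₁ : ℝ)
    {p : Param} (h₀ : 0 < p.1) (h₁ : 0 < p.2.1) {x₀ x₁ : Ω → ℝ}
    (hx : ∀ᵐ y ∂μ, 0 < x₀ y ∧ 0 < x₁ y) (i₀ : Integrable x₀ μ) (i₁ : Integrable x₁ μ)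
    (j : Integrable (fun y => x₀ y * Real.log (x₀ y / x₁ y)) μ)
    (j₀ : Integrable (fun y => x₀ y * Real.log (x₀ y / f₀ y)) μ)
    (j₁ : Integrable (fun y => x₁ y * Real.log (x₁ y / f₁ y)) μ) :
    dualFun μ f₀ f₁ ε₀ ε₁ p ≤ ∫ y, x₀ y * Real.log (x₀ y / x₁ y) ∂μ
      + p.1 * (∫ y, x₀ y * Real.log (x₀ y / f₀ y) ∂μ - ε₀)
      + p.2.1 * (∫ y, x₁ y * Real.log (x₁ y / f₁ y) ∂μ - ε₁)
      + p.2.2.1 * (∫ y, x₀ y ∂μ - 1) + p.2.2.2 * (∫ y, x₁ y ∂μ - 1) := by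
  obtain ⟨d₀, d₁, -, -⟩ := integrable_dens hf₀ hf₁ h₀ h₁
  have k₀ := j₀.const_mul p.1
  have k₁ := j₁.const_mul p.2.1
  have n₀ := i₀.const_mul p.2.2.1
  have n₁ := i₁.const_mul p.2.2.2
  have t₀ : Integrable (fun y => x₀ y * Real.log (x₀ y / x₁ y) +
    p.1 * (x₀ y * Real.log (x₀ y / f₀ y))) μ := j.add k₀
  have t₁ : Integrable (fun y => x₀ y * Real.log (x₀ y / x₁ y) +
    p.1 * (x₀ y * Real.log (x₀ y / f₀ y)) + p.2.1 * (x₁ y * Real.log (x₁ y / f₁ y))) μ :=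
    t₀.add k₁
  have t₂ : Integrable (fun y => x₀ y * Real.log (x₀ y / x₁ y) +
    p.1 * (x₀ y * Real.log (x₀ y / f₀ y)) + p.2.1 * (x₁ y * Real.log (x₁ y / f₁ y)) +
    p.2.2.1 * x₀ y) μ := t₁.add n₀
  have hle : ∫ y, -(p.1 * dens₀ f₀ f₁ p y + p.2.1 * dens₁ f₀ f₁ p y) ∂μ ≤
      ∫ y, (x₀ y * Real.log (x₀ y / x₁ y) + p.1 * (x₀ y * Real.log (x₀ y / f₀ y))
        + p.2.1 * (x₁ y * Real.log (x₁ y / f₁ y)) + p.2.2.1 * x₀ y + p.2.2.2 * x₁ y) ∂μ := by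
    refine integral_mono_ae ((d₀.const_mul _).add (d₁.const_mul _)).neg
      (t₂.add n₁) ?_
    filter_upwards [hf₀.2.1, hf₁.2.1, hx] with y y0 y1 hxy
    exact lagrangian_ge h₀ h₁ y0 y1 hxy.1 hxy.2
  rw [integral_neg, integral_add (d₀.const_mul _) (d₁.const_mul _), integral_const_mul,
    integral_const_mul, integral_add t₂ n₁,
    integral_add t₁ n₀, integral_add t₀ k₁, integral_add j k₀,
    integral_const_mul, integral_const_mul, integral_const_mul, integral_const_mul] at hle
  unfold dualFun
  linarith

end Dual

/-! ### Positivity of the dual function somewhere -/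

section Certificate

variable {Ω : Type*}

/-- A pointwise bound on the optimal densities for multipliers of the special form used to
separate disjoint neighborhoods; `L` stands for a truncated log-likelihood ratio. -/
theorem dens_sum_le {f₀ f₁ : Ω → ℝ} {y : Ω} {lam₀ lam₁ s c₀ c₁ L κ : ℝ} (h₀ : 0 < lam₀)
    (h₁ : 0 < lam₁)
    (hf₀ : 0 < f₀ y) (hf₁ : 0 < f₁ y) (hs : lam₁ * (1 - s) = lam₀ * s)
    (hρ1 : |lam₀ * s * L| ≤ 1) (hρκ : |lam₀ * s * L| ≤ κ) {p : Param}
    (hp : p = (lam₀, lam₁, -1 - lam₀ * (1 - c₀), 1 + κ ^ 2 - lam₁ * (1 - c₁))) :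
    lam₀ * dens₀ f₀ f₁ p y + lam₁ * dens₁ f₀ f₁ p y ≤
      lam₀ * (f₀ y * Real.exp (s * L - c₀)) +
        lam₁ * (f₁ y * Real.exp (-(1 - s) * L - c₁)) := by
  subst hp
  have e := lagrangian_eq (mu₀ := -1 - lam₀ * (1 - c₀))
    (mu₁ := 1 + κ ^ 2 - lam₁ * (1 - c₁)) h₀ h₁ hf₀ hf₁ lam₀ lam₁ (-1 - lam₀ * (1 - c₀))
    (1 + κ ^ 2 - lam₁ * (1 - c₁)) _ _ rfl rfl
  have p₀ := paramDensity₀_pos (mu₀ := -1 - lam₀ * (1 - c₀))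
    (mu₁ := 1 + κ ^ 2 - lam₁ * (1 - c₁)) h₀ h₁ hf₀ hf₁
  have p₁ := paramDensity₁_pos (mu₀ := -1 - lam₀ * (1 - c₀))
    (mu₁ := 1 + κ ^ 2 - lam₁ * (1 - c₁)) h₀ h₁ hf₀ hf₁
  unfold dens₀ dens₁
  simp only
  set g₀ := paramDensity₀ lam₀ lam₁ (-1 - lam₀ * (1 - c₀)) (1 + κ ^ 2 - lam₁ * (1 - c₁)) f₀ f₁ y
  set g₁ := paramDensity₁ lam₀ lam₁ (-1 - lam₀ * (1 - c₀)) (1 + κ ^ 2 - lam₁ * (1 - c₁)) f₀ f₁ y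
  have i := mul_log_div_ge p₀ p₁ (Real.exp_pos (-(lam₀ * s * L)))
  have i₀ := mul_le_mul_of_nonneg_left
    (mul_log_div_ge p₀ hf₀ (Real.exp_pos (s * L - c₀))) h₀.le
  have i₁ := mul_le_mul_of_nonneg_left
    (mul_log_div_ge p₁ hf₁ (Real.exp_pos (-(1 - s) * L - c₁))) h₁.le
  rw [Real.log_exp] at i i₀ i₁
  -- the second-order error of the exponential is absorbed by the summand `κ ^ 2` of `mu₁`
  have hexp : Real.exp (-(lam₀ * s * L)) ≤ 1 - lam₀ * s * L + κ ^ 2 := by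
    have h := (abs_le.1 (Real.abs_exp_sub_one_sub_id_le
      (show |-(lam₀ * s * L)| ≤ 1 by rwa [abs_neg]))).2
    have hsq : (-(lam₀ * s * L)) ^ 2 ≤ κ ^ 2 :=
      sq_le_sq' (by linarith [(abs_le.1 hρκ).2]) (by linarith [(abs_le.1 hρκ).1])
    linarith
  have hexp' := mul_le_mul_of_nonneg_right hexp p₁.le
  linear_combination i + i₀ + i₁ + e + hexp' + g₁ * L * hs

theorem abs_clip_le {M : ℝ} (hM : 0 ≤ M) (x : ℝ) : |max (-M) (min M x)| ≤ M := by
  rw [abs_le]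
  exact ⟨le_max_left _ _, max_le (by linarith) (min_le_left _ _)⟩

theorem exp_clip_le {M s : ℝ} (hM : 0 ≤ M) (h0 : 0 ≤ s) (h1 : s ≤ 1) (x : ℝ) :
    Real.exp (s * max (-M) (min M x)) ≤ 1 + Real.exp x := by
  rcases le_total 0 x with h | h
  · have hc : max (-M) (min M x) ≤ x := max_le (by linarith) (min_le_right _ _)
    have : Real.exp (s * max (-M) (min M x)) ≤ Real.exp x := Real.exp_le_exp.2 (by nlinarith)
    linarith
  · have hc : max (-M) (min M x) ≤ 0 := max_le (by linarith) ((min_le_right _ _).trans h)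
    have : Real.exp (s * max (-M) (min M x)) ≤ 1 := Real.exp_le_one_iff.2 (by nlinarith)
    linarith [Real.exp_pos x]

theorem neg_clip {M : ℝ} (hM : 0 ≤ M) (x : ℝ) :
    -max (-M) (min M x) = max (-M) (min M (-x)) := by
  grind

variable [MeasurableSpace Ω] {μ : Measure Ω}

theorem measurable_mul_exp_clip {f g : Ω → ℝ} (hf : Measurable f) (hg : Measurable g) (a M : ℝ) :
    Measurable fun y => f y * Real.exp (a * max (-M) (min M (Real.log (g y / f y)))) := by
  have h := measurable_log_div hf hg
  exact hf.mul (Real.measurable_exp.comp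
    ((measurable_const.max (measurable_const.min h)).const_mul a))

theorem ae_norm_mul_exp_clip_le {f g : Ω → ℝ} (hf : IsPosDensity μ f) (hg : IsPosDensity μ g)
    {a M : ℝ} (hM : 0 ≤ M) (h0 : 0 ≤ a) (h1 : a ≤ 1) :
    ∀ᵐ y ∂μ, ‖f y * Real.exp (a * max (-M) (min M (Real.log (g y / f y))))‖ ≤ f y + g y := by
  filter_upwards [hf.2.1, hg.2.1] with y y0 y1
  rw [Real.norm_eq_abs, abs_of_pos (by positivity), ← mul_one_add_exp_log_div y0 y1]
  exact mul_le_mul_of_nonneg_left (exp_clip_le hM h0 h1 _) y0.le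

theorem integrable_mul_exp_clip {f g : Ω → ℝ} (hf : IsPosDensity μ f) (hg : IsPosDensity μ g)
    {a M : ℝ} (hM : 0 ≤ M) (h0 : 0 ≤ a) (h1 : a ≤ 1) :
    Integrable (fun y => f y * Real.exp (a * max (-M) (min M (Real.log (g y / f y))))) μ :=
  (hf.2.2.1.add hg.2.2.1).mono' (measurable_mul_exp_clip hf.1 hg.1 a M).aestronglyMeasurable
    (ae_norm_mul_exp_clip_le hf hg hM h0 h1)

/-- Truncating the log-likelihood ratio changes the Hellinger integral arbitrarily little. -/
theorem tendsto_integral_mul_exp_clip {f g : Ω → ℝ} (hf : IsPosDensity μ f)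
    (hg : IsPosDensity μ g) {a : ℝ} (h0 : 0 ≤ a) (h1 : a ≤ 1) :
    Tendsto (fun n : ℕ => ∫ y, f y *
      Real.exp (a * max (-(n : ℝ)) (min (n : ℝ) (Real.log (g y / f y)))) ∂μ) atTop
      (𝓝 (geoMass μ f g a)) := by
  refine tendsto_integral_of_dominated_convergence (fun y => f y + g y)
    (fun n => (measurable_mul_exp_clip hf.1 hg.1 a n).aestronglyMeasurable)
    (hf.2.2.1.add hg.2.2.1) (fun n => ae_norm_mul_exp_clip_le hf hg (Nat.cast_nonneg n) h0 h1)
    (ae_of_all _ fun y => ?_)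
  refine Tendsto.congr' ?_ tendsto_const_nhds
  obtain ⟨N, hN⟩ := exists_nat_ge |Real.log (g y / f y)|
  filter_upwards [eventually_ge_atTop N] with n hn
  have hn' : |Real.log (g y / f y)| ≤ n := hN.trans (by exact_mod_cast hn)
  rw [abs_le] at hn'
  rw [geoKernel, min_eq_right hn'.2, max_eq_right hn'.1]

/-- The Hellinger integral is symmetric in the two densities. -/
theorem geoMass_swap {f g : Ω → ℝ} (hf : IsPosDensity μ f) (hg : IsPosDensity μ g) (s : ℝ) :
    geoMass μ g f (1 - s) = geoMass μ f g s := by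
  refine integral_congr_ae ?_
  filter_upwards [hf.2.1, hg.2.1] with y y0 y1
  have h : Real.log (f y / g y) = -Real.log (g y / f y) := log_div_swap _ _
  have hr : g y = f y * Real.exp (Real.log (g y / f y)) := by
    rw [Real.exp_log (div_pos y1 y0), mul_div_cancel₀ _ y0.ne']
  rw [geoKernel, geoKernel, h]
  nth_rewrite 1 [hr]
  rw [mul_assoc, ← Real.exp_add]
  congr 2
  ring

/-- Strong duality in qualitative form: for disjoint neighborhoods the dual function takes a
positive value. The multipliers are small multiples of `(1 - s, s)`, where `s` is a parameter at
which the Rényi-type bound separates the neighborhoods. -/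
theorem exists_dualFun_pos [SigmaFinite μ] {f₀ f₁ : Ω → ℝ} (hf₀ : IsPosDensity μ f₀)
    (hf₁ : IsPosDensity μ f₁) {ε₀ ε₁ : ℝ} (hε₀ : 0 < ε₀) (hε₁ : 0 < ε₁)
    (hdisj : Disjoint (klClass (distOf μ f₀) ε₀) (klClass (distOf μ f₁) ε₁)) :
    ∃ p : Param, 0 < p.1 ∧ 0 < p.2.1 ∧ 0 < dualFun μ f₀ f₁ ε₀ ε₁ p := by
  obtain ⟨s, hs0, hs1, hs⟩ := exists_separating hf₀ hf₁ hε₀ hε₁ hdisj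
  have hZ := geoMass_pos hf₀ hf₁ hs0.le hs1.le
  have t₀ := tendsto_integral_mul_exp_clip hf₀ hf₁ hs0.le hs1.le
  have t₁ := tendsto_integral_mul_exp_clip hf₁ hf₀ (a := 1 - s) (by linarith) (by linarith)
  rw [geoMass_swap hf₀ hf₁] at t₁
  have hlim := ((t₀.log hZ.ne').const_mul (1 - s)).add ((t₁.log hZ.ne').const_mul s)
  have hev := (hlim.eventually_lt_const (u := -((1 - s) * ε₀ + s * ε₁)) (by linarith)).and
    ((t₀.eventually_const_lt hZ).and ((t₁.eventually_const_lt hZ).and (eventually_ge_atTop 1)))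
  obtain ⟨M, hM, hZ₀, hZ₁, hM1⟩ := hev.exists
  have hM1' : (1 : ℝ) ≤ M := by exact_mod_cast hM1
  have hM0 : (0 : ℝ) ≤ M := by linarith
  set Z₀ := ∫ y, f₀ y * Real.exp (s * max (-(M : ℝ)) (min (M : ℝ) (Real.log (f₁ y / f₀ y)))) ∂μ
  set Z₁ := ∫ y, f₁ y *
    Real.exp ((1 - s) * max (-(M : ℝ)) (min (M : ℝ) (Real.log (f₀ y / f₁ y)))) ∂μ
  set η := -((1 - s) * ε₀ + s * ε₁) - ((1 - s) * Real.log Z₀ + s * Real.log Z₁) with hη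
  have hη0 : 0 < η := by linarith
  -- the scale of the multipliers, small enough for the second-order error to be negligible
  obtain ⟨R, hR0, hR1, hR2⟩ : ∃ R : ℝ, 0 < R ∧ R * M ≤ 1 ∧ R * M ^ 2 < η := by
    refine ⟨min (1 / M) (η / (2 * M ^ 2)), by positivity, ?_, ?_⟩
    · have := mul_le_mul_of_nonneg_right (min_le_left (1 / (M : ℝ)) (η / (2 * M ^ 2))) hM0
      rwa [one_div_mul_cancel (by positivity)] at this
    · have := mul_le_mul_of_nonneg_right (min_le_right (1 / (M : ℝ)) (η / (2 * M ^ 2)))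
        (sq_nonneg (M : ℝ))
      have h2 : η / (2 * (M : ℝ) ^ 2) * M ^ 2 = η / 2 := by field_simp
      linarith
  have h₀ : 0 < R * (1 - s) := mul_pos hR0 (by linarith)
  have h₁ : 0 < R * s := mul_pos hR0 hs0
  set p : Param := (R * (1 - s), R * s, -1 - R * (1 - s) * (1 - Real.log Z₀),
    1 + (R * M) ^ 2 - R * s * (1 - Real.log Z₁)) with hp
  refine ⟨p, h₀, h₁, ?_⟩
  have i₀ := integrable_mul_exp_clip hf₀ hf₁ hM0 hs0.le hs1.le
  have i₁ := integrable_mul_exp_clip hf₁ hf₀ (a := 1 - s) hM0 (by linarith) (by linarith)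
  obtain ⟨d₀, d₁, -, -⟩ := integrable_dens hf₀ hf₁ (p := p) h₀ h₁
  have hle : ∫ y, (R * (1 - s) * dens₀ f₀ f₁ p y + R * s * dens₁ f₀ f₁ p y) ∂μ ≤
      ∫ y, (R * (1 - s) / Z₀ * (f₀ y *
        Real.exp (s * max (-(M : ℝ)) (min (M : ℝ) (Real.log (f₁ y / f₀ y))))) +
        R * s / Z₁ * (f₁ y *
        Real.exp ((1 - s) * max (-(M : ℝ)) (min (M : ℝ) (Real.log (f₀ y / f₁ y)))))) ∂μ := by
    refine integral_mono_ae ((d₀.const_mul _).add (d₁.const_mul _))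
      ((i₀.const_mul _).add (i₁.const_mul _)) ?_
    filter_upwards [hf₀.2.1, hf₁.2.1] with y y0 y1
    have hclip := abs_clip_le hM0 (Real.log (f₁ y / f₀ y))
    have hρ : |R * (1 - s) * s * max (-(M : ℝ)) (min (M : ℝ) (Real.log (f₁ y / f₀ y)))| ≤
        R * M := by
      rw [abs_mul, abs_of_pos (mul_pos h₀ hs0)]
      refine mul_le_mul ?_ hclip (abs_nonneg _) hR0.le
      have : (1 - s) * s ≤ 1 := by nlinarith
      nlinarith
    have h := dens_sum_le (f₀ := f₀) (f₁ := f₁) (c₀ := Real.log Z₀) (c₁ := Real.log Z₁) h₀ h₁ y0 y1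
      (by ring) (hρ.trans hR1) hρ hp
    refine h.trans (le_of_eq ?_)
    rw [log_div_swap (f₀ y) (f₁ y), ← neg_clip hM0, Real.exp_sub, Real.exp_sub, Real.exp_log hZ₀,
      Real.exp_log hZ₁, mul_neg, neg_mul]
    ring
  rw [integral_add (d₀.const_mul _) (d₁.const_mul _), integral_const_mul, integral_const_mul,
    integral_add (i₀.const_mul _) (i₁.const_mul _), integral_const_mul, integral_const_mul] at hle
  change _ ≤ R * (1 - s) / Z₀ * Z₀ + R * s / Z₁ * Z₁ at hle
  rw [div_mul_cancel₀ _ hZ₀.ne', div_mul_cancel₀ _ hZ₁.ne'] at hle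
  have hfin : R * (η - R * M ^ 2) ≤ dualFun μ f₀ f₁ ε₀ ε₁ p := by
    unfold dualFun
    simp only [hp] at hle ⊢
    rw [hη]
    linarith
  exact (mul_pos hR0 (by linarith)).trans_le hfin

end Certificate

/-! ### The dual function attains its maximum -/

section Attained

variable {Ω : Type*} [MeasurableSpace Ω] {μ : Measure Ω} {f₀ f₁ : Ω → ℝ}

/-- Weak duality at rescaled pairs of densities. -/
theorem dualFun_le_scaled (hf₀ : IsPosDensity μ f₀) (hf₁ : IsPosDensity μ f₁) (ε₀ ε₁ : ℝ)
    {p : Param} (h₀ : 0 < p.1) (h₁ : 0 < p.2.1) {x₀ x₁ : Ω → ℝ}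
    (hx₀ : IsPosDensity μ x₀) (hx₁ : IsPosDensity μ x₁)
    (j : Integrable (fun y => x₀ y * Real.log (x₀ y / x₁ y)) μ)
    (j₀ : Integrable (fun y => x₀ y * Real.log (x₀ y / f₀ y)) μ)
    (j₁ : Integrable (fun y => x₁ y * Real.log (x₁ y / f₁ y)) μ) {c₀ c₁ : ℝ} (hc₀ : 0 < c₀)
    (hc₁ : 0 < c₁) :
    dualFun μ f₀ f₁ ε₀ ε₁ p ≤
      c₀ * (∫ y, x₀ y * Real.log (x₀ y / x₁ y) ∂μ + Real.log (c₀ / c₁))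
      + p.1 * (c₀ * (∫ y, x₀ y * Real.log (x₀ y / f₀ y) ∂μ + Real.log c₀) - ε₀)
      + p.2.1 * (c₁ * (∫ y, x₁ y * Real.log (x₁ y / f₁ y) ∂μ + Real.log c₁) - ε₁)
      + p.2.2.1 * (c₀ - 1) + p.2.2.2 * (c₁ - 1) := by
  -- scaling a density adds a multiple of the density to its entropy integrand
  have key : ∀ {x z : Ω → ℝ} {c d : ℝ}, IsPosDensity μ x → (∀ᵐ y ∂μ, 0 < z y) → 0 < c → 0 < d →
      Integrable (fun y => x y * Real.log (x y / z y)) μ →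
      Integrable (fun y => c * x y * Real.log (c * x y / (d * z y))) μ ∧
      ∫ y, c * x y * Real.log (c * x y / (d * z y)) ∂μ =
        c * (∫ y, x y * Real.log (x y / z y) ∂μ + Real.log (c / d)) := by
    intro x z c d hx hz hc hd hi
    have hi' : Integrable (fun y => x y * Real.log (x y / z y) + Real.log (c / d) * x y) μ :=
      hi.add (hx.2.2.1.const_mul _)
    have hae : (fun y => c * (x y * Real.log (x y / z y) + Real.log (c / d) * x y)) =ᵐ[μ]
        fun y => c * x y * Real.log (c * x y / (d * z y)) := by
      filter_upwards [hx.2.1, hz] with y hxy hzy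
      rw [mul_div_mul_comm, Real.log_mul (by positivity) (by positivity)]
      ring
    refine ⟨(hi'.const_mul c).congr hae, ?_⟩
    rw [← integral_congr_ae hae, integral_const_mul, integral_add hi (hx.2.2.1.const_mul _),
      integral_const_mul, hx.2.2.2, mul_one]
  obtain ⟨k, e⟩ := key hx₀ hx₁.2.1 hc₀ hc₁ j
  obtain ⟨k₀, e₀⟩ := key hx₀ hf₀.2.1 hc₀ one_pos j₀
  obtain ⟨k₁, e₁⟩ := key hx₁ hf₁.2.1 hc₁ one_pos j₁
  simp only [one_mul, div_one] at k₀ e₀ k₁ e₁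
  have hpos : ∀ᵐ y ∂μ, 0 < c₀ * x₀ y ∧ 0 < c₁ * x₁ y := by
    filter_upwards [hx₀.2.1, hx₁.2.1] with y y0 y1 using ⟨mul_pos hc₀ y0, mul_pos hc₁ y1⟩
  have h := dualFun_le hf₀ hf₁ ε₀ ε₁ h₀ h₁ hpos (hx₀.2.2.1.const_mul c₀)
    (hx₁.2.2.1.const_mul c₁) k k₀ k₁
  rwa [e, e₀, e₁, integral_const_mul, integral_const_mul, hx₀.2.2.2, hx₁.2.2.2, mul_one,
    mul_one] at h

theorem mul_le_mul_abs {a b c : ℝ} (ha : 0 < a) (hb : a ≤ b) : a * c ≤ b * |c| :=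
  (mul_le_mul_of_nonneg_left (le_abs_self c) ha.le).trans
    (mul_le_mul_of_nonneg_right hb (abs_nonneg c))

/-- The superlevel sets of the dual function at positive levels are contained in a box on which
both divergence multipliers stay away from zero. -/
theorem exists_box [SigmaFinite μ] (hf₀ : IsPosDensity μ f₀) (hf₁ : IsPosDensity μ f₁) {ε₀ ε₁ : ℝ}
    (hε₀ : 0 < ε₀) (hε₁ : 0 < ε₁) {δ : ℝ} (hδ : 0 < δ) :
    ∃ lo hi : Param, 0 < lo.1 ∧ 0 < lo.2.1 ∧ ∀ p : Param, 0 < p.1 → 0 < p.2.1 →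
      δ ≤ dualFun μ f₀ f₁ ε₀ ε₁ p → p ∈ Set.Icc lo hi := by
  obtain ⟨s, hs0, hs1, hs⟩ := exists_geoDiv₀_lt hf₀ hf₁ hε₀
  obtain ⟨t, ht0, ht1, ht⟩ := exists_geoDiv₁_lt hf₀ hf₁ hε₁
  have xs := isPosDensity_geoDensity hf₀ hf₁ hs0.le hs1.le
  have xt := isPosDensity_geoDensity hf₀ hf₁ ht0.le ht1.le
  obtain ⟨is₀, es₀⟩ := integral_geoDensity_log₀ hf₀ hf₁ hs0 hs1
  obtain ⟨is₁, es₁⟩ := integral_geoDensity_log₁ hf₀ hf₁ hs0 hs1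
  obtain ⟨it₀, et₀⟩ := integral_geoDensity_log₀ hf₀ hf₁ ht0 ht1
  obtain ⟨it₁, et₁⟩ := integral_geoDensity_log₁ hf₀ hf₁ ht0 ht1
  have jst := integrable_geoDensity_log_div hf₀ hf₁ hs0 hs1 ht0 ht1
  have jss := integrable_geoDensity_log_div hf₀ hf₁ hs0 hs1 hs0 hs1
  have jtt := integrable_geoDensity_log_div hf₀ hf₁ ht0 ht1 ht0 ht1
  have hself : ∀ r, 0 < r → r < 1 → ∫ y, geoDensity μ f₀ f₁ r y *
      Real.log (geoDensity μ f₀ f₁ r y / geoDensity μ f₀ f₁ r y) ∂μ = 0 := by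
    intro r hr0 hr1
    refine integral_eq_zero_of_ae ?_
    filter_upwards [(isPosDensity_geoDensity hf₀ hf₁ hr0.le hr1.le).2.1] with y hy
    rw [div_self hy.ne', Real.log_one, mul_zero, Pi.zero_apply]
  set A := ∫ y, geoDensity μ f₀ f₁ s y *
    Real.log (geoDensity μ f₀ f₁ s y / geoDensity μ f₀ f₁ t y) ∂μ
  set B₀ := geoDiv₀ μ f₀ f₁ s
  set B₁ := geoDiv₁ μ f₀ f₁ s
  set C₀ := geoDiv₀ μ f₀ f₁ t
  set C₁ := geoDiv₁ μ f₀ f₁ t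
  -- upper bounds for the multipliers from the strictly feasible pair
  set Λ₀ := |A| / (ε₀ - B₀) with hΛ₀
  set Λ₁ := |A| / (ε₁ - C₁) with hΛ₁
  set D := Λ₀ * |2 * (B₀ + Real.log 2) - ε₀| + Λ₀ * |1 / 2 * (B₀ + Real.log (1 / 2)) - ε₀|
    + Λ₁ * |2 * (C₁ + Real.log 2) - ε₁| + Λ₁ * |1 / 2 * (C₁ + Real.log (1 / 2)) - ε₁|
    + Λ₀ * |B₀ - ε₀| + Λ₁ * |C₁ - ε₁| with hD
  set N := 2 * |A| + 2 * |Real.log 2| + 2 * |Real.log (1 / 2)| + D with hN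
  have hposΛ₀ : 0 ≤ Λ₀ := div_nonneg (abs_nonneg _) (by linarith)
  have hposΛ₁ : 0 ≤ Λ₁ := div_nonneg (abs_nonneg _) (by linarith)
  refine ⟨(δ / (|C₀| + 1), δ / (|B₁| + 1), -N, -N), (Λ₀, Λ₁, 2 * N, 2 * N), by positivity,
    by positivity, fun p h₀ h₁ hp => ?_⟩
  have q : ∀ {c₀ c₁ : ℝ}, 0 < c₀ → 0 < c₁ → δ ≤ c₀ * (A + Real.log (c₀ / c₁))
      + p.1 * (c₀ * (B₀ + Real.log c₀) - ε₀) + p.2.1 * (c₁ * (C₁ + Real.log c₁) - ε₁)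
      + p.2.2.1 * (c₀ - 1) + p.2.2.2 * (c₁ - 1) := fun hc₀ hc₁ => by
    have h := dualFun_le_scaled hf₀ hf₁ ε₀ ε₁ h₀ h₁ xs xt jst is₀ it₁ hc₀ hc₁
    rw [es₀, et₁] at h
    exact hp.trans h
  have l₀ : δ / (|C₀| + 1) ≤ p.1 := by
    have h := dualFun_le_scaled hf₀ hf₁ ε₀ ε₁ h₀ h₁ xt xt jtt it₀ it₁ one_pos one_pos
    rw [et₀, et₁, hself t ht0 ht1] at h
    simp only [div_one, Real.log_one, add_zero, mul_zero, one_mul, sub_self, zero_add] at h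
    rw [div_le_iff₀ (by positivity)]
    nlinarith [le_abs_self C₀]
  have l₁ : δ / (|B₁| + 1) ≤ p.2.1 := by
    have h := dualFun_le_scaled hf₀ hf₁ ε₀ ε₁ h₀ h₁ xs xs jss is₀ is₁ one_pos one_pos
    rw [es₀, es₁, hself s hs0 hs1] at h
    simp only [div_one, Real.log_one, add_zero, mul_zero, one_mul, sub_self, zero_add] at h
    rw [div_le_iff₀ (by positivity)]
    nlinarith [le_abs_self B₁]
  have hA := le_abs_self A
  have q1 := q one_pos one_pos
  simp only [div_one, Real.log_one, add_zero, mul_zero, one_mul, sub_self] at q1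
  have m₀ : 0 < p.1 * (ε₀ - B₀) := mul_pos h₀ (by linarith)
  have m₁ : 0 < p.2.1 * (ε₁ - C₁) := mul_pos h₁ (by linarith)
  have u₀ : p.1 ≤ Λ₀ := by
    rw [hΛ₀, le_div_iff₀ (by linarith)]
    linarith
  have u₁ : p.2.1 ≤ Λ₁ := by
    rw [hΛ₁, le_div_iff₀ (by linarith)]
    linarith
  have a₁ := mul_le_mul_abs (c := 2 * (B₀ + Real.log 2) - ε₀) h₀ u₀
  have a₂ := mul_le_mul_abs (c := 1 / 2 * (B₀ + Real.log (1 / 2)) - ε₀) h₀ u₀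
  have a₃ := mul_le_mul_abs (c := B₀ - ε₀) h₀ u₀
  have b₁ := mul_le_mul_abs (c := 2 * (C₁ + Real.log 2) - ε₁) h₁ u₁
  have b₂ := mul_le_mul_abs (c := 1 / 2 * (C₁ + Real.log (1 / 2)) - ε₁) h₁ u₁
  have b₃ := mul_le_mul_abs (c := C₁ - ε₁) h₁ u₁
  have z₁ := mul_nonneg hposΛ₀ (abs_nonneg (2 * (B₀ + Real.log 2) - ε₀))
  have z₂ := mul_nonneg hposΛ₀ (abs_nonneg (1 / 2 * (B₀ + Real.log (1 / 2)) - ε₀))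
  have z₃ := mul_nonneg hposΛ₀ (abs_nonneg (B₀ - ε₀))
  have z₄ := mul_nonneg hposΛ₁ (abs_nonneg (2 * (C₁ + Real.log 2) - ε₁))
  have z₅ := mul_nonneg hposΛ₁ (abs_nonneg (1 / 2 * (C₁ + Real.log (1 / 2)) - ε₁))
  have z₆ := mul_nonneg hposΛ₁ (abs_nonneg (C₁ - ε₁))
  have e₁ := le_abs_self (Real.log 2)
  have e₂ := le_abs_self (Real.log (1 / 2))
  have e₃ := abs_nonneg A
  have e₄ := abs_nonneg (Real.log 2)
  have e₅ := abs_nonneg (Real.log (1 / 2))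
  -- doubling or halving one of the two densities bounds the multipliers of the masses
  have q2 := q two_pos one_pos
  have q3 := q one_half_pos one_pos
  have q4 := q one_pos two_pos
  have q5 := q one_pos one_half_pos
  have hhalf : (1 : ℝ) / (1 / 2) = 2 := by norm_num
  rw [hhalf] at q5
  simp only [div_one, Real.log_one, add_zero, mul_zero, one_mul, sub_self] at q2 q3 q4 q5
  refine ⟨⟨l₀, l₁, ?_, ?_⟩, ⟨u₀, u₁, ?_, ?_⟩⟩ <;> simp only <;> rw [hN, hD]
  · linarith only [q2, a₁, b₃, z₁, z₂, z₃, z₄, z₅, z₆, e₁, e₂, e₃, e₄, e₅, hA, hδ]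
  · linarith only [q4, a₃, b₁, z₁, z₂, z₃, z₄, z₅, z₆, e₁, e₂, e₃, e₄, e₅, hA, hδ]
  · linarith only [q3, a₂, b₃, z₁, z₂, z₃, z₄, z₅, z₆, e₁, e₂, e₃, e₄, e₅, hA, hδ]
  · linarith only [q5, a₃, b₂, z₁, z₂, z₃, z₄, z₅, z₆, e₁, e₂, e₃, e₄, e₅, hA, hδ]

theorem exists_dualFun_max [SigmaFinite μ] (hf₀ : IsPosDensity μ f₀) (hf₁ : IsPosDensity μ f₁)
    {ε₀ ε₁ : ℝ} (hε₀ : 0 < ε₀) (hε₁ : 0 < ε₁)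
    (hdisj : Disjoint (klClass (distOf μ f₀) ε₀) (klClass (distOf μ f₁) ε₁)) :
    ∃ p : Param, 0 < p.1 ∧ 0 < p.2.1 ∧ ∀ q : Param, 0 < q.1 → 0 < q.2.1 →
      dualFun μ f₀ f₁ ε₀ ε₁ q ≤ dualFun μ f₀ f₁ ε₀ ε₁ p := by
  obtain ⟨p₁, hp0, hp1, hpos⟩ := exists_dualFun_pos hf₀ hf₁ hε₀ hε₁ hdisj
  obtain ⟨lo, hi, hlo0, hlo1, hbox⟩ := exists_box hf₀ hf₁ hε₀ hε₁ hpos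
  have hcont : ContinuousOn (dualFun μ f₀ f₁ ε₀ ε₁) (Set.Icc lo hi) := fun p hp =>
    (continuousAt_dualFun hf₀ hf₁ ε₀ ε₁ (hlo0.trans_le hp.1.1)
      (hlo1.trans_le hp.1.2.1)).continuousWithinAt
  obtain ⟨p, hp, hmax⟩ := isCompact_Icc.exists_isMaxOn ⟨p₁, hbox p₁ hp0 hp1 le_rfl⟩ hcont
  have hle := hmax (hbox p₁ hp0 hp1 le_rfl)
  refine ⟨p, hlo0.trans_le hp.1.1, hlo1.trans_le hp.1.2.1, fun q hq0 hq1 => ?_⟩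
  rcases le_total (dualFun μ f₀ f₁ ε₀ ε₁ p₁) (dualFun μ f₀ f₁ ε₀ ε₁ q) with h | h
  · exact hmax (hbox q hq0 hq1 h)
  · exact h.trans hle

/-! ### Stationarity at the maximum -/

/-- The supergradient inequality of the concave dual function. Its supergradient collects the
residuals of the four parameter equations. -/
theorem dualFun_le_supergradient (hf₀ : IsPosDensity μ f₀) (hf₁ : IsPosDensity μ f₁) (ε₀ ε₁ : ℝ)
    {p q : Param} (hp₀ : 0 < p.1) (hp₁ : 0 < p.2.1) (hq₀ : 0 < q.1) (hq₁ : 0 < q.2.1) :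
    dualFun μ f₀ f₁ ε₀ ε₁ p ≤ dualFun μ f₀ f₁ ε₀ ε₁ q
      + (p.1 - q.1) * (∫ y, dens₀ f₀ f₁ q y * Real.log (dens₀ f₀ f₁ q y / f₀ y) ∂μ - ε₀)
      + (p.2.1 - q.2.1) * (∫ y, dens₁ f₀ f₁ q y * Real.log (dens₁ f₀ f₁ q y / f₁ y) ∂μ - ε₁)
      + (p.2.2.1 - q.2.2.1) * (∫ y, dens₀ f₀ f₁ q y ∂μ - 1)
      + (p.2.2.2 - q.2.2.2) * (∫ y, dens₁ f₀ f₁ q y ∂μ - 1) := by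
  obtain ⟨d₀, d₁, k₀, k₁⟩ := integrable_dens hf₀ hf₁ hq₀ hq₁
  -- at the minimizer the mixed entropy integrand is a linear combination of the others
  have hae : (fun y => (-(q.1 + q.2.2.1)) * dens₀ f₀ f₁ q y
      + (-q.1) * (dens₀ f₀ f₁ q y * Real.log (dens₀ f₀ f₁ q y / f₀ y))
      + (-(q.2.1 + q.2.2.2)) * dens₁ f₀ f₁ q y
      + (-q.2.1) * (dens₁ f₀ f₁ q y * Real.log (dens₁ f₀ f₁ q y / f₁ y))) =ᵐ[μ]
      fun y => dens₀ f₀ f₁ q y * Real.log (dens₀ f₀ f₁ q y / dens₁ f₀ f₁ q y) := by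
    filter_upwards [hf₀.2.1, hf₁.2.1] with y y0 y1
    have h := lagrangian_eq hq₀ hq₁ y0 y1 0 0 0 0 (dens₀ f₀ f₁ q y) (dens₁ f₀ f₁ q y) rfl rfl
    linarith
  have a₀ := d₀.const_mul (-(q.1 + q.2.2.1))
  have a₁ := k₀.const_mul (-q.1)
  have a₂ := d₁.const_mul (-(q.2.1 + q.2.2.2))
  have a₃ := k₁.const_mul (-q.2.1)
  have t₁ : Integrable (fun y => (-(q.1 + q.2.2.1)) * dens₀ f₀ f₁ q y
      + (-q.1) * (dens₀ f₀ f₁ q y * Real.log (dens₀ f₀ f₁ q y / f₀ y))) μ := a₀.add a₁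
  have t₂ : Integrable (fun y => (-(q.1 + q.2.2.1)) * dens₀ f₀ f₁ q y
      + (-q.1) * (dens₀ f₀ f₁ q y * Real.log (dens₀ f₀ f₁ q y / f₀ y))
      + (-(q.2.1 + q.2.2.2)) * dens₁ f₀ f₁ q y) μ := t₁.add a₂
  have hint := (integral_congr_ae hae).symm
  rw [integral_add t₂ a₃, integral_add t₁ a₂, integral_add a₀ a₁, integral_const_mul,
    integral_const_mul, integral_const_mul, integral_const_mul] at hint
  have h := dualFun_le hf₀ hf₁ ε₀ ε₁ hp₀ hp₁ (ae_dens_pos hf₀ hf₁ hq₀ hq₁) d₀ d₁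
    ((t₂.add a₃).congr hae) k₀ k₁
  refine h.trans (le_of_eq ?_)
  rw [hint]
  unfold dualFun
  ring

theorem eq_zero_of_eventually_mul_nonpos {φ : ℝ → ℝ} (hφ : ContinuousAt φ 0)
    (h : ∀ᶠ t in 𝓝 (0 : ℝ), t * φ t ≤ 0) : φ 0 = 0 := by
  refine le_antisymm ?_ ?_
  · refine le_of_tendsto (hφ.tendsto.mono_left (nhdsWithin_le_nhds (s := Set.Ioi 0))) ?_
    filter_upwards [h.filter_mono nhdsWithin_le_nhds, self_mem_nhdsWithin] with t ht hpos
    have hpos' : 0 < t := hpos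
    by_contra hlt
    exact absurd ht (not_le.2 (mul_pos hpos' (not_le.1 hlt)))
  · refine ge_of_tendsto (hφ.tendsto.mono_left (nhdsWithin_le_nhds (s := Set.Iio 0))) ?_
    filter_upwards [h.filter_mono nhdsWithin_le_nhds, self_mem_nhdsWithin] with t ht hneg
    have hneg' : t < 0 := hneg
    by_contra hlt
    exact absurd ht (not_le.2 (mul_pos_of_neg_of_neg hneg' (not_le.1 hlt)))

/-- At a maximum of the dual function the continuous supergradient vanishes, so all four
parameter equations hold. -/
theorem exists_paramEquations [SigmaFinite μ] (hf₀ : IsPosDensity μ f₀)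
    (hf₁ : IsPosDensity μ f₁) {ε₀ ε₁ : ℝ} (hε₀ : 0 < ε₀) (hε₁ : 0 < ε₁)
    (hdisj : Disjoint (klClass (distOf μ f₀) ε₀) (klClass (distOf μ f₁) ε₁)) :
    ∃ lam₀ lam₁ mu₀ mu₁ : ℝ, 0 < lam₀ ∧ 0 < lam₁ ∧
      ParamEquations μ f₀ f₁ ε₀ ε₁ lam₀ lam₁ mu₀ mu₁ := by
  obtain ⟨p, h₀, h₁, hmax⟩ := exists_dualFun_max hf₀ hf₁ hε₀ hε₁ hdisj
  obtain ⟨c₀, c₁, c₂, c₃⟩ := continuousAt_integral_dens hf₀ hf₁ h₀ h₁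
  -- along a line through the maximum the directional supergradient vanishes
  have line : ∀ (v : Param) {ψ : Param → ℝ}, ContinuousAt ψ p →
      (∀ t : ℝ, 0 < (p + t • v).1 → 0 < (p + t • v).2.1 →
        dualFun μ f₀ f₁ ε₀ ε₁ p ≤ dualFun μ f₀ f₁ ε₀ ε₁ (p + t • v) - t * ψ (p + t • v)) →
      ψ p = 0 := by
    intro v ψ hψ hle
    have hl : ContinuousAt (fun t : ℝ => p + t • v) 0 := by fun_prop
    have hp : p + (0 : ℝ) • v = p := by simp
    have hc : ContinuousAt (fun t : ℝ => ψ (p + t • v)) 0 :=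
      ContinuousAt.comp' (g := ψ) (by rwa [hp]) hl
    have e₀ : ∀ᶠ t : ℝ in 𝓝 0, 0 < (p + t • v).1 :=
      (continuous_fst.continuousAt.comp' hl).eventually_const_lt (by simpa using h₀)
    have e₁ : ∀ᶠ t : ℝ in 𝓝 0, 0 < (p + t • v).2.1 :=
      ((continuous_fst.comp continuous_snd).continuousAt.comp' hl).eventually_const_lt
        (by simpa using h₁)
    have hz := eq_zero_of_eventually_mul_nonpos hc (by
      filter_upwards [e₀, e₁] with t t0 t1
      linarith [hle t t0 t1, hmax _ t0 t1])
    simpa using hz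
  have z₀ := line (1, 0, 0, 0) (c₂.sub_const ε₀) fun t t0 t1 => by
    have h := dualFun_le_supergradient hf₀ hf₁ ε₀ ε₁ h₀ h₁ t0 t1
    refine h.trans (le_of_eq ?_)
    simp
    ring
  have z₁ := line (0, 1, 0, 0) (c₃.sub_const ε₁) fun t t0 t1 => by
    have h := dualFun_le_supergradient hf₀ hf₁ ε₀ ε₁ h₀ h₁ t0 t1
    refine h.trans (le_of_eq ?_)
    simp
    ring
  have z₂ := line (0, 0, 1, 0) (c₀.sub_const 1) fun t t0 t1 => by
    have h := dualFun_le_supergradient hf₀ hf₁ ε₀ ε₁ h₀ h₁ t0 t1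
    refine h.trans (le_of_eq ?_)
    simp
    ring
  have z₃ := line (0, 0, 0, 1) (c₁.sub_const 1) fun t t0 t1 => by
    have h := dualFun_le_supergradient hf₀ hf₁ ε₀ ε₁ h₀ h₁ t0 t1
    refine h.trans (le_of_eq ?_)
    simp
    ring
  obtain ⟨d₀, d₁, k₀, k₁⟩ := integrable_dens hf₀ hf₁ h₀ h₁
  have hpos := ae_dens_pos hf₀ hf₁ h₀ h₁
  have g₀ : IsPosDensity μ (dens₀ f₀ f₁ p) :=
    ⟨measurable_dens₀ hf₀.1 hf₁.1 p, hpos.mono fun y h => h.1, d₀, sub_eq_zero.1 z₂⟩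
  have g₁ : IsPosDensity μ (dens₁ f₀ f₁ p) :=
    ⟨measurable_dens₁ hf₀.1 hf₁.1 p, hpos.mono fun y h => h.2, d₁, sub_eq_zero.1 z₃⟩
  refine ⟨p.1, p.2.1, p.2.2.1, p.2.2.2, h₀, h₁, sub_eq_zero.1 z₂, sub_eq_zero.1 z₃, ?_, ?_⟩
  · have h := (klDiv_of_integral_mul_log hf₀ g₀ k₀).1
    rw [sub_eq_zero.1 z₀] at h
    exact h
  · have h := (klDiv_of_integral_mul_log hf₁ g₁ k₁).1
    rw [sub_eq_zero.1 z₁] at h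
    exact h

end Attained

end RobustNP

end

theorem theorem3 {Ω : Type*} [MeasurableSpace Ω] (μ : Measure Ω) [SigmaFinite μ]
    (f₀ f₁ : Ω → ℝ) (hf₀ : RobustNP.IsPosDensity μ f₀) (hf₁ : RobustNP.IsPosDensity μ f₁)
    (ε₀ ε₁ : ℝ) (hε₀ : 0 < ε₀) (hε₁ : 0 < ε₁)
    (hdisj : Disjoint (RobustNP.klClass (RobustNP.distOf μ f₀) ε₀)
      (RobustNP.klClass (RobustNP.distOf μ f₁) ε₁)) :
    -- Type-I test
    ((∃ lam₀ lam₁ mu₀ mu₁ : ℝ, 0 < lam₀ ∧ 0 < lam₁ ∧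
        RobustNP.ParamEquations μ f₀ f₁ ε₀ ε₁ lam₀ lam₁ mu₀ mu₁) ∧
      ∀ lam₀ lam₁ mu₀ mu₁ : ℝ, 0 < lam₀ → 0 < lam₁ →
        RobustNP.ParamEquations μ f₀ f₁ ε₀ ε₁ lam₀ lam₁ mu₀ mu₁ →
        ∀ g₀ g₁ : Ω → ℝ,
          g₀ = RobustNP.paramDensity₀ lam₀ lam₁ mu₀ mu₁ f₀ f₁ →
          g₁ = RobustNP.paramDensity₁ lam₀ lam₁ mu₀ mu₁ f₀ f₁ →
          RobustNP.IsPosDensity μ g₀ ∧ RobustNP.IsPosDensity μ g₁ ∧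
          (∀ G₀ G₁ : Measure Ω,
            RobustNP.IsTypeILeastFavorable (RobustNP.klClass (RobustNP.distOf μ f₀) ε₀)
                (RobustNP.klClass (RobustNP.distOf μ f₁) ε₁) G₀ G₁ ↔
              G₀ = RobustNP.distOf μ g₀ ∧ G₁ = RobustNP.distOf μ g₁) ∧
          Integrable (fun y => Real.log (g₁ y / g₀ y)) (RobustNP.distOf μ g₀) ∧
          (∀ t₀ : ℝ, t₀ = ∫ y, Real.log (g₁ y / g₀ y) ∂(RobustNP.distOf μ g₀) →
            RobustNP.IsAsymptoticallyMinimaxRobust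
                (RobustNP.klClass (RobustNP.distOf μ f₀) ε₀)
                (RobustNP.klClass (RobustNP.distOf μ f₁) ε₁)
                (RobustNP.distOf μ g₀) (RobustNP.distOf μ g₁)
                (fun y => Real.log (g₁ y / g₀ y)) t₀ ∧
            Tendsto (RobustNP.upperRate (fun y => Real.log (g₁ y / g₀ y)) t₀
              (RobustNP.distOf μ g₀)) atTop (𝓝 0) ∧
            Tendsto (RobustNP.lowerRate (fun y => Real.log (g₁ y / g₀ y)) t₀
              (RobustNP.distOf μ g₁)) atTop
              (𝓝 (-(klDiv (RobustNP.distOf μ g₀) (RobustNP.distOf μ g₁) : EReal))))) ∧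
    -- Type-II test: the nominal data are interchanged, and so are the resulting densities
    ((∃ lam₀ lam₁ mu₀ mu₁ : ℝ, 0 < lam₀ ∧ 0 < lam₁ ∧
        RobustNP.ParamEquations μ f₁ f₀ ε₁ ε₀ lam₀ lam₁ mu₀ mu₁) ∧
      ∀ lam₀ lam₁ mu₀ mu₁ : ℝ, 0 < lam₀ → 0 < lam₁ →
        RobustNP.ParamEquations μ f₁ f₀ ε₁ ε₀ lam₀ lam₁ mu₀ mu₁ →
        ∀ g₀ g₁ : Ω → ℝ,
          g₁ = RobustNP.paramDensity₀ lam₀ lam₁ mu₀ mu₁ f₁ f₀ →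
          g₀ = RobustNP.paramDensity₁ lam₀ lam₁ mu₀ mu₁ f₁ f₀ →
          RobustNP.IsPosDensity μ g₀ ∧ RobustNP.IsPosDensity μ g₁ ∧
          (∀ G₀ G₁ : Measure Ω,
            RobustNP.IsTypeIILeastFavorable (RobustNP.klClass (RobustNP.distOf μ f₀) ε₀)
                (RobustNP.klClass (RobustNP.distOf μ f₁) ε₁) G₀ G₁ ↔
              G₀ = RobustNP.distOf μ g₀ ∧ G₁ = RobustNP.distOf μ g₁) ∧
          Integrable (fun y => Real.log (g₁ y / g₀ y)) (RobustNP.distOf μ g₁) ∧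
          (∀ t₁ : ℝ, t₁ = ∫ y, Real.log (g₁ y / g₀ y) ∂(RobustNP.distOf μ g₁) →
            RobustNP.IsAsymptoticallyMinimaxRobust
                (RobustNP.klClass (RobustNP.distOf μ f₀) ε₀)
                (RobustNP.klClass (RobustNP.distOf μ f₁) ε₁)
                (RobustNP.distOf μ g₀) (RobustNP.distOf μ g₁)
                (fun y => Real.log (g₁ y / g₀ y)) t₁ ∧
            Tendsto (RobustNP.lowerRate (fun y => Real.log (g₁ y / g₀ y)) t₁
              (RobustNP.distOf μ g₁)) atTop (𝓝 0) ∧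
            Tendsto (RobustNP.upperRate (fun y => Real.log (g₁ y / g₀ y)) t₁
              (RobustNP.distOf μ g₀)) atTop
              (𝓝 (-(klDiv (RobustNP.distOf μ g₁) (RobustNP.distOf μ g₀) : EReal))))) := by
  open RobustNP in
  refine ⟨⟨exists_paramEquations hf₀ hf₁ hε₀ hε₁ hdisj, ?_⟩,
    ⟨exists_paramEquations hf₁ hf₀ hε₁ hε₀ hdisj.symm, ?_⟩⟩
  · rintro lam₀ lam₁ mu₀ mu₁ h₀ h₁ heq g₀ g₁ rfl rfl
    have K := heq.isKKTPair hf₀ hf₁ hε₀ hε₁ h₀ h₁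
    refine ⟨K.density₀, K.density₁, K.isTypeILeastFavorable_iff, ?_, fun t ht => ?_⟩
    · exact K.integrable_log₀.neg.congr (ae_of_all _ fun y => (log_div_swap _ _).symm)
    · exact K.typeI_robust hdisj ht
  · rintro lam₀ lam₁ mu₀ mu₁ h₀ h₁ heq g₀ g₁ rfl rfl
    have K := heq.isKKTPair hf₁ hf₀ hε₁ hε₀ h₀ h₁
    refine ⟨K.density₁, K.density₀, fun G₀ G₁ => ?_, K.integrable_log₀, fun t ht => ?_⟩
    · rw [isTypeIILeastFavorable_iff_swap, K.isTypeILeastFavorable_iff, and_comm]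
    · exact K.typeII_robust hdisj ht
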